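/- Let $n,m\ge 0$ be integers. Write $\mathbb T=\{|z|=1\}$, $\mathbb D=\{|z|<1\}$, let $\mathcal L_{n,m}$ be the complex span of the Laurent monomials $z^sw^t$ with $|s|\le n$, $|t|\le m$, and let $\mathcal P_{k,l}$ be the complex span of the monomials $z^sw^t$ with $0\le s\le k$, $0\le t\le l$ (so that $\mathcal P_{k,l}=\{0\}$ if $k=-1$ or $l=-1$). A linear form $\mathcal T:\mathcal L_{n,m}\to\mathbb C$ is called positive if $\mathcal T\big(f(z,w)\bar f(1/z,1/w)\big)>0$ for every nonzero $f\in\mathcal P_{n,m}$, where $\bar f(z,w)=\overline{f(\bar z,\bar w)}$; it then defines the inner product $\langle f,g\rangle_{\mathcal T}=\mathcal T\big(f(z,w)\bar g(1/z,1/w)\big)$ on $\mathcal P_{n,m}$. With respect to this inner product put \[ \mathcal F^1_{n-1,m}=\mathcal P_{n-1,m}\ominus\mathcal P_{n-1,m-1},\qquad \mathcal F^2_{n,m-1}=\mathcal P_{n,m-1}\ominus\mathcal P_{n-1,m-1}. \] **Corollary (Geronimo–Woerdeman).** Let $\mathcal T$ be a positive linear form on $\mathcal L_{n,m}$. There exists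 a polynomial $p\in\mathbb C[z,w]$ with no zeros on the closed bidisk $\overline{\mathbb D}\times\overline{\mathbb D}$, of degree at most $n$ in $z$ and at most $m$ in $w$, such that \[ \mathcal T(z^jw^k)=\int_{\mathbb T^2}z^jw^k\,\frac{|dz|\,|dw|}{(2\pi)^2|p(z,w)|^2}\qquad\text{for all integers } |j|\le n,\ |k|\le m, \] if and only if $\mathcal F^1_{n-1,m}\perp\mathcal F^2_{n,m-1}$ with respect to $\langle\cdot,\cdot\rangle_{\mathcal T}$. -/

import Mathlib

open scoped ComplexOrder

noncomputable section

namespace BernsteinSzego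

/-- The ring `ℂ[z, z⁻¹, w, w⁻¹]` of Laurent polynomials in two variables; the exponent `(s, t)`
stands for the monomial `z ^ s * w ^ t`. -/
abbrev Laurent : Type := AddMonoidAlgebra ℂ (ℤ × ℤ)

/-- The monomial `z ^ s * w ^ t`. -/
def mono (s t : ℤ) : Laurent := AddMonoidAlgebra.single (s, t) 1

/-- `𝓛_{j,k}`: the complex span of the monomials `z ^ s * w ^ t`, `|s| ≤ j`, `|t| ≤ k`. -/
def laurentSpace (j k : ℤ) : Submodule ℂ Laurent :=
  Submodule.span ℂ {f | ∃ s t : ℤ, |s| ≤ j ∧ |t| ≤ k ∧ f = mono s t}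

/-- `𝓟_{j,k}`: the complex span of the monomials `z ^ s * w ^ t`, `0 ≤ s ≤ j`, `0 ≤ t ≤ k`.
It is the zero space if `j = -1` or `k = -1`. -/
def polySpace (j k : ℤ) : Submodule ℂ Laurent :=
  Submodule.span ℂ {f | ∃ s t : ℤ, (0 ≤ s ∧ s ≤ j) ∧ (0 ≤ t ∧ t ≤ k) ∧ f = mono s t}

/-- The conjugate-linear ring homomorphism `f(z, w) ↦ f̄(1/z, 1/w)`, where
`f̄(z, w) = conj (f (conj z, conj w))`: coefficients are conjugated and exponents negated. -/
def conjInv : Laurent →+* Laurent :=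
  (AddMonoidAlgebra.mapDomainRingHom ℂ (-AddMonoidHom.id (ℤ × ℤ))).comp
    (AddMonoidAlgebra.mapRingHom (ℤ × ℤ) (starRingEnd ℂ))

theorem conjInv_single (s t : ℤ) (c : ℂ) :
    conjInv (AddMonoidAlgebra.single (s, t) c) =
      AddMonoidAlgebra.single (-s, -t) (starRingEnd ℂ c) := by
  simp [conjInv]

theorem conjInv_smul (c : ℂ) (f : Laurent) :
    conjInv (c • f) = starRingEnd ℂ c • conjInv f := by
  have h : ∀ (c : ℂ) (f : Laurent), c • f = AddMonoidAlgebra.single ((0 : ℤ), (0 : ℤ)) c * f := by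
    intro c f
    ext x
    have h0 : ((0 : ℤ), (0 : ℤ)) = 0 := rfl
    simp [h0]
  rw [h, map_mul, conjInv_single, neg_zero, ← h]

theorem mono_mem_laurentSpace {n m j k : ℤ} (hj : |j| ≤ n) (hk : |k| ≤ m) :
    mono j k ∈ laurentSpace n m :=
  Submodule.subset_span ⟨j, k, hj, hk, rfl⟩

theorem mul_conjInv_mem {n m : ℤ} {f g : Laurent}
    (hf : f ∈ polySpace n m) (hg : g ∈ polySpace n m) :
    f * conjInv g ∈ laurentSpace n m := by
  unfold polySpace at hf hg
  induction hf using Submodule.span_induction with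
  | zero => simp
  | add x y _ _ hx hy => rw [add_mul]; exact Submodule.add_mem _ hx hy
  | smul a x _ hx => rw [smul_mul_assoc]; exact Submodule.smul_mem _ _ hx
  | mem x hx =>
    obtain ⟨s, t, hs, ht, rfl⟩ := hx
    induction hg using Submodule.span_induction with
    | zero => simp
    | add x y _ _ hx hy => rw [map_add, mul_add]; exact Submodule.add_mem _ hx hy
    | smul a x _ hx =>
      rw [conjInv_smul, mul_smul_comm]; exact Submodule.smul_mem _ _ hx
    | mem y hy =>
      obtain ⟨s', t', hs', ht', rfl⟩ := hy
      have h : mono s t * conjInv (mono s' t') = mono (s - s') (t - t') := by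
        simp [mono, conjInv_single, AddMonoidAlgebra.single_mul_single, sub_eq_add_neg]
      rw [h]
      exact mono_mem_laurentSpace (abs_le.2 ⟨by omega, by omega⟩) (abs_le.2 ⟨by omega, by omega⟩)

/-- The sesquilinear form `⟨f, g⟩_T = T (f(z, w) ḡ(1/z, 1/w))` on `𝓟_{n,m}` (linear in `f`,
conjugate-linear in `g`) defined by a linear form `T` on `𝓛_{n,m}`. -/
def form {n m : ℤ} (T : laurentSpace n m →ₗ[ℂ] ℂ) :
    polySpace n m →ₗ[ℂ] polySpace n m →ₗ⋆[ℂ] ℂ :=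
  LinearMap.mk₂'ₛₗ (RingHom.id ℂ) (starRingEnd ℂ)
    (fun f g => T ⟨(f : Laurent) * conjInv (g : Laurent), mul_conjInv_mem f.2 g.2⟩)
    (by
      intro f₁ f₂ g
      rw [← map_add]; congr 1; ext1; simp [add_mul])
    (by
      intro c f g
      rw [← map_smul]; congr 1; ext1; simp)
    (by
      intro f g₁ g₂
      rw [← map_add]; congr 1; ext1; simp [mul_add])
    (by
      intro c f g
      rw [← map_smul]; congr 1; ext1; simp [conjInv_smul])

/-- `T` is positive: `T (f(z, w) f̄(1/z, 1/w)) > 0` (real and positive) for every nonzero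
`f ∈ 𝓟_{n,m}`. -/
def IsPositive {n m : ℤ} (T : laurentSpace n m →ₗ[ℂ] ℂ) : Prop :=
  ∀ f : polySpace n m, f ≠ 0 → 0 < form T f f

/-- `𝓟_{k,l}` as a subspace of `𝓟_{n,m}` (for `k ≤ n`, `l ≤ m`). -/
def subPoly (n m k l : ℤ) : Submodule ℂ (polySpace n m) :=
  (polySpace k l).comap (polySpace n m).subtype

/-- `S ⊖ R`: the elements of `S` which are orthogonal to `R` with respect to `⟨·, ·⟩_T`. -/
def ominus {n m : ℤ} (T : laurentSpace n m →ₗ[ℂ] ℂ) (S R : Submodule ℂ (polySpace n m)) :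
    Submodule ℂ (polySpace n m) :=
  S ⊓ R.orthogonalBilin (form T).flip

/-- `𝓕¹_{k,l} = 𝓟_{k,l} ⊖ 𝓟_{k,l-1}`. -/
def F1 {n m : ℤ} (T : laurentSpace n m →ₗ[ℂ] ℂ) (k l : ℤ) : Submodule ℂ (polySpace n m) :=
  ominus T (subPoly n m k l) (subPoly n m k (l - 1))

/-- `𝓕²_{k,l} = 𝓟_{k,l} ⊖ 𝓟_{k-1,l}`. -/
def F2 {n m : ℤ} (T : laurentSpace n m →ₗ[ℂ] ℂ) (k l : ℤ) : Submodule ℂ (polySpace n m) :=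
  ominus T (subPoly n m k l) (subPoly n m (k - 1) l)

/-- The subspaces `S` and `R` of `𝓟_{n,m}` are orthogonal with respect to `⟨·, ·⟩_T`. -/
def Orthogonal {n m : ℤ} (T : laurentSpace n m →ₗ[ℂ] ℂ) (S R : Submodule ℂ (polySpace n m)) :
    Prop :=
  ∀ f ∈ S, ∀ g ∈ R, form T f g = 0

/-- `p(z, w)` has no zeros on the closed bidisk. -/
def IsStable (p : MvPolynomial (Fin 2) ℂ) : Prop :=
  ∀ z w : ℂ, ‖z‖ ≤ 1 → ‖w‖ ≤ 1 → MvPolynomial.eval ![z, w] p ≠ 0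

/-- The moment `∫_{𝕋²} z ^ j * w ^ k |dz||dw| / ((2π)² |p(z, w)|²)`, with `z = exp (iθ)` and
`w = exp (iφ)`. -/
def bsMoment (p : MvPolynomial (Fin 2) ℂ) (j k : ℤ) : ℂ :=
  ∫ θ in (0 : ℝ)..(2 * Real.pi), ∫ φ in (0 : ℝ)..(2 * Real.pi),
    Complex.exp (θ * Complex.I) ^ j * Complex.exp (φ * Complex.I) ^ k /
      ((2 * Real.pi) ^ 2 *
        (‖MvPolynomial.eval ![Complex.exp (θ * Complex.I), Complex.exp (φ * Complex.I)] p‖ : ℂ) ^ 2)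

end BernsteinSzego

end

open scoped ComplexOrder

noncomputable section

namespace BernsteinSzego

open ComplexConjugate

/-! ### Monomials, reversal, the form and its orthonormal bases -/

section

/-! Split off the variable w: an element of `𝓟_{n,m-1}` is a row of m polynomials in z (its `col`s).
An orthonormal basis of `𝓖 = 𝓟_{n,m-1} ⊖ z 𝓟_{n-1,m-1}` gives an m × m matrix polynomial Γ,
invertible on the closed disk (`det_matG_ne_zero`), and the matrix Bernstein–Szegő theorem
`sesq_eq_gform` represents the form on `𝓟_{n,m-1}` by the weight Γ⁻¹Γ⁻ᴴ on |z| = 1. A stable p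
supplies a second weight: for |z| = 1, the Toeplitz matrix W(z) (`matW`) of the moments in w of
1/|p(z,·)|². Both directions go through the equality W = Γ⁻¹Γ⁻ᴴ on the circle.

From moments to orthogonality. The two weights have the same integrals against products φψ̄ of
polynomials in z of degree at most n, and W⁻¹ is built from such products by the Gohberg–Semencul
formula (`toeplitz_inverse`, `gsX_identity`). With M = ΓWΓᴴ, the traces of M and of M⁻¹ therefore
both have circle average m. Since tr(M + M⁻¹ - 2) ≥ 0, with equality only for M = 1, the weights
coincide (`matW_eq_weightG`). The recurrence for the moments of 1/|p|² and the analyticity of Γ⁻¹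
then make 𝓖 orthogonal to z^j w⁻¹ for 1 ≤ j ≤ n (`sesq_bsLin_neg_one`), which after reversal says 𝓕¹
⊥ 𝓕² (`orth_of_sesq_neg_one`).

From orthogonality to moments. Take for p the normalized element of `𝓟_{n,m}` orthogonal to
everything without constant term. If 𝓕¹ ⊥ 𝓕², then bases of `𝓟_{n-1,m-1}`, 𝓕¹ and 𝓕², together with
the reversal of p, form an orthonormal basis of `𝓟_{n,m}`. Reversal is antiunitary, so the reversed
basis has the same reproducing kernel; comparing the two expressions gives `christoffel_darboux`. On
the diagonal, and by a limiting argument on the torus, this yields stability (`IsExtremal.lStable`).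
For |z| = 1 it is the Gohberg–Semencul identity with inverse matrix ΓᴴΓ, so again the weights
coincide. Hence the moments agree for |t| < m and, exchanging the variables, for |s| < n. The corner
(n, m) follows from the orthogonality defining p, the corner (n, -m) from 𝓖 ⊥ z^n w⁻¹, and the
others by conjugation (`IsExtremal.apply_mono`). -/

theorem mem_polySpace {k l : ℤ} {f : Laurent} :
    f ∈ polySpace k l ↔
      ∀ s t : ℤ, f.coeff (s, t) ≠ 0 → (0 ≤ s ∧ s ≤ k) ∧ (0 ≤ t ∧ t ≤ l) := by
  have h : polySpace k l = AddMonoidAlgebra.supported ℂ ℂ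
      {x : ℤ × ℤ | (0 ≤ x.1 ∧ x.1 ≤ k) ∧ (0 ≤ x.2 ∧ x.2 ≤ l)} := by
    rw [AddMonoidAlgebra.supported_eq_span_single, polySpace]
    congr 1
    ext f
    simp only [Set.mem_ofPred_eq, Set.mem_image, Prod.exists, mono]
    constructor
    · rintro ⟨s, t, hs, ht, rfl⟩; exact ⟨s, t, ⟨hs, ht⟩, rfl⟩
    · rintro ⟨s, t, ⟨hs, ht⟩, rfl⟩; exact ⟨s, t, hs, ht, rfl⟩
  rw [h, AddMonoidAlgebra.mem_supported']
  constructor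
  · intro h s t hst
    by_contra hc
    exact hst (h (s, t) hc)
  · rintro h ⟨s, t⟩ hst
    by_contra hc
    exact hst (h s t hc)

theorem mono_mem_polySpace {k l s t : ℤ} (hs : 0 ≤ s) (hs' : s ≤ k) (ht : 0 ≤ t) (ht' : t ≤ l) :
    mono s t ∈ polySpace k l :=
  Submodule.subset_span ⟨s, t, ⟨hs, hs'⟩, ⟨ht, ht'⟩, rfl⟩

theorem polySpace_mono {k l k' l' : ℤ} (hk : k ≤ k') (hl : l ≤ l') :
    polySpace k l ≤ polySpace k' l' := by
  intro f hf
  rw [mem_polySpace] at *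
  intro s t h
  have := hf s t h
  omega

theorem coeff_mono (s t a b : ℤ) :
    (mono s t).coeff (a, b) = if s = a ∧ t = b then 1 else 0 := by
  simp [mono, Finsupp.single_apply, Prod.ext_iff]

theorem coeff_mono_mul (s t : ℤ) (f : Laurent) (a b : ℤ) :
    (mono s t * f).coeff (a, b) = f.coeff (a - s, b - t) := by
  rw [mono, AddMonoidAlgebra.coeff_single_mul_apply, one_mul]
  congr 1
  simp [Prod.ext_iff]
  constructor <;> ring

theorem mono_mul_mono (s t s' t' : ℤ) : mono s t * mono s' t' = mono (s + s') (t + t') := by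
  simp [mono, AddMonoidAlgebra.single_mul_single]

theorem mono_zero : mono 0 0 = 1 := rfl

theorem conjInv_mono (s t : ℤ) : conjInv (mono s t) = mono (-s) (-t) := by
  simp [mono, conjInv_single]

theorem conjInv_conjInv (f : Laurent) : conjInv (conjInv f) = f := by
  induction f using AddMonoidAlgebra.induction_linear with
  | zero => simp
  | add x y hx hy => simp [hx, hy]
  | single m r => obtain ⟨s, t⟩ := m; simp [conjInv_single]

theorem coeff_conjInv (f : Laurent) (a b : ℤ) :
    (conjInv f).coeff (a, b) = conj (f.coeff (-a, -b)) := by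
  induction f using AddMonoidAlgebra.induction_linear with
  | zero => simp
  | add x y hx hy => simp [hx, hy]
  | single m r =>
    obtain ⟨s, t⟩ := m
    have : (-s = a ∧ -t = b) ↔ (s = -a ∧ t = -b) := by omega
    simp only [conjInv_single, AddMonoidAlgebra.coeff_single, Finsupp.single_apply, Prod.ext_iff,
      this]
    split_ifs <;> simp

/-- Multiplication by a monomial maps `𝓟_{k,l}` into `𝓟_{k',l'}`. -/
theorem mono_mul_mem {k l k' l' s t : ℤ} {f : Laurent} (hf : f ∈ polySpace k l)
    (hs : 0 ≤ s) (hs' : k + s ≤ k') (ht : 0 ≤ t) (ht' : l + t ≤ l') :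
    mono s t * f ∈ polySpace k' l' := by
  rw [mem_polySpace] at *
  intro a b h
  rw [coeff_mono_mul] at h
  have := hf _ _ h
  omega

theorem exists_eq_mono_mul {k l : ℤ} {f : Laurent} (hf : f ∈ polySpace k l)
    (h : ∀ t, f.coeff (0, t) = 0) :
    ∃ g ∈ polySpace (k - 1) l, f = mono 1 0 * g := by
  refine ⟨mono (-1) 0 * f, ?_, ?_⟩
  · rw [mem_polySpace] at *
    intro a b hab
    rw [coeff_mono_mul] at hab
    have h1 := hf _ _ hab
    have : a - -1 ≠ 0 := by
      intro h0
      rw [h0] at hab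
      exact hab (h _)
    omega
  · rw [← mul_assoc, mono_mul_mono]; norm_num [mono_zero]

/-- The reversal `f ↦ z ^ a * w ^ b * f̄(1/z, 1/w)`. -/
def rev (a b : ℤ) (f : Laurent) : Laurent := mono a b * conjInv f

theorem coeff_rev (a b : ℤ) (f : Laurent) (s t : ℤ) :
    (rev a b f).coeff (s, t) = conj (f.coeff (a - s, b - t)) := by
  rw [rev, coeff_mono_mul, coeff_conjInv]
  congr 3 <;> ring_nf

theorem rev_rev (a b : ℤ) (f : Laurent) : rev a b (rev a b f) = f := by
  rw [rev, rev, map_mul, conjInv_conjInv, conjInv_mono, ← mul_assoc, mono_mul_mono]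
  simp [mono_zero]

theorem rev_mem {a b : ℤ} {f : Laurent} (hf : f ∈ polySpace a b) : rev a b f ∈ polySpace a b := by
  rw [mem_polySpace] at *
  intro s t h
  rw [coeff_rev] at h
  have := hf _ _ (fun h0 => h (by rw [h0, map_zero]))
  omega

theorem rev_smul (a b : ℤ) (c : ℂ) (f : Laurent) : rev a b (c • f) = conj c • rev a b f := by
  simp [rev, conjInv_smul]

theorem rev_sum {ι : Type*} (s : Finset ι) (a b : ℤ) (f : ι → Laurent) :
    rev a b (∑ i ∈ s, f i) = ∑ i ∈ s, rev a b (f i) := by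
  simp [rev, Finset.mul_sum]

theorem mono_mul_rev (s t a b : ℤ) (f : Laurent) :
    mono s t * rev a b f = rev (s + a) (t + b) f := by
  rw [rev, rev, ← mul_assoc, mono_mul_mono]

/-- The sesquilinear form `(f, g) ↦ L (f(z, w) ḡ(1/z, 1/w))` on Laurent polynomials. -/
def sesq (L : Laurent →ₗ[ℂ] ℂ) : Laurent →ₗ[ℂ] Laurent →ₗ⋆[ℂ] ℂ :=
  LinearMap.mk₂'ₛₗ (RingHom.id ℂ) (starRingEnd ℂ) (fun f g => L (f * conjInv g))
    (by intro f₁ f₂ g; simp [add_mul])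
    (by intro c f g; simp)
    (by intro f g₁ g₂; simp [mul_add])
    (by intro c f g; simp [conjInv_smul])

theorem sesq_apply (L : Laurent →ₗ[ℂ] ℂ) (f g : Laurent) : sesq L f g = L (f * conjInv g) := rfl

theorem sesq_mono (L : Laurent →ₗ[ℂ] ℂ) (s t s' t' : ℤ) :
    sesq L (mono s t) (mono s' t') = L (mono (s - s') (t - t')) := by
  rw [sesq_apply, conjInv_mono, mono_mul_mono]; rfl

theorem sesq_mono_mul (L : Laurent →ₗ[ℂ] ℂ) (s t : ℤ) (f g : Laurent) :
    sesq L (mono s t * f) (mono s t * g) = sesq L f g := by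
  have h : mono s t * f * (mono (-s) (-t) * conjInv g) = f * conjInv g := by
    have h1 : mono s t * mono (-s) (-t) = 1 := by
      rw [mono_mul_mono, add_neg_cancel, add_neg_cancel, mono_zero]
    linear_combination (f * conjInv g) * h1
  rw [sesq_apply, map_mul conjInv, conjInv_mono, h, sesq_apply]

/-- Reversal is antiunitary: the monomial cancels against its own `conjInv`, and the involution
exchanges the two factors. -/
theorem sesq_rev (L : Laurent →ₗ[ℂ] ℂ) (a b : ℤ) (f g : Laurent) :
    sesq L (rev a b f) (rev a b g) = sesq L g f := by
  rw [rev, rev, sesq_mono_mul, sesq_apply, conjInv_conjInv, mul_comm, sesq_apply]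

/-- `L` is hermitian on `𝓛_{n,m}` and defines an inner product on `𝓟_{n,m}`. -/
structure PosOn (L : Laurent →ₗ[ℂ] ℂ) (n m : ℤ) : Prop where
  herm : ∀ f ∈ laurentSpace n m, L (conjInv f) = conj (L f)
  pos : ∀ f ∈ polySpace n m, f ≠ 0 → 0 < (sesq L f f).re

theorem PosOn.symm {L : Laurent →ₗ[ℂ] ℂ} {n m : ℤ} (hL : PosOn L n m) {f g : Laurent}
    (hf : f ∈ polySpace n m) (hg : g ∈ polySpace n m) : sesq L g f = conj (sesq L f g) := by
  rw [sesq_apply, sesq_apply, ← hL.herm _ (mul_conjInv_mem hf hg), map_mul conjInv, conjInv_conjInv,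
    mul_comm]

theorem PosOn.self_eq {L : Laurent →ₗ[ℂ] ℂ} {n m : ℤ} (hL : PosOn L n m) {f : Laurent}
    (hf : f ∈ polySpace n m) : sesq L f f = ((sesq L f f).re : ℂ) :=
  (Complex.conj_eq_iff_re.1 (hL.symm hf hf).symm).symm

theorem PosOn.nonneg {L : Laurent →ₗ[ℂ] ℂ} {n m : ℤ} (hL : PosOn L n m) {f : Laurent}
    (hf : f ∈ polySpace n m) : 0 ≤ (sesq L f f).re := by
  by_cases h : f = 0
  · simp [h]
  · exact (hL.pos f hf h).le

theorem PosOn.eq_zero {L : Laurent →ₗ[ℂ] ℂ} {n m : ℤ} (hL : PosOn L n m) {f : Laurent}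
    (hf : f ∈ polySpace n m) (h : sesq L f f = 0) : f = 0 := by
  by_contra h0
  have := hL.pos f hf h0
  simp [h] at this

/-- `e` is an orthonormal basis of `S` with respect to `sesq L`. -/
structure IsONB (L : Laurent →ₗ[ℂ] ℂ) (S : Submodule ℂ Laurent) {ι : Type*} [Fintype ι]
    [DecidableEq ι] (e : ι → Laurent) : Prop where
  mem : ∀ i, e i ∈ S
  inner : ∀ i j, sesq L (e i) (e j) = if i = j then 1 else 0
  expand : ∀ x ∈ S, x = ∑ i, sesq L x (e i) • e i

instance finiteDimensional_polySpace (k l : ℤ) : FiniteDimensional ℂ (polySpace k l) := by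
  apply FiniteDimensional.span_of_finite
  have : {f | ∃ s t : ℤ, (0 ≤ s ∧ s ≤ k) ∧ (0 ≤ t ∧ t ≤ l) ∧ f = mono s t} ⊆
      (fun x : ℤ × ℤ => mono x.1 x.2) '' (Set.Icc 0 k ×ˢ Set.Icc 0 l) := by
    rintro f ⟨s, t, hs, ht, rfl⟩
    exact ⟨(s, t), ⟨hs, ht⟩, rfl⟩
  exact (((Set.finite_Icc _ _).prod (Set.finite_Icc _ _)).image _).subset this

theorem PosOn.exists_isONB {L : Laurent →ₗ[ℂ] ℂ} {n m : ℤ} (hL : PosOn L n m)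
    {S : Submodule ℂ Laurent} (hS : S ≤ polySpace n m) :
    ∃ e : Fin (Module.finrank ℂ S) → Laurent, IsONB L S e := by
  have : FiniteDimensional ℂ S := Submodule.finiteDimensional_of_le hS
  let core : InnerProductSpace.Core ℂ S :=
    -- The arguments are exchanged because Mathlib's inner product is conjugate-linear in the first
    -- one.
    { inner := fun x y => sesq L (y : Laurent) (x : Laurent)
      conj_inner_symm := fun x y => (hL.symm (hS x.2) (hS y.2)).symm
      re_inner_nonneg := fun x => hL.nonneg (hS x.2)
      add_left := fun x y z => by simp
      smul_left := fun x y r => by simp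
      definite := fun x h => Subtype.ext (hL.eq_zero (hS x.2) h) }
  let : NormedAddCommGroup S := core.toNormedAddCommGroup
  let : InnerProductSpace ℂ S := InnerProductSpace.ofCore core.toCore
  let b := stdOrthonormalBasis ℂ S
  refine ⟨fun i => b i, fun i => (b i).2, fun i j => ?_, fun x hx => ?_⟩
  · have := orthonormal_iff_ite.1 b.orthonormal j i
    simp only [eq_comm (a := i)]
    exact this
  · have := congrArg (Subtype.val) (b.sum_repr' ⟨x, hx⟩)
    simp only [Submodule.coe_sum, Submodule.coe_smul] at this
    exact this.symm

/-- `S ⊖ R` with respect to `sesq L`. -/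
def perp (L : Laurent →ₗ[ℂ] ℂ) (S R : Submodule ℂ Laurent) : Submodule ℂ Laurent where
  carrier := {x | x ∈ S ∧ ∀ y ∈ R, sesq L x y = 0}
  zero_mem' := ⟨S.zero_mem, by simp⟩
  add_mem' := fun hx hy => ⟨S.add_mem hx.1 hy.1, fun y h => by simp [hx.2 y h, hy.2 y h]⟩
  smul_mem' := fun c _ hx => ⟨S.smul_mem c hx.1, fun y h => by simp [hx.2 y h]⟩

theorem mem_perp {L : Laurent →ₗ[ℂ] ℂ} {S R : Submodule ℂ Laurent} {x : Laurent} :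
    x ∈ perp L S R ↔ x ∈ S ∧ ∀ y ∈ R, sesq L x y = 0 := Iff.rfl

variable {L : Laurent →ₗ[ℂ] ℂ} {ι κ : Type*} [Fintype ι] [DecidableEq ι] [Fintype κ]
  [DecidableEq κ]

theorem IsONB.sesq_sum {S : Submodule ℂ Laurent} {e : ι → Laurent} (he : IsONB L S e)
    (c : ι → ℂ) (j : ι) : sesq L (∑ i, c i • e i) (e j) = c j := by
  simp [he.inner]

/-- The remainder of the orthogonal projection is orthogonal. -/
theorem IsONB.sub_perp {R : Submodule ℂ Laurent} {e : ι → Laurent} (he : IsONB L R e)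
    (x : Laurent) {y : Laurent} (hy : y ∈ R) :
    sesq L (x - ∑ i, sesq L x (e i) • e i) y = 0 := by
  rw [he.expand y hy, map_sum]
  apply Finset.sum_eq_zero
  intro j _
  rw [map_smulₛₗ, map_sub, LinearMap.sub_apply, he.sesq_sum, sub_self, smul_zero]

/-- The remainder of the projection onto R lies in S ⊖ R, so a basis of the complement completes the
expansion. -/
theorem IsONB.sum_elim {n m : ℤ} (hL : PosOn L n m) {S R : Submodule ℂ Laurent}
    (hS : S ≤ polySpace n m) (hR : R ≤ S) {e : ι → Laurent} {a : κ → Laurent}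
    (he : IsONB L R e) (ha : IsONB L (perp L S R) a) : IsONB L S (Sum.elim e a) := by
  have hae : ∀ i j, sesq L (a j) (e i) = 0 := fun i j => (ha.mem j).2 _ (he.mem i)
  have hea : ∀ i j, sesq L (e i) (a j) = 0 := fun i j => by
    rw [hL.symm (hS (ha.mem j).1) (hS (hR (he.mem i))), hae, map_zero]
  refine ⟨?_, ?_, ?_⟩
  · rintro (i | j)
    exacts [hR (he.mem i), (ha.mem j).1]
  · rintro (i | i) (j | j)
    · simp [he.inner]
    · simp [hea]
    · simp [hae]
    · simp [ha.inner]
  · intro x hx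
    have h1 : x - ∑ i, sesq L x (e i) • e i ∈ perp L S R :=
      ⟨S.sub_mem hx (S.sum_mem fun i _ => S.smul_mem _ (hR (he.mem i))),
        fun y hy => he.sub_perp x hy⟩
    have h2 := ha.expand _ h1
    have h3 : ∀ j, sesq L (x - ∑ i, sesq L x (e i) • e i) (a j) = sesq L x (a j) := by
      intro j
      simp [hea]
    simp only [h3] at h2
    rw [Fintype.sum_sum_type]
    simp only [Sum.elim_inl, Sum.elim_inr]
    rw [← h2]
    abel

/-- The reproducing kernel of a subspace does not depend on the orthonormal basis. -/
theorem IsONB.kernel_eq {n m : ℤ} (hL : PosOn L n m) {S : Submodule ℂ Laurent}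
    (hS : S ≤ polySpace n m) {e : ι → Laurent} {a : κ → Laurent}
    (he : IsONB L S e) (ha : IsONB L S a) (φ ψ : Laurent →ₗ[ℂ] ℂ) :
    ∑ i, φ (e i) * conj (ψ (e i)) = ∑ j, φ (a j) * conj (ψ (a j)) := by
  have h1 : ∀ i, φ (e i) = ∑ j, sesq L (e i) (a j) * φ (a j) := fun i => by
    conv_lhs => rw [ha.expand _ (he.mem i)]
    simp
  have h2 : ∀ j, ψ (a j) = ∑ i, sesq L (a j) (e i) * ψ (e i) := fun j => by
    conv_lhs => rw [he.expand _ (ha.mem j)]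
    simp
  calc ∑ i, φ (e i) * conj (ψ (e i))
      = ∑ i, ∑ j, φ (a j) * (sesq L (e i) (a j) * conj (ψ (e i))) := by
        refine Finset.sum_congr rfl fun i _ => ?_
        rw [h1 i, Finset.sum_mul]
        exact Finset.sum_congr rfl fun j _ => by ring
    _ = ∑ j, φ (a j) * conj (ψ (a j)) := by
        rw [Finset.sum_comm]
        refine Finset.sum_congr rfl fun j _ => ?_
        rw [h2 j, map_sum, Finset.mul_sum]
        refine Finset.sum_congr rfl fun i _ => ?_
        rw [map_mul, hL.symm (hS (he.mem i)) (hS (ha.mem j)), Complex.conj_conj]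

/-- In the expansion, the conjugation of scalars by `rev` cancels against the exchange of arguments
in `sesq_rev`. -/
theorem IsONB.map_rev {n m a b : ℤ} (hL : PosOn L n m) {S S' : Submodule ℂ Laurent}
    (hSn : S ≤ polySpace n m) {e : ι → Laurent} (he : IsONB L S e) (hS : ∀ x ∈ S, rev a b x ∈ S')
    (hS' : ∀ x ∈ S', rev a b x ∈ S) : IsONB L S' (fun i => rev a b (e i)) := by
  refine ⟨fun i => hS _ (he.mem i), fun i j => ?_, fun x hx => ?_⟩
  · rw [sesq_rev, he.inner]
    simp [eq_comm]
  · have h1 := he.expand _ (hS' x hx)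
    conv_lhs => rw [← rev_rev a b x, h1]
    rw [rev_sum]
    refine Finset.sum_congr rfl fun i _ => ?_
    rw [rev_smul]
    congr 1
    conv_rhs => rw [← rev_rev a b x, sesq_rev, hL.symm (hSn (hS' x hx)) (hSn (he.mem i))]

end

/-! ### The space 𝓖 and the matrix polynomial Γ -/

section

theorem laurentSpace_mono {k l k' l' : ℤ} (hk : k ≤ k') (hl : l ≤ l') :
    laurentSpace k l ≤ laurentSpace k' l' := by
  apply Submodule.span_mono
  rintro f ⟨s, t, hs, ht, rfl⟩
  exact ⟨s, t, hs.trans hk, ht.trans hl, rfl⟩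

theorem PosOn.mono {L : Laurent →ₗ[ℂ] ℂ} {k l k' l' : ℤ} (hL : PosOn L k' l') (hk : k ≤ k')
    (hl : l ≤ l') : PosOn L k l :=
  ⟨fun f hf => hL.herm f (laurentSpace_mono hk hl hf),
    fun f hf => hL.pos f (polySpace_mono hk hl hf)⟩

/-- Evaluation at `(z, w)`. -/
def ev (z w : ℂ) : Laurent →ₗ[ℂ] ℂ :=
  (Finsupp.linearCombination ℂ (fun x : ℤ × ℤ => z ^ x.1 * w ^ x.2)) ∘ₗ
    (AddMonoidAlgebra.coeffLinearEquiv ℂ : Laurent ≃ₗ[ℂ] _).toLinearMap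

/-- The value at `z` of the coefficient of `w ^ t`. -/
def col (t : ℤ) (z : ℂ) : Laurent →ₗ[ℂ] ℂ :=
  (Finsupp.linearCombination ℂ (fun x : ℤ × ℤ => if x.2 = t then z ^ x.1 else 0)) ∘ₗ
    (AddMonoidAlgebra.coeffLinearEquiv ℂ : Laurent ≃ₗ[ℂ] _).toLinearMap

/-- The coefficient of a monomial as a linear form. -/
def coeffLin (s t : ℤ) : Laurent →ₗ[ℂ] ℂ :=
  (Finsupp.lapply (s, t)) ∘ₗ
    (AddMonoidAlgebra.coeffLinearEquiv ℂ : Laurent ≃ₗ[ℂ] _).toLinearMap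

theorem coeffLin_apply (s t : ℤ) (f : Laurent) : coeffLin s t f = f.coeff (s, t) := rfl

theorem ev_mono (z w : ℂ) (s t : ℤ) : ev z w (mono s t) = z ^ s * w ^ t := by
  simp [ev, mono]

theorem col_mono (t : ℤ) (z : ℂ) (a b : ℤ) :
    col t z (mono a b) = if b = t then z ^ a else 0 := by
  simp [col, mono]

/-- Natural exponents suffice here, so identities proved this way also hold at z = 0 or w = 0, where
negative powers would misbehave. -/
theorem polySpace_induction {V : Type*} [AddCommGroup V] [Module ℂ V] {k l : ℤ}
    (φ ψ : Laurent →ₗ[ℂ] V)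
    (h : ∀ s t : ℕ, (s : ℤ) ≤ k → (t : ℤ) ≤ l → φ (mono s t) = ψ (mono s t)) {f : Laurent}
    (hf : f ∈ polySpace k l) : φ f = ψ f := by
  refine LinearMap.eqOn_span (s := {f | ∃ s t : ℤ, (0 ≤ s ∧ s ≤ k) ∧ (0 ≤ t ∧ t ≤ l) ∧
    f = mono s t}) ?_ hf
  rintro f ⟨s, t, ⟨hs, hs'⟩, ⟨ht, ht'⟩, rfl⟩
  lift s to ℕ using hs
  lift t to ℕ using ht
  exact h s t hs' ht'

theorem polySpace_expand {n m : ℕ} {f : Laurent} (hf : f ∈ polySpace n ((m : ℤ) - 1)) :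
    f = ∑ s ∈ Finset.range (n + 1), ∑ t ∈ Finset.range m, f.coeff (s, t) • mono s t := by
  have := polySpace_induction LinearMap.id
    (∑ s ∈ Finset.range (n + 1), ∑ t ∈ Finset.range m,
      (coeffLin s t).smulRight (mono s t)) (fun a b ha hb => ?_) hf
  · simpa [coeffLin_apply] using this
  · simp only [LinearMap.id_apply, LinearMap.sum_apply, LinearMap.smulRight_apply,
      coeffLin_apply, coeff_mono]
    rw [Finset.sum_eq_single a, Finset.sum_eq_single b]
    · simp
    · intro c _ hc; simp [Ne.symm hc]
    · intro h; exact absurd (Finset.mem_range.2 (by omega)) h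
    · intro c _ hc; simp [Ne.symm hc]
    · intro h; exact absurd (Finset.mem_range.2 (by omega)) h

theorem col_eq_sum {n : ℕ} {l : ℤ} {f : Laurent} (hf : f ∈ polySpace n l) (t : ℤ) (z : ℂ) :
    col t z f = ∑ s ∈ Finset.range (n + 1), f.coeff (s, t) * z ^ s := by
  have := polySpace_induction (col t z)
    (∑ s ∈ Finset.range (n + 1), (z ^ s) • (coeffLin s t)) (fun a b ha hb => ?_) hf
  · rw [this]
    simp only [LinearMap.sum_apply, LinearMap.smul_apply, coeffLin_apply, smul_eq_mul, mul_comm]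
  · simp only [LinearMap.sum_apply, LinearMap.smul_apply, coeffLin_apply, coeff_mono, col_mono]
    rw [Finset.sum_eq_single a]
    · by_cases h : (b : ℤ) = t <;> simp [h]
    · intro c _ hc; simp [Ne.symm hc]
    · intro h; exact absurd (Finset.mem_range.2 (by omega)) h

theorem ev_eq_sum {n m : ℕ} {f : Laurent} (hf : f ∈ polySpace n ((m : ℤ) - 1)) (z w : ℂ) :
    ev z w f = ∑ t ∈ Finset.range m, col t z f * w ^ t := by
  have := polySpace_induction (ev z w)
    (∑ t ∈ Finset.range m, (w ^ t) • (col t z)) (fun a b ha hb => ?_) hf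
  · rw [this]
    simp only [LinearMap.sum_apply, LinearMap.smul_apply, smul_eq_mul, mul_comm]
  · simp only [LinearMap.sum_apply, LinearMap.smul_apply, col_mono, ev_mono]
    rw [Finset.sum_eq_single b]
    · simp [mul_comm]
    · intro c _ hc; simp [Ne.symm hc]
    · intro h; exact absurd (Finset.mem_range.2 (by omega)) h

theorem col_mono_mul {k l : ℤ} {f : Laurent} (hf : f ∈ polySpace k l) (t : ℤ) (z : ℂ) :
    col t z (mono 1 0 * f) = z * col t z f := by
  refine polySpace_induction ((col t z) ∘ₗ LinearMap.mulLeft ℂ (mono 1 0)) (z • col t z)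
    (fun a b _ _ => ?_) hf
  have : (1 : ℤ) + a = ((a + 1 : ℕ) : ℤ) := by push_cast; ring
  simp only [LinearMap.comp_apply, LinearMap.mulLeft_apply, mono_mul_mono, col_mono, zero_add,
    LinearMap.smul_apply, smul_eq_mul, this, zpow_natCast, pow_succ']
  split_ifs <;> simp

theorem ev_mono_mul {k l : ℤ} {f : Laurent} (hf : f ∈ polySpace k l) (z w : ℂ) (a b : ℕ) :
    ev z w (mono a b * f) = z ^ a * w ^ b * ev z w f := by
  refine polySpace_induction ((ev z w) ∘ₗ LinearMap.mulLeft ℂ (mono a b))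
    ((z ^ a * w ^ b) • ev z w) (fun s t _ _ => ?_) hf
  have h1 : (a : ℤ) + s = ((a + s : ℕ) : ℤ) := by push_cast; ring
  have h2 : (b : ℤ) + t = ((b + t : ℕ) : ℤ) := by push_cast; ring
  simp only [LinearMap.comp_apply, LinearMap.mulLeft_apply, mono_mul_mono, ev_mono, 
    LinearMap.smul_apply, smul_eq_mul, h1, h2, zpow_natCast, pow_add]
  ring

theorem col_eq_zero_of_mem_zero {l : ℤ} {f : Laurent} (hf : f ∈ polySpace 0 l) (t : ℤ) (z : ℂ) :
    col t z f = f.coeff (0, t) := by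
  simpa using col_eq_sum (n := 0) hf t z

theorem differentiable_col {n : ℕ} {l : ℤ} {f : Laurent} (hf : f ∈ polySpace n l) (t : ℤ) :
    Differentiable ℂ (fun z => col t z f) := by
  simp_rw [col_eq_sum hf]
  fun_prop

/-- Division with remainder by `z - z₀`. -/
theorem exists_div (z₀ : ℂ) {n : ℕ} {l : ℤ} {f : Laurent} (hf : f ∈ polySpace n l) :
    ∃ h ∈ polySpace ((n : ℤ) - 1) l, ∃ r ∈ polySpace 0 l,
      f = mono 1 0 * h - z₀ • h + r := by
  unfold polySpace at hf
  induction hf using Submodule.span_induction with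
  | zero => exact ⟨0, Submodule.zero_mem _, 0, Submodule.zero_mem _, by simp⟩
  | add x y _ _ hx hy =>
    obtain ⟨h, hh, r, hr, rfl⟩ := hx
    obtain ⟨h', hh', r', hr', rfl⟩ := hy
    refine ⟨h + h', Submodule.add_mem _ hh hh', r + r', Submodule.add_mem _ hr hr', ?_⟩
    rw [mul_add, smul_add]; abel
  | smul a x _ hx =>
    obtain ⟨h, hh, r, hr, rfl⟩ := hx
    refine ⟨a • h, Submodule.smul_mem _ _ hh, a • r, Submodule.smul_mem _ _ hr, ?_⟩
    rw [smul_add, smul_sub, mul_smul_comm, smul_comm]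
  | mem x hx =>
    obtain ⟨s, t, ⟨hs, hs'⟩, ⟨ht, ht'⟩, rfl⟩ := hx
    lift s to ℕ using hs
    induction s with
    | zero =>
      exact ⟨0, Submodule.zero_mem _, mono 0 t, mono_mem_polySpace le_rfl le_rfl ht ht', by simp⟩
    | succ s ih =>
      obtain ⟨h, hh, r, hr, hf⟩ := ih (by push_cast at hs' ⊢; omega)
      refine ⟨z₀ • h + mono s t, Submodule.add_mem _ (Submodule.smul_mem _ _ hh)
        (mono_mem_polySpace (by omega) (by push_cast at hs'; omega) ht ht'), z₀ • r,
        Submodule.smul_mem _ _ hr, ?_⟩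
      have h1 : mono ((s + 1 : ℕ) : ℤ) t = mono 1 0 * mono s t := by
        rw [mono_mul_mono]; congr 1 <;> push_cast <;> ring
      rw [h1, mul_add, smul_add]
      conv_rhs => enter [1, 2, 2]; rw [hf]
      rw [smul_add, smul_sub, mul_smul_comm, smul_comm]
      abel

/-- At z = z₀ the multiple of z - z₀ disappears, so the remainder, which is constant in z, must
vanish. -/
theorem exists_eq_sub_mul {z₀ : ℂ} {n : ℕ} {l : ℤ} {f : Laurent} (hf : f ∈ polySpace n l)
    (h0 : ∀ t, col t z₀ f = 0) :
    ∃ h ∈ polySpace ((n : ℤ) - 1) l, f = mono 1 0 * h - z₀ • h := by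
  obtain ⟨h, hh, r, hr, hf'⟩ := exists_div z₀ hf
  have : r = 0 := by
    ext ⟨s, t⟩
    by_contra hc
    have hs : s = 0 := by have := mem_polySpace.1 hr s t hc; omega
    subst hs
    apply hc
    have := h0 t
    rw [hf', map_add, map_sub, col_mono_mul hh, map_smul, smul_eq_mul, sub_self, zero_add,
      col_eq_zero_of_mem_zero hr] at this
    simpa using this
  exact ⟨h, hh, by rw [hf', this, add_zero]⟩

/-- `z 𝓟_{k,l}`. -/
def shiftSpace (k l : ℤ) : Submodule ℂ Laurent :=
  (polySpace k l).map (LinearMap.mulLeft ℂ (mono 1 0))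

theorem mem_shiftSpace {k l : ℤ} {f : Laurent} :
    f ∈ shiftSpace k l ↔ ∃ g ∈ polySpace k l, mono 1 0 * g = f := by
  simp [shiftSpace, Submodule.mem_map]

theorem shiftSpace_le {k l : ℤ} : shiftSpace (k - 1) l ≤ polySpace k l := by
  intro f hf
  obtain ⟨g, hg, rfl⟩ := mem_shiftSpace.1 hf
  exact mono_mul_mem hg (by norm_num) (by omega) le_rfl (by omega)

/-- `𝓖 = 𝓟_{n,m-1} ⊖ z 𝓟_{n-1,m-1}`. -/
def spaceG (L : Laurent →ₗ[ℂ] ℂ) (n m : ℕ) : Submodule ℂ Laurent :=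
  perp L (polySpace n ((m : ℤ) - 1)) (shiftSpace ((n : ℤ) - 1) ((m : ℤ) - 1))

theorem spaceG_le (L : Laurent →ₗ[ℂ] ℂ) (n m : ℕ) : spaceG L n m ≤ polySpace n ((m : ℤ) - 1) :=
  fun _ h => h.1

variable {L : Laurent →ₗ[ℂ] ℂ} {n m : ℕ}

/-- The classical zero argument for Szegő polynomials. If z₀ is a common zero of the columns, g = (z
- z₀)h, so z₀h = zh - g with g ⊥ zh. Multiplication by z is isometric, so Pythagoras gives |z₀|²‖h‖²
= ‖h‖² + ‖g‖², which forces g = 0 when |z₀| ≤ 1. -/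
theorem eq_zero_of_col_eq_zero (hL : PosOn L n ((m : ℤ) - 1)) {g : Laurent}
    (hg : g ∈ spaceG L n m) {z : ℂ} (hz : ‖z‖ ≤ 1) (h0 : ∀ t, col t z g = 0) : g = 0 := by
  obtain ⟨h, hh, hgh⟩ := exists_eq_sub_mul hg.1 h0
  have hhn : h ∈ polySpace n ((m : ℤ) - 1) := polySpace_mono (by omega) le_rfl hh
  have hzh : mono 1 0 * h ∈ shiftSpace ((n : ℤ) - 1) ((m : ℤ) - 1) :=
    mem_shiftSpace.2 ⟨h, hh, rfl⟩
  have hzhn := shiftSpace_le hzh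
  have h1 : sesq L g (mono 1 0 * h) = 0 := hg.2 _ hzh
  have h1' : sesq L (mono 1 0 * h) g = 0 := by rw [hL.symm hg.1 hzhn, h1, map_zero]
  have h2 : z • h = mono 1 0 * h - g := by rw [hgh]; abel
  have h3 : sesq L (z • h) (z • h) = sesq L h h + sesq L g g := by
    rw [h2]
    simp only [map_sub, LinearMap.sub_apply, h1, h1', sesq_mono_mul]
    ring
  have h4 : sesq L (z • h) (z • h) = ((‖z‖ ^ 2 : ℝ) : ℂ) * sesq L h h := by
    simp only [map_smulₛₗ, LinearMap.smul_apply, smul_eq_mul, RingHom.id_apply]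
    rw [← mul_assoc, mul_comm (conj z), Complex.mul_conj, Complex.normSq_eq_norm_sq]
  rw [h4, hL.self_eq hhn, hL.self_eq hg.1, ← Complex.ofReal_mul, ← Complex.ofReal_add] at h3
  have h5 := Complex.ofReal_injective h3
  have h6 := hL.nonneg hhn
  by_contra hne
  have h7 := hL.pos g hg.1 hne
  have h8 : ‖z‖ ^ 2 ≤ 1 := pow_le_one₀ (norm_nonneg _) hz
  nlinarith

/-- Subtracting the projection onto `z 𝓟_{n-1,m-1}` leaves the coefficients of z⁰ untouched. -/
theorem exists_mem_spaceG_coeff (hL : PosOn L n ((m : ℤ) - 1)) {y : Laurent}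
    (hy : y ∈ polySpace n ((m : ℤ) - 1)) :
    ∃ g ∈ spaceG L n m, ∀ t, g.coeff (0, t) = y.coeff (0, t) := by
  obtain ⟨e, he⟩ := hL.exists_isONB (S := shiftSpace ((n : ℤ) - 1) ((m : ℤ) - 1)) shiftSpace_le
  refine ⟨y - ∑ i, sesq L y (e i) • e i, ⟨Submodule.sub_mem _ hy (Submodule.sum_mem _ fun i _ =>
    Submodule.smul_mem _ _ (shiftSpace_le (he.mem i))), fun x hx => he.sub_perp y hx⟩, ?_⟩
  intro t
  have h1 : ∀ i, coeffLin 0 t (e i) = 0 := by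
    intro i
    obtain ⟨g, hg, h⟩ := mem_shiftSpace.1 (he.mem i)
    rw [← h, coeffLin_apply, coeff_mono_mul]
    by_contra hc
    have := mem_polySpace.1 hg _ _ hc
    omega
  rw [← coeffLin_apply, ← coeffLin_apply]
  simp [h1]

/-- The m coefficients of z⁰ are coordinates on 𝓖: they determine an element by
`eq_zero_of_col_eq_zero` at z = 0, and `exists_mem_spaceG_coeff` prescribes them freely. This makes
Γ a square matrix. -/
theorem finrank_spaceG (hL : PosOn L n ((m : ℤ) - 1)) :
    Module.finrank ℂ (spaceG L n m) = m := by
  let φ : spaceG L n m →ₗ[ℂ] (Fin m → ℂ) :=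
    LinearMap.pi fun k => coeffLin 0 (k : ℕ) ∘ₗ (spaceG L n m).subtype
  have hφ : ∀ g k, φ g k = (g : Laurent).coeff (0, ((k : ℕ) : ℤ)) := fun g k => rfl
  have hinj : Function.Injective φ := by
    rw [← LinearMap.ker_eq_bot, LinearMap.ker_eq_bot']
    intro g hg
    have h0 : ∀ t, col t 0 (g : Laurent) = 0 := by
      intro t
      rw [col_eq_sum g.2.1, Finset.sum_range_succ']
      simp only [pow_succ, mul_zero, Finset.sum_const_zero, Nat.cast_zero, pow_zero, mul_one,
        zero_add]
      by_contra hc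
      have h1 := mem_polySpace.1 g.2.1 _ _ hc
      have h2 := congrFun hg ⟨t.toNat, by omega⟩
      rw [hφ] at h2
      exact hc (by simpa [Int.toNat_of_nonneg h1.2.1] using h2)
    exact Subtype.ext (eq_zero_of_col_eq_zero hL g.2 (by simp) h0)
  have hsurj : Function.Surjective φ := by
    intro v
    obtain ⟨g, hg, h⟩ := exists_mem_spaceG_coeff hL (y := ∑ k : Fin m, v k • mono 0 (k : ℕ))
      (Submodule.sum_mem _ fun k _ => Submodule.smul_mem _ _
        (mono_mem_polySpace le_rfl (by omega) (by omega) (by omega)))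
    refine ⟨⟨g, hg⟩, ?_⟩
    ext k
    rw [hφ]
    simp only [h]
    rw [← coeffLin_apply]
    simp only [map_sum, map_smul, coeffLin_apply, coeff_mono, smul_eq_mul]
    rw [Finset.sum_eq_single k]
    · simp
    · intro j _ hj
      have : ¬ ((j : ℕ) : ℤ) = ((k : ℕ) : ℤ) := fun h => hj (Fin.ext (by omega))
      simp [this]
    · simp
  have := (LinearEquiv.ofBijective φ ⟨hinj, hsurj⟩).finrank_eq
  simpa using this

theorem exists_isONB_spaceG (hL : PosOn L n ((m : ℤ) - 1)) :
    ∃ g : Fin m → Laurent, IsONB L (spaceG L n m) g := by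
  have := hL.exists_isONB (spaceG_le L n m)
  rwa [finrank_spaceG hL] at this

/-- The matrix polynomial `Γ(z)` of the coefficients of `w ^ k` of the `g i`. -/
def matG (g : Fin m → Laurent) (z : ℂ) : Matrix (Fin m) (Fin m) ℂ :=
  Matrix.of fun i k => col (k : ℕ) z (g i)

theorem matG_apply (g : Fin m → Laurent) (z : ℂ) (i k : Fin m) :
    matG g z i k = col (k : ℕ) z (g i) := rfl

/-- A left null vector of Γ(z) would be a combination of the basis all of whose columns vanish at z.
-/
theorem det_matG_ne_zero (hL : PosOn L n ((m : ℤ) - 1)) {g : Fin m → Laurent}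
    (hg : IsONB L (spaceG L n m) g) {z : ℂ} (hz : ‖z‖ ≤ 1) : (matG g z).det ≠ 0 := by
  intro hdet
  obtain ⟨v, hv, hv0⟩ := Matrix.exists_vecMul_eq_zero_iff.2 hdet
  have hmem : ∑ i, v i • g i ∈ spaceG L n m :=
    Submodule.sum_mem _ fun i _ => Submodule.smul_mem _ _ (hg.mem i)
  have h0 : ∑ i, v i • g i = 0 := by
    refine eq_zero_of_col_eq_zero hL hmem hz fun t => ?_
    by_cases ht : 0 ≤ t ∧ t < m
    · have := congrFun hv0 ⟨t.toNat, by omega⟩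
      simp only [Matrix.vecMul, dotProduct, matG_apply, Pi.zero_apply, Int.toNat_of_nonneg ht.1]
        at this
      simpa using this
    · rw [col_eq_sum hmem.1]
      apply Finset.sum_eq_zero
      intro s _
      have : (∑ i, v i • g i).coeff (s, t) = 0 := by
        by_contra hc
        have := mem_polySpace.1 hmem.1 _ _ hc
        omega
      rw [this, zero_mul]
  apply hv
  ext j
  have := hg.sesq_sum v j
  rw [h0] at this
  simpa using this.symm

end

/-! ### Circle averages and the matrix Bernstein–Szegő theorem -/

section

/-- The average over the unit circle. -/
abbrev cavg (f : ℂ → ℂ) : ℂ := Real.circleAverage f 0 1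

/-- Continuity on the unit circle. -/
abbrev CircleCont (f : ℂ → ℂ) : Prop := ContinuousOn f (Metric.sphere 0 1)

theorem cavg_congr {f g : ℂ → ℂ} (h : ∀ z : ℂ, ‖z‖ = 1 → f z = g z) : cavg f = cavg g :=
  Real.circleAverage_congr_sphere fun z hz => h z (by simpa using hz)

theorem CircleCont.integrable {f : ℂ → ℂ} (h : CircleCont f) : CircleIntegrable f 0 1 :=
  ContinuousOn.circleIntegrable zero_le_one h

theorem cavg_add {f g : ℂ → ℂ} (hf : CircleCont f) (hg : CircleCont g) :
    cavg (fun z => f z + g z) = cavg f + cavg g :=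
  Real.circleAverage_fun_add hf.integrable hg.integrable

theorem cavg_sub {f g : ℂ → ℂ} (hf : CircleCont f) (hg : CircleCont g) :
    cavg (fun z => f z - g z) = cavg f - cavg g :=
  Real.circleAverage_fun_sub hf.integrable hg.integrable

theorem cavg_sum {ι : Type*} (s : Finset ι) {f : ι → ℂ → ℂ} (hf : ∀ i ∈ s, CircleCont (f i)) :
    cavg (fun z => ∑ i ∈ s, f i z) = ∑ i ∈ s, cavg (f i) :=
  Real.circleAverage_fun_sum fun i hi => (hf i hi).integrable

theorem cavg_mul_left (c : ℂ) (f : ℂ → ℂ) : cavg (fun z => c * f z) = c * cavg f :=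
  Real.circleAverage_fun_smul (a := c) (f := f)

theorem cavg_const (c : ℂ) : cavg (fun _ => c) = c := Real.circleAverage_const c 0 1

theorem cavg_conj (f : ℂ → ℂ) : cavg (fun z => conj (f z)) = conj (cavg f) := by
  rw [cavg, cavg, Real.circleAverage_def, Real.circleAverage_def, Complex.real_smul, Complex.real_smul,
    map_mul, Complex.conj_ofReal]
  congr 1
  rw [intervalIntegral.intervalIntegral_eq_integral_uIoc,
    intervalIntegral.intervalIntegral_eq_integral_uIoc, integral_conj]
  simp only [Complex.real_smul, map_mul, Complex.conj_ofReal]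

theorem cavg_eq_apply_zero {f : ℂ → ℂ} (hf : ∀ z : ℂ, ‖z‖ ≤ 1 → DifferentiableAt ℂ f z) :
    cavg f = f 0 := by
  apply DiffContOnCl.circleAverage
  apply DifferentiableOn.diffContOnCl
  intro z hz
  rw [abs_one, closure_ball _ one_ne_zero] at hz
  exact (hf z (by simpa using hz)).differentiableWithinAt

theorem circleCont_of_differentiableAt {f : ℂ → ℂ}
    (hf : ∀ z : ℂ, ‖z‖ ≤ 1 → DifferentiableAt ℂ f z) : CircleCont f := fun z hz =>
  (hf z (by simp at hz; exact hz.le)).continuousAt.continuousWithinAt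

theorem CircleCont.conj {f : ℂ → ℂ} (hf : CircleCont f) : CircleCont (fun z => conj (f z)) :=
  Complex.continuous_conj.comp_continuousOn hf

theorem circleCont_zpow (j : ℤ) : CircleCont (fun z => z ^ j) := fun z hz =>
  (continuousAt_zpow₀ z j (Or.inl (by rintro rfl; simp at hz))).continuousWithinAt

theorem circleCont_col (t : ℤ) (f : Laurent) : CircleCont (fun z => col t z f) := by
  induction f using AddMonoidAlgebra.induction_linear with
  | zero => simpa using continuousOn_const
  | add x y hx hy => simp only [map_add]; exact hx.add hy
  | single m r =>
    obtain ⟨a, b⟩ := m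
    have h : AddMonoidAlgebra.single (a, b) r = r • mono a b := by
      simp [mono]
    simp only [h, map_smul, col_mono]
    split_ifs
    · exact (circleCont_zpow a).const_smul r
    · exact continuousOn_const

theorem col_mono_mul' {z : ℂ} (hz : z ≠ 0) (t s : ℤ) (f : Laurent) :
    col t z (mono s 0 * f) = z ^ s * col t z f := by
  induction f using AddMonoidAlgebra.induction_linear with
  | zero => simp
  | add x y hx hy => simp only [mul_add, map_add, hx, hy]
  | single m r =>
    obtain ⟨a, b⟩ := m
    have h : AddMonoidAlgebra.single (a, b) r = r • mono a b := by
      simp [mono]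
    simp only [h, mul_smul_comm, map_smul, col_mono, mono_mul_mono, zpow_add₀ hz, zero_add]
    split_ifs
    · rfl
    · simp only [smul_zero, mul_zero]

variable {L : Laurent →ₗ[ℂ] ℂ} {n m : ℕ}

theorem differentiableAt_inv_entry {A : ℂ → Matrix (Fin m) (Fin m) ℂ} {z : ℂ}
    (hA : ∀ i j, DifferentiableAt ℂ (fun z => A z i j) z) (hdet : (A z).det ≠ 0) (i j : Fin m) :
    DifferentiableAt ℂ (fun z => (A z)⁻¹ i j) z := by
  have hd : ∀ {B : ℂ → Matrix (Fin m) (Fin m) ℂ},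
      (∀ i j, DifferentiableAt ℂ (fun z => B z i j) z) →
      DifferentiableAt ℂ (fun z => (B z).det) z := by
    intro B hB
    simp_rw [Matrix.det_apply]
    refine DifferentiableAt.fun_sum fun σ _ => ?_
    apply DifferentiableAt.const_smul
    exact DifferentiableAt.fun_finsetProd fun i _ => hB _ _
  have h1 : (fun z => (A z)⁻¹ i j) = fun z => (A z).det⁻¹ * (A z).adjugate i j := by
    ext z
    rw [Matrix.inv_def, Ring.inverse_eq_inv']; rfl
  rw [h1]
  refine ((hd hA).inv hdet).mul ?_
  simp_rw [Matrix.adjugate_apply]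
  apply hd
  intro a b
  by_cases h : a = j
  · subst h; simp
  · simp only [Matrix.updateRow_ne h]; exact hA a b

/-- `β(z) = Γ(z)⁻¹`. -/
def matB (g : Fin m → Laurent) (z : ℂ) : Matrix (Fin m) (Fin m) ℂ := (matG g z)⁻¹

theorem differentiableAt_matB (hL : PosOn L n ((m : ℤ) - 1)) {g : Fin m → Laurent}
    (hg : IsONB L (spaceG L n m) g) {z : ℂ} (hz : ‖z‖ ≤ 1) (i j : Fin m) :
    DifferentiableAt ℂ (fun z => matB g z i j) z :=
  differentiableAt_inv_entry (fun i _ => differentiable_col (hg.mem i).1 _ z)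
    (det_matG_ne_zero hL hg hz) i j

/-- `Γ(z)⁻¹ Γ(z)⁻ᴴ`. -/
def weightG (g : Fin m → Laurent) (z : ℂ) : Matrix (Fin m) (Fin m) ℂ :=
  matB g z * (matB g z).conjTranspose

theorem circleCont_weightG (hL : PosOn L n ((m : ℤ) - 1)) {g : Fin m → Laurent}
    (hg : IsONB L (spaceG L n m) g) (i j : Fin m) : CircleCont (fun z => weightG g z i j) := by
  simp only [weightG, Matrix.mul_apply, Matrix.conjTranspose_apply]
  refine continuousOn_finsetSum _ fun k _ => ?_
  have h := fun i j => circleCont_of_differentiableAt fun z hz =>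
    differentiableAt_matB hL hg (z := z) hz i j
  exact (h i k).mul (h j k).conj

/-- The inner product of `f` and `h` with respect to the matrix weight `Γ⁻¹ Γ⁻ᴴ`. -/
def gform (g : Fin m → Laurent) (f h : Laurent) : ℂ :=
  cavg fun z => ∑ k : Fin m, ∑ l : Fin m,
    col (k : ℕ) z f * weightG g z k l * conj (col (l : ℕ) z h)

theorem circleCont_gform (hL : PosOn L n ((m : ℤ) - 1)) {g : Fin m → Laurent}
    (hg : IsONB L (spaceG L n m) g) (f h : Laurent) :
    CircleCont fun z => ∑ k : Fin m, ∑ l : Fin m,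
      col (k : ℕ) z f * weightG g z k l * conj (col (l : ℕ) z h) :=
  continuousOn_finsetSum _ fun k _ => continuousOn_finsetSum _ fun l _ =>
    ((circleCont_col _ f).mul (circleCont_weightG hL hg k l)).mul (circleCont_col _ h).conj

/-- `gform` as a sesquilinear form. -/
def gformLin (hL : PosOn L n ((m : ℤ) - 1)) {g : Fin m → Laurent}
    (hg : IsONB L (spaceG L n m) g) : Laurent →ₗ[ℂ] Laurent →ₗ⋆[ℂ] ℂ :=
  LinearMap.mk₂'ₛₗ (RingHom.id ℂ) (starRingEnd ℂ) (gform g)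
    (by
      intro f₁ f₂ h
      rw [gform, gform, gform, ← cavg_add (circleCont_gform hL hg _ _) (circleCont_gform hL hg _ _)]
      simp only [map_add, add_mul, Finset.sum_add_distrib])
    (by
      intro c f h
      rw [gform, gform, RingHom.id_apply, smul_eq_mul, ← cavg_mul_left]
      simp only [map_smul, smul_eq_mul, mul_assoc, Finset.mul_sum])
    (by
      intro f h₁ h₂
      rw [gform, gform, gform, ← cavg_add (circleCont_gform hL hg _ _) (circleCont_gform hL hg _ _)]
      simp only [map_add, mul_add, Finset.sum_add_distrib])
    (by
      intro c f h
      rw [gform, gform, smul_eq_mul, ← cavg_mul_left]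
      simp only [map_smul, smul_eq_mul, map_mul, Finset.mul_sum]
      refine cavg_congr fun z _ => Finset.sum_congr rfl fun k _ => Finset.sum_congr rfl fun l _ => ?_
      ring)

theorem gform_symm (g : Fin m → Laurent) (f h : Laurent) : gform g h f = conj (gform g f h) := by
  rw [gform, gform, ← cavg_conj]
  refine cavg_congr fun z _ => ?_
  rw [map_sum, Finset.sum_comm]
  refine Finset.sum_congr rfl fun k _ => ?_
  rw [map_sum]
  refine Finset.sum_congr rfl fun l _ => ?_
  have : weightG g z l k = conj (weightG g z k l) := by
    have h : (weightG g z).conjTranspose = weightG g z := by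
      simp [weightG, Matrix.conjTranspose_mul]
    conv_lhs => rw [← h]
    rfl
  rw [map_mul, map_mul, Complex.conj_conj, this]
  ring

theorem gform_mono_mul (g : Fin m → Laurent) (s : ℤ) (f h : Laurent) :
    gform g (mono s 0 * f) (mono s 0 * h) = gform g f h := by
  rw [gform, gform]
  refine cavg_congr fun z hz => ?_
  have hz0 : z ≠ 0 := by rintro rfl; simp at hz
  have h1 : z ^ s * conj (z ^ s) = 1 := by
    rw [Complex.mul_conj, Complex.normSq_eq_norm_sq, norm_zpow, hz]; simp
  refine Finset.sum_congr rfl fun k _ => Finset.sum_congr rfl fun l _ => ?_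
  rw [col_mono_mul' hz0, col_mono_mul' hz0, map_mul]
  linear_combination (col (k : ℕ) z f * weightG g z k l * conj (col (l : ℕ) z h)) * h1

theorem matB_mul_matG (hL : PosOn L n ((m : ℤ) - 1)) {g : Fin m → Laurent}
    (hg : IsONB L (spaceG L n m) g) {z : ℂ} (hz : ‖z‖ ≤ 1) : matB g z * matG g z = 1 :=
  Matrix.nonsing_inv_mul _ (isUnit_iff_ne_zero.2 (det_matG_ne_zero hL hg hz))

theorem matG_mul_matB (hL : PosOn L n ((m : ℤ) - 1)) {g : Fin m → Laurent}
    (hg : IsONB L (spaceG L n m) g) {z : ℂ} (hz : ‖z‖ ≤ 1) : matG g z * matB g z = 1 :=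
  Matrix.mul_nonsing_inv _ (isUnit_iff_ne_zero.2 (det_matG_ne_zero hL hg hz))

theorem weightG_mul_matG (hL : PosOn L n ((m : ℤ) - 1)) {g : Fin m → Laurent}
    (hg : IsONB L (spaceG L n m) g) {z : ℂ} (hz : ‖z‖ ≤ 1) :
    weightG g z * (matG g z).conjTranspose = matB g z := by
  rw [weightG, mul_assoc, ← Matrix.conjTranspose_mul, matG_mul_matB hL hg hz,
    Matrix.conjTranspose_one, mul_one]

/-- Against a row of Γ the weight Γ⁻¹Γ⁻ᴴ collapses to Γ⁻¹, so the integrand f Γ⁻¹ is analytic on the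
closed disk and its average is its value at 0. -/
theorem gform_basis (hL : PosOn L n ((m : ℤ) - 1)) {g : Fin m → Laurent}
    (hg : IsONB L (spaceG L n m) g) {f : Laurent} (hf : f ∈ polySpace n ((m : ℤ) - 1))
    (i : Fin m) : gform g f (g i) = ∑ k : Fin m, f.coeff (0, ((k : ℕ) : ℤ)) * matB g 0 k i := by
  have h1 : gform g f (g i) = cavg fun z => ∑ k : Fin m, col (k : ℕ) z f * matB g z k i := by
    rw [gform]
    refine cavg_congr fun z hz => Finset.sum_congr rfl fun k _ => ?_
    rw [← weightG_mul_matG hL hg hz.le, Matrix.mul_apply, Finset.mul_sum]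
    refine Finset.sum_congr rfl fun l _ => ?_
    rw [Matrix.conjTranspose_apply, matG_apply, mul_assoc]; rfl
  rw [h1, cavg_eq_apply_zero]
  · refine Finset.sum_congr rfl fun k _ => ?_
    rw [col_eq_sum hf, Finset.sum_range_succ']
    simp
  · intro z hz
    exact DifferentiableAt.fun_sum fun k _ => (differentiable_col hf _ z).mul
      (differentiableAt_matB hL hg hz k i)

/-- The coefficient row is f(0)Γ(0)⁻¹, exactly the one for which the combination has the same z⁰
part as f; the difference is then divisible by z. -/
theorem exists_basis_decomp (hL : PosOn L n ((m : ℤ) - 1)) {g : Fin m → Laurent}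
    (hg : IsONB L (spaceG L n m) g) {f : Laurent} (hf : f ∈ polySpace n ((m : ℤ) - 1)) :
    ∃ q ∈ polySpace ((n : ℤ) - 1) ((m : ℤ) - 1),
      f - ∑ i, (∑ k : Fin m, f.coeff (0, ((k : ℕ) : ℤ)) * matB g 0 k i) • g i = mono 1 0 * q := by
  set b : Fin m → ℂ := fun i => ∑ k : Fin m, f.coeff (0, ((k : ℕ) : ℤ)) * matB g 0 k i
  have hmem : f - ∑ i, b i • g i ∈ polySpace n ((m : ℤ) - 1) :=
    Submodule.sub_mem _ hf (Submodule.sum_mem _ fun i _ => Submodule.smul_mem _ _ (hg.mem i).1)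
  refine exists_eq_mono_mul hmem fun t => ?_
  by_contra hc
  have ht := mem_polySpace.1 hmem _ _ hc
  apply hc
  obtain ⟨k, rfl⟩ : ∃ k : Fin m, ((k : ℕ) : ℤ) = t :=
    ⟨⟨t.toNat, by omega⟩, by simp; omega⟩
  have h2 : ∀ a b, (matB g 0 * matG g 0) a b = (1 : Matrix (Fin m) (Fin m) ℂ) a b := fun a b => by
    rw [matB_mul_matG hL hg (z := 0) (by simp)]
  have h3 : ∀ i, (g i).coeff (0, ((k : ℕ) : ℤ)) = matG g 0 i k := by
    intro i
    rw [matG_apply, col_eq_sum (hg.mem i).1, Finset.sum_range_succ']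
    simp
  rw [← coeffLin_apply]
  simp only [map_sub, map_sum, map_smul, coeffLin_apply, smul_eq_mul, h3, Finset.sum_mul]
  rw [Finset.sum_comm]
  simp only [mul_assoc, ← Finset.mul_sum]
  simp only [Matrix.mul_apply] at h2
  simp [h2, Matrix.one_apply]

/-- The right-hand side is that of `gform_basis`, so the two forms agree whenever one argument is in
𝓖. -/
theorem sesq_basis (hL : PosOn L n ((m : ℤ) - 1)) {g : Fin m → Laurent}
    (hg : IsONB L (spaceG L n m) g) {f : Laurent} (hf : f ∈ polySpace n ((m : ℤ) - 1))
    (i : Fin m) : sesq L f (g i) = ∑ k : Fin m, f.coeff (0, ((k : ℕ) : ℤ)) * matB g 0 k i := by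
  obtain ⟨q, hq, hfq⟩ := exists_basis_decomp hL hg hf
  have hzq := mem_shiftSpace.2 ⟨q, hq, rfl⟩
  have h4 : sesq L (mono 1 0 * q) (g i) = 0 := by
    rw [hL.symm (hg.mem i).1 (shiftSpace_le hzq), (hg.mem i).2 _ hzq, map_zero]
  rw [← hfq, map_sub, LinearMap.sub_apply, hg.sesq_sum, sub_eq_zero] at h4
  exact h4

/-- A sesquilinear form which is preserved by strictly contracting steps vanishes. -/
theorem form_self_eq_zero {k l : ℤ} (hL : PosOn L k l) (D : Laurent →ₗ[ℂ] Laurent →ₗ⋆[ℂ] ℂ)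
    (hD : ∀ f ∈ polySpace k l, f ≠ 0 → ∃ f' ∈ polySpace k l, D f f = D f' f' ∧
      (sesq L f' f').re < (sesq L f f).re) {f : Laurent} (hf : f ∈ polySpace k l) :
    D f f = 0 := by
  obtain ⟨N, e, he⟩ : ∃ N, ∃ e : Fin N → Laurent, IsONB L (polySpace k l) e :=
    ⟨_, hL.exists_isONB (le_refl _)⟩
  let v : EuclideanSpace ℂ (Fin N) → Laurent := fun x => ∑ i, x i • e i
  have hv : ∀ x, v x ∈ polySpace k l := fun x =>
    Submodule.sum_mem _ fun i _ => Submodule.smul_mem _ _ (he.mem i)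
  have hvs : ∀ f ∈ polySpace k l, ∃ x, v x = f := fun f hf =>
    ⟨WithLp.toLp 2 (fun i => sesq L f (e i)), (he.expand f hf).symm⟩
  have hsmul : ∀ (c : ℂ) x, v (c • x) = c • v x := by
    intro c x
    simp [v, Finset.smul_sum, smul_smul]
  have hnorm : ∀ x, (sesq L (v x) (v x)).re = ‖x‖ ^ 2 := by
    intro x
    have h1 : sesq L (v x) (v x) = ∑ i, conj (x i) * x i := by
      conv_lhs => enter [2]; simp only [v]
      rw [map_sum]
      refine Finset.sum_congr rfl fun i _ => ?_
      rw [map_smulₛₗ, he.sesq_sum, smul_eq_mul]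
    rw [h1, EuclideanSpace.norm_sq_eq, Complex.re_sum]
    refine Finset.sum_congr rfl fun i _ => ?_
    rw [mul_comm, Complex.mul_conj, Complex.normSq_eq_norm_sq, Complex.ofReal_re]
  have hDs : ∀ (r : ℝ) x, D (v ((r : ℂ) • x)) (v ((r : ℂ) • x)) = (r : ℂ) ^ 2 * D (v x) (v x) := by
    intro r x
    rw [hsmul]
    simp only [map_smulₛₗ, LinearMap.smul_apply, smul_eq_mul, RingHom.id_apply,
      Complex.conj_ofReal]
    ring
  have hcont : Continuous fun x => ‖D (v x) (v x)‖ := by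
    have : ∀ x, D (v x) (v x) = ∑ i, ∑ j, x i * conj (x j) * D (e i) (e j) := by
      intro x
      simp only [v, map_sum, LinearMap.sum_apply, map_smulₛₗ, LinearMap.smul_apply, smul_eq_mul,
        RingHom.id_apply, Finset.mul_sum]
      rw [Finset.sum_comm]
      refine Finset.sum_congr rfl fun i _ => Finset.sum_congr rfl fun j _ => ?_
      ring
    simp only [this]
    refine continuous_norm.comp (continuous_finsetSum _ fun i _ => continuous_finsetSum _
      fun j _ => ?_)
    have hi : ∀ i : Fin N, Continuous fun x : EuclideanSpace ℂ (Fin N) => x i := fun i => by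
      fun_prop
    exact ((hi i).mul (Complex.continuous_conj.comp (hi j))).mul continuous_const
  obtain ⟨x, rfl⟩ := hvs f hf
  by_cases hx : x = 0
  · simp [hx, v]
  -- Let y maximize |D| on the unit sphere. A contracting step from y gives a vector of norm less
  -- than 1 with the same value of D, which contradicts homogeneity unless the maximum is 0.
  obtain ⟨y, hy, hmax⟩ := (isCompact_sphere (0 : EuclideanSpace ℂ (Fin N)) 1).exists_isMaxOn
    ⟨((‖x‖⁻¹ : ℝ) : ℂ) • x, by simp [norm_smul, hx]⟩ hcont.continuousOn
  have hy1 : ‖y‖ = 1 := by simpa using hy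
  have hbound : ∀ x, ‖D (v x) (v x)‖ ≤ ‖x‖ ^ 2 * ‖D (v y) (v y)‖ := by
    intro x
    by_cases hx : x = 0
    · simp [hx, v]
    have h1 := hmax (show ((‖x‖⁻¹ : ℝ) : ℂ) • x ∈ Metric.sphere _ _ by simp [norm_smul, hx])
    simp only [Set.mem_ofPred_eq, hDs] at h1
    have hx' : 0 < ‖x‖ := norm_pos_iff.2 hx
    rw [norm_mul, norm_pow, Complex.norm_real, norm_inv, norm_norm, inv_pow,
      inv_mul_le_iff₀ (by positivity)] at h1
    exact h1
  have hy0 : ‖D (v y) (v y)‖ = 0 := by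
    by_contra hne
    have hvy : v y ≠ 0 := by
      intro h
      simp [h] at hne
    obtain ⟨f', hf', h1, h2⟩ := hD _ (hv y) hvy
    obtain ⟨x', rfl⟩ := hvs f' hf'
    have h3 := hbound x'
    rw [← h1] at h3
    rw [hnorm, hnorm, hy1] at h2
    have : 0 < ‖D (v y) (v y)‖ := lt_of_le_of_ne (norm_nonneg _) (Ne.symm hne)
    nlinarith
  have := hbound x
  rw [hy0, mul_zero] at this
  exact norm_le_zero_iff.1 this

/-- Polarization: f + h and f + ih give the sum and, up to a factor, the difference of D f h and D h
f; no hermitian symmetry is needed. -/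
theorem form_eq_zero_of_self {k l : ℤ} (D : Laurent →ₗ[ℂ] Laurent →ₗ⋆[ℂ] ℂ)
    (hD : ∀ f ∈ polySpace k l, D f f = 0) {f h : Laurent} (hf : f ∈ polySpace k l)
    (hh : h ∈ polySpace k l) : D f h = 0 := by
  have h1 := hD _ (Submodule.add_mem _ hf hh)
  have h2 := hD _ (Submodule.add_mem _ hf (Submodule.smul_mem _ Complex.I hh))
  simp only [map_add, LinearMap.add_apply, map_smulₛₗ, LinearMap.smul_apply, smul_eq_mul,
    RingHom.id_apply, Complex.conj_I, hD f hf, hD h hh] at h1 h2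
  have h3 := Complex.I_mul_I
  linear_combination (1 / 2 : ℂ) * h1 + (1 / 2 * Complex.I) * h2 +
    (1 / 2 * D f h - 1 / 2 * D h f) * h3

/-- The matrix-valued Bernstein–Szegő theorem. -/
theorem sesq_eq_gform (hL : PosOn L n ((m : ℤ) - 1)) {g : Fin m → Laurent}
    (hg : IsONB L (spaceG L n m) g) {f h : Laurent} (hf : f ∈ polySpace n ((m : ℤ) - 1))
    (hh : h ∈ polySpace n ((m : ℤ) - 1)) : sesq L f h = gform g f h := by
  set D : Laurent →ₗ[ℂ] Laurent →ₗ⋆[ℂ] ℂ := sesq L - gformLin hL hg with hDdef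
  have hDapp : ∀ f h, D f h = sesq L f h - gform g f h := fun f h => rfl
  have hD1 : ∀ f ∈ polySpace n ((m : ℤ) - 1), ∀ i, D f (g i) = 0 := fun f hf i => by
    rw [hDapp, sesq_basis hL hg hf, gform_basis hL hg hf, sub_self]
  have hD2 : ∀ f ∈ polySpace n ((m : ℤ) - 1), ∀ i, D (g i) f = 0 := fun f hf i => by
    rw [hDapp, hL.symm hf (hg.mem i).1, gform_symm, ← map_sub, ← hDapp, hD1 f hf, map_zero]
  have hDz : ∀ f h, D (mono 1 0 * f) (mono 1 0 * h) = D f h := fun f h => by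
    rw [hDapp, hDapp, sesq_mono_mul, gform_mono_mul]
  suffices h0 : D f h = 0 by
    rw [hDapp, sub_eq_zero] at h0
    exact h0
  refine form_eq_zero_of_self D (fun f hf => form_self_eq_zero hL D ?_ hf) hf hh
  -- Write f = Σ bᵢgᵢ + zq; passing to q keeps D and lowers the squared norm by Σ|bᵢ|². If b = 0 the
  -- norm does not drop but the degree in z does, hence induction on the degree. The shift by one
  -- makes j = 0 the zero space, where f ≠ 0 is impossible.
  have key : ∀ j : ℕ, ∀ f ∈ polySpace ((j : ℤ) - 1) ((m : ℤ) - 1), (j : ℤ) - 1 ≤ n → f ≠ 0 →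
      ∃ f' ∈ polySpace n ((m : ℤ) - 1), D f f = D f' f' ∧
      (sesq L f' f').re < (sesq L f f).re := by
    intro j
    induction j with
    | zero =>
      intro f hf _ h0
      exfalso
      apply h0
      ext ⟨s, t⟩
      by_contra hc
      have := mem_polySpace.1 hf s t hc
      simp at this
      omega
    | succ j ih =>
      intro f hf hj h0
      have hfn : f ∈ polySpace n ((m : ℤ) - 1) := polySpace_mono hj le_rfl hf
      obtain ⟨q, hq, hfq⟩ := exists_basis_decomp hL hg hfn
      set b : Fin m → ℂ := fun i => ∑ k : Fin m, f.coeff (0, ((k : ℕ) : ℤ)) * matB g 0 k i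
      have hqn : q ∈ polySpace n ((m : ℤ) - 1) := polySpace_mono (by omega) le_rfl hq
      have hzq := mem_shiftSpace.2 ⟨q, hq, rfl⟩
      have hzqn := shiftSpace_le hzq
      have hfeq : f = ∑ i, b i • g i + mono 1 0 * q := by rw [← hfq]; abel
      have hGq : sesq L (∑ i, b i • g i) (∑ i, b i • g i) = ((∑ i, ‖b i‖ ^ 2 : ℝ) : ℂ) := by
        conv_lhs => rw [map_sum]
        push_cast
        refine Finset.sum_congr rfl fun i _ => ?_
        rw [map_smulₛₗ, hg.sesq_sum, smul_eq_mul, mul_comm, Complex.mul_conj,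
          Complex.normSq_eq_norm_sq]
        push_cast; rfl
      have h1 : ∀ i, sesq L (g i) (mono 1 0 * q) = 0 := fun i => (hg.mem i).2 _ hzq
      have h2 : ∀ i, sesq L (mono 1 0 * q) (g i) = 0 := fun i => by
        rw [hL.symm (hg.mem i).1 hzqn, h1, map_zero]
      have hB : (sesq L f f).re = ∑ i, ‖b i‖ ^ 2 + (sesq L q q).re := by
        have : sesq L f f = ((∑ i, ‖b i‖ ^ 2 : ℝ) : ℂ) + sesq L q q := by
          have h3 : sesq L (∑ i, b i • g i) (mono 1 0 * q) = 0 := by simp [h1]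
          have h4 : sesq L (mono 1 0 * q) (∑ i, b i • g i) = 0 := by simp [h2]
          rw [hfeq, ← hGq, map_add (sesq L), LinearMap.add_apply, map_add, map_add, h3, h4,
            sesq_mono_mul, add_zero, zero_add]
        rw [this, Complex.add_re, Complex.ofReal_re]
      -- The gᵢ pair to zero under D with everything in the space, and D is invariant under
      -- multiplication by z.
      have hDf : D f f = D q q := by
        conv_lhs => rw [hfeq]
        have h3 : ∀ i j, D (g i) (g j) = 0 := fun i j => hD1 _ (hg.mem i).1 j
        have h4 : ∀ i, D (g i) (mono 1 0 * q) = 0 := fun i => hD2 _ hzqn i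
        have h5 : ∀ i, D (mono 1 0 * q) (g i) = 0 := fun i => hD1 _ hzqn i
        simp [h3, h4, h5, hDz]
      by_cases hb : ∑ i, ‖b i‖ ^ 2 = 0
      · have hb0 : ∀ i, b i = 0 := by
          intro i
          have := (Finset.sum_eq_zero_iff_of_nonneg (fun i _ => by positivity)).1 hb i
            (Finset.mem_univ i)
          simpa using this
        have hfz : f = mono 1 0 * q := by rw [hfeq]; simp [hb0]
        have hqj : q ∈ polySpace ((j : ℤ) - 1) ((m : ℤ) - 1) := by
          rw [mem_polySpace]
          intro s t hst
          have h6 := mem_polySpace.1 hq s t hst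
          have h7 : f.coeff (s + 1, t) ≠ 0 := by
            rw [hfz, coeff_mono_mul]
            simpa using hst
          have := mem_polySpace.1 hf _ _ h7
          push_cast at this
          omega
        have hq0 : q ≠ 0 := by rintro rfl; exact h0 (by rw [hfz, mul_zero])
        obtain ⟨f', hf', h8, h9⟩ := ih q hqj (by push_cast at hj; omega) hq0
        exact ⟨f', hf', hDf.trans h8, by rw [hB, hb, zero_add]; exact h9⟩
      · have : 0 < ∑ i, ‖b i‖ ^ 2 :=
          lt_of_le_of_ne (Finset.sum_nonneg fun i _ => by positivity) (Ne.symm hb)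
        exact ⟨q, hqn, hDf, by rw [hB]; linarith⟩
  exact fun f hf hne => key (n + 1) f (by simpa using hf) (by simp) hne

end

/-! ### Toeplitz matrices of the weight 1/|q|² on the circle -/

section

/-- The polynomial `∑ c t * w ^ t` of degree at most `m`. -/
def qpoly (m : ℕ) (c : ℕ → ℂ) (w : ℂ) : ℂ := ∑ t ∈ Finset.range (m + 1), c t * w ^ t

/-- The coefficients of the reversed polynomial. -/
def revc (m : ℕ) (c : ℕ → ℂ) (t : ℕ) : ℂ := conj (c (m - t))

/-- The moments of the weight `1 / |q| ^ 2` on the unit circle. -/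
def wm (q : ℂ → ℂ) (j : ℤ) : ℂ := cavg fun w => w ^ j / (‖q w‖ : ℂ) ^ 2

theorem differentiable_qpoly (m : ℕ) (c : ℕ → ℂ) : Differentiable ℂ (qpoly m c) := by
  unfold qpoly; fun_prop

variable {m : ℕ} {c : ℕ → ℂ}

theorem CircleCont.fun_mul {f g : ℂ → ℂ} (hf : CircleCont f) (hg : CircleCont g) :
    CircleCont fun z => f z * g z := ContinuousOn.mul hf hg

theorem CircleCont.const_mul {f : ℂ → ℂ} (hf : CircleCont f) (a : ℂ) :
    CircleCont fun z => a * f z := continuousOn_const.mul hf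

theorem CircleCont.fun_sum {ι : Type*} (s : Finset ι) {f : ι → ℂ → ℂ}
    (hf : ∀ i, CircleCont (f i)) : CircleCont fun z => ∑ i ∈ s, f i z :=
  continuousOn_finsetSum _ fun i _ => hf i

theorem conj_eq_inv {w : ℂ} (hw : ‖w‖ = 1) : conj w = w⁻¹ := (Complex.inv_eq_conj hw).symm

theorem conj_qpoly_revc {w : ℂ} (hw : ‖w‖ = 1) :
    conj (qpoly m (revc m c) w) = (w ^ m)⁻¹ * qpoly m c w := by
  have hw0 : w ≠ 0 := by rintro rfl; simp at hw
  rw [qpoly, qpoly, map_sum, ← Finset.sum_range_reflect, Finset.mul_sum]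
  refine Finset.sum_congr rfl fun t ht => ?_
  have ht' : t ≤ m := by simpa [Nat.lt_succ_iff] using ht
  have h1 : m + 1 - 1 - t = m - t := by omega
  have h2 : m - (m - t) = t := by omega
  rw [h1, revc, h2, map_mul, Complex.conj_conj, map_pow, conj_eq_inv hw, inv_pow]
  have h3 : w ^ m = w ^ (m - t) * w ^ t := by rw [← pow_add]; congr 1; omega
  rw [h3]
  field_simp

theorem cavg_pow_div {q : ℂ → ℂ} (hq : Differentiable ℂ q) (hq0 : ∀ w : ℂ, ‖w‖ ≤ 1 → q w ≠ 0)
    (j : ℕ) : cavg (fun w => w ^ j / q w) = 0 ^ j / q 0 :=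
  cavg_eq_apply_zero (f := fun w => w ^ j / q w) fun w hw =>
    (by fun_prop : DifferentiableAt ℂ (fun w : ℂ => w ^ j) w).div (hq w) (hq0 w hw)

theorem circleCont_wm {q : ℂ → ℂ} (hq : Differentiable ℂ q)
    (hq0 : ∀ w : ℂ, ‖w‖ ≤ 1 → q w ≠ 0) (j : ℤ) :
    CircleCont fun w => w ^ j / (‖q w‖ : ℂ) ^ 2 := by
  refine (circleCont_zpow j).div ?_ ?_
  · exact ((Complex.continuous_ofReal.comp (continuous_norm.comp hq.continuous)).pow 2).continuousOn
  · intro w hw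
    have := hq0 w (by simp at hw; exact hw.le)
    simpa using this

theorem wm_neg (q : ℂ → ℂ) (j : ℤ) : wm q (-j) = conj (wm q j) := by
  rw [wm, wm, ← cavg_conj]
  refine cavg_congr fun w hw => ?_
  rw [map_div₀, map_zpow₀, conj_eq_inv hw, inv_zpow', map_pow, Complex.conj_ofReal]

/-- `q` is orthogonal to positive powers with respect to `1 / |q| ^ 2`. -/
theorem sum_coeff_wm (hq0 : ∀ w : ℂ, ‖w‖ ≤ 1 → qpoly m c w ≠ 0) (j : ℕ) :
    ∑ t ∈ Finset.range (m + 1), c t * wm (qpoly m c) ((t : ℤ) - j) =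
      conj (0 ^ j / qpoly m c 0) := by
  have hq := differentiable_qpoly m c
  calc _ = cavg fun w => ∑ t ∈ Finset.range (m + 1),
        c t * (w ^ ((t : ℤ) - j) / (‖qpoly m c w‖ : ℂ) ^ 2) := by
        rw [cavg_sum _ fun t _ => (circleCont_wm hq hq0 _).const_mul _]
        simp_rw [cavg_mul_left]
        rfl
    -- The sum produces a factor q, and q/(q q̄) leaves w⁻ʲ/q̄, the conjugate of a function analytic
    -- on the closed disk.
    _ = cavg fun w => conj (w ^ j / qpoly m c w) := by
        refine cavg_congr fun w hw => ?_
        have hw0 : w ≠ 0 := by rintro rfl; simp at hw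
        have h0 := hq0 w hw.le
        have h0' : conj (qpoly m c w) ≠ 0 := by simpa using h0
        rw [map_div₀, map_pow, conj_eq_inv hw, inv_pow, ← Complex.mul_conj']
        have : ∀ t : ℕ, c t * (w ^ ((t : ℤ) - j) / (qpoly m c w * conj (qpoly m c w))) =
            (c t * w ^ t) * (w ^ j * (qpoly m c w * conj (qpoly m c w)))⁻¹ := by
          intro t
          rw [zpow_sub₀ hw0, zpow_natCast, zpow_natCast]
          field_simp
        simp_rw [this]
        rw [← Finset.sum_mul]
        change qpoly m c w * _ = _
        field_simp
    _ = _ := by rw [cavg_conj, cavg_pow_div hq hq0]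

/-- Inversion of the Toeplitz matrix of the weight `1 / |q| ^ 2`. -/
theorem toeplitz_inverse (hq0 : ∀ w : ℂ, ‖w‖ ≤ 1 → qpoly m c w ≠ 0) {X : Fin m → Fin m → ℂ}
    (hX : ∀ w η : ℂ, (1 - w * conj η) *
      ∑ l : Fin m, ∑ l' : Fin m, X l l' * w ^ (l : ℕ) * conj (η ^ (l' : ℕ)) =
      qpoly m c w * conj (qpoly m c η) - qpoly m (revc m c) w * conj (qpoly m (revc m c) η))
    (k l' : Fin m) :
    ∑ l : Fin m, wm (qpoly m c) (((k : ℕ) : ℤ) - ((l : ℕ) : ℤ)) * conj (X l l') =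
      if k = l' then 1 else 0 := by
  set q := qpoly m c with hqdef
  set r := qpoly m (revc m c) with hrdef
  have hq : Differentiable ℂ q := differentiable_qpoly m c
  set a : Fin m → ℂ := fun l' => ∑ l : Fin m,
    wm q (((k : ℕ) : ℤ) - ((l : ℕ) : ℤ)) * conj (X l l') with ha
  -- Generating function in η of the k-th row of the product. Inserting `hX` splits the integrand
  -- into q(η) times a Cauchy integrand for wᵏ/q, minus r(η) times an antianalytic function.
  have key : ∀ η : ℂ, ‖η‖ < 1 → ∑ l' : Fin m, a l' * η ^ (l' : ℕ) = η ^ (k : ℕ) := by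
    intro η hη
    have hne : ∀ w : ℂ, ‖w‖ ≤ 1 → 1 - w * conj η ≠ 0 := by
      intro w hw h
      have h1 : ‖w * conj η‖ < 1 := by
        rw [norm_mul, Complex.norm_conj]
        nlinarith [norm_nonneg w, norm_nonneg η]
      rw [← sub_eq_zero.1 h] at h1
      simp at h1
    have h1 : ∑ l' : Fin m, a l' * η ^ (l' : ℕ) = cavg fun w =>
        ∑ l' : Fin m, ∑ l : Fin m, (conj (X l l') * η ^ (l' : ℕ)) *
          (w ^ (((k : ℕ) : ℤ) - ((l : ℕ) : ℤ)) / (‖q w‖ : ℂ) ^ 2) := by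
      rw [cavg_sum _ fun l' _ => CircleCont.fun_sum _ fun l =>
        (circleCont_wm hq hq0 _).const_mul _]
      refine Finset.sum_congr rfl fun l' _ => ?_
      rw [cavg_sum _ fun l _ => (circleCont_wm hq hq0 _).const_mul _, ha,
        Finset.sum_mul]
      refine Finset.sum_congr rfl fun l _ => ?_
      rw [cavg_mul_left, ← wm]
      ring
    have h2 : (cavg fun w => ((w - 0) / (w - η)) • (w ^ (k : ℕ) / q w)) = η ^ (k : ℕ) / q η := by
      refine DiffContOnCl.circleAverage_smul_div (f := fun w => w ^ (k : ℕ) / q w)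
        (DifferentiableOn.diffContOnCl ?_) (by simpa using hη)
      intro w hw
      rw [abs_one, closure_ball _ one_ne_zero] at hw
      exact ((by fun_prop : DifferentiableAt ℂ (fun w : ℂ => w ^ (k : ℕ)) w).div (hq w)
        (hq0 w (by simpa using hw))).differentiableWithinAt
    -- The antianalytic part vanishes because k < m leaves a positive power of w at the origin.
    have h3 : (cavg fun w => w ^ (m - k) / ((1 - w * conj η) * q w)) = 0 := by
      rw [cavg_eq_apply_zero]
      · have : m - (k : ℕ) ≠ 0 := by omega
        simp [this]
      · intro w hw
        exact (by fun_prop : DifferentiableAt ℂ (fun w : ℂ => w ^ (m - (k : ℕ))) w).div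
          ((by fun_prop : DifferentiableAt ℂ (fun w : ℂ => 1 - w * conj η) w).mul (hq w))
          (mul_ne_zero (hne w hw) (hq0 w hw))
    have hc1 : CircleCont fun w => ((w - 0) / (w - η)) • (w ^ (k : ℕ) / q w) := by
      have h4 : CircleCont fun w => (w - 0) / (w - η) := by
        refine ContinuousOn.div (by fun_prop) (by fun_prop) fun w hw h => ?_
        rw [sub_eq_zero] at h
        simp at hw
        rw [← h, hw] at hη
        exact lt_irrefl _ hη
      have h5 : CircleCont fun w => w ^ (k : ℕ) / q w :=
        ContinuousOn.div (by fun_prop) hq.continuous.continuousOn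
          fun w hw => hq0 w (by simp at hw; exact hw.le)
      exact h4.smul h5
    have hc2 : CircleCont fun w => w ^ (m - (k : ℕ)) / ((1 - w * conj η) * q w) := by
      refine ContinuousOn.div (by fun_prop) (ContinuousOn.mul (by fun_prop)
        hq.continuous.continuousOn) ?_
      intro w hw
      have hw' : ‖w‖ ≤ 1 := by simp at hw; exact hw.le
      exact mul_ne_zero (hne w hw') (hq0 w hw')
    calc ∑ l' : Fin m, a l' * η ^ (l' : ℕ)
        = cavg fun w => q η * (((w - 0) / (w - η)) • (w ^ (k : ℕ) / q w)) -
            r η * conj (w ^ (m - (k : ℕ)) / ((1 - w * conj η) * q w)) := by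
          rw [h1]
          refine cavg_congr fun w hw => ?_
          have hw0 : w ≠ 0 := by rintro rfl; simp at hw
          have h0 := hq0 w hw.le
          have h0' : conj (q w) ≠ 0 := by simpa using h0
          have h4 : ∑ l' : Fin m, ∑ l : Fin m, (conj (X l l') * η ^ (l' : ℕ)) *
              (w ^ (((k : ℕ) : ℤ) - ((l : ℕ) : ℤ)) / (‖q w‖ : ℂ) ^ 2) =
              w ^ (k : ℕ) / (‖q w‖ : ℂ) ^ 2 * conj (∑ l : Fin m, ∑ l' : Fin m,
                X l l' * w ^ (l : ℕ) * conj (η ^ (l' : ℕ))) := by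
            rw [Finset.sum_comm, map_sum, Finset.mul_sum]
            refine Finset.sum_congr rfl fun l _ => ?_
            rw [map_sum, Finset.mul_sum]
            refine Finset.sum_congr rfl fun l' _ => ?_
            rw [map_mul, map_mul, Complex.conj_conj, map_pow, conj_eq_inv hw, inv_pow, zpow_sub₀ hw0,
              zpow_natCast, zpow_natCast]
            field_simp
          have h5 := congrArg conj (hX w η)
          have h6 : 1 - w⁻¹ * η ≠ 0 := by
            have := (map_ne_zero (starRingEnd ℂ)).2 (hne w hw.le)
            rwa [map_sub, map_mul, Complex.conj_conj, map_one, conj_eq_inv hw] at this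
          have h7 : w - η ≠ 0 := by
            intro h
            apply h6
            rw [← sub_eq_zero.1 h, inv_mul_cancel₀ hw0, sub_self]
          rw [map_mul, map_sub, map_sub, map_mul, map_mul, map_mul, Complex.conj_conj,
            Complex.conj_conj, Complex.conj_conj, map_one, conj_eq_inv hw,
            hrdef, conj_qpoly_revc hw, ← hqdef, ← hrdef] at h5
          rw [mul_comm, ← eq_div_iff h6] at h5
          rw [h4, h5, ← Complex.mul_conj',
            map_div₀, map_mul, map_sub, map_mul, Complex.conj_conj, map_one, map_pow,
            conj_eq_inv hw, inv_pow, smul_eq_mul, sub_zero]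
          have h8 : w ^ m = w ^ (m - (k : ℕ)) * w ^ (k : ℕ) := by
            rw [← pow_add]; congr 1; omega
          have h9 : 1 - w⁻¹ * η = (w - η) / w := by field_simp
          rw [h8, h9]
          field_simp
      _ = q η * (η ^ (k : ℕ) / q η) - r η * conj 0 := by
          rw [cavg_sub (hc1.const_mul _) (hc2.conj.const_mul _),
            cavg_mul_left, cavg_mul_left, h2, cavg_conj, h3]
      _ = η ^ (k : ℕ) := by
          rw [map_zero, mul_zero, sub_zero, mul_div_cancel₀ _ (hq0 η hη.le)]
  -- The generating functions agree on the open disk, so the polynomials, and hence the matrix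
  -- entries, agree.
  have hpoly : (∑ l' : Fin m, Polynomial.C (a l') * Polynomial.X ^ (l' : ℕ)) =
      (Polynomial.X ^ (k : ℕ) : Polynomial ℂ) := by
    refine Polynomial.eq_of_infinite_eval_eq _ _ (Set.Infinite.mono (s := Metric.ball 0 1) ?_ ?_)
    · intro η hη
      have := key η (by simpa using hη)
      simpa [Polynomial.eval_finsetSum] using this
    · exact infinite_of_mem_nhds (0 : ℂ) (Metric.ball_mem_nhds _ one_pos)
  have := congrArg (fun P => Polynomial.coeff P (l' : ℕ)) hpoly
  simp only [Polynomial.finsetSum_coeff, Polynomial.coeff_C_mul_X_pow, Polynomial.coeff_X_pow]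
    at this
  rw [Finset.sum_eq_single l'] at this
  · simpa [Fin.ext_iff, eq_comm] using this
  · intro b _ hb
    rw [if_neg fun h => hb (Fin.ext h.symm)]
  · simp

end

/-! ### A trace inequality, and the Bernstein–Szegő functional of a stable polynomial -/

section

theorem cavg_re (F : ℂ → ℂ) (hF : CircleCont F) :
    (cavg F).re = (2 * Real.pi)⁻¹ * ∫ θ in (0 : ℝ)..(2 * Real.pi), (F (circleMap 0 1 θ)).re := by
  have h : ∫ θ in (0 : ℝ)..(2 * Real.pi), (F (circleMap 0 1 θ)).re =
      (∫ θ in (0 : ℝ)..(2 * Real.pi), F (circleMap 0 1 θ)).re :=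
    Complex.reCLM.intervalIntegral_comp_comm hF.integrable
  rw [h, cavg, Real.circleAverage_def, Complex.real_smul, Complex.re_ofReal_mul]

theorem cavg_nonneg {F : ℂ → ℂ} (h : ∀ z : ℂ, ‖z‖ = 1 → 0 ≤ F z) : 0 ≤ cavg F := by
  have h1 : cavg F = cavg fun z => (((F z).re : ℝ) : ℂ) :=
    cavg_congr fun z hz => by
      have := (Complex.le_def.1 (h z hz)).2
      exact Complex.ext (by simp) (by simpa using this.symm)
  rw [h1, cavg, Real.circleAverage_def, intervalIntegral.integral_ofReal, Complex.real_smul,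
    ← Complex.ofReal_mul, Complex.zero_le_real]
  refine mul_nonneg (by positivity) (intervalIntegral.integral_nonneg (by positivity) ?_)
  intro θ _
  exact (Complex.le_def.1 (h (circleMap 0 1 θ) (by simp))).1

theorem re_eq_zero_of_cavg_eq_zero {F : ℂ → ℂ} (hF : CircleCont F)
    (h : ∀ z : ℂ, ‖z‖ = 1 → 0 ≤ (F z).re) (h0 : cavg F = 0) {z : ℂ} (hz : ‖z‖ = 1) :
    (F z).re = 0 := by
  by_contra hne
  have hpos : 0 < (F z).re := lt_of_le_of_ne (h z hz) (Ne.symm hne)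
  have hcont : Continuous fun θ : ℝ => (F (circleMap 0 1 θ)).re :=
    Complex.continuous_re.comp (hF.comp_continuous (continuous_circleMap 0 1) (by simp))
  obtain ⟨θ, hθ, rfl⟩ : ∃ θ ∈ Set.Icc (0 : ℝ) (2 * Real.pi), circleMap 0 1 θ = z := by
    have : z ∈ circleMap 0 1 '' Set.Ioc 0 (2 * Real.pi) := by
      rw [image_circleMap_Ioc]; simpa using hz
    obtain ⟨θ, hθ, h⟩ := this
    exact ⟨θ, ⟨hθ.1.le, hθ.2⟩, h⟩
  have h1 := intervalIntegral.integral_pos (by positivity : (0 : ℝ) < 2 * Real.pi)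
    hcont.continuousOn (fun θ _ => h _ (by simp)) ⟨θ, hθ, hpos⟩
  have h2 := cavg_re F hF
  rw [h0, Complex.zero_re] at h2
  have : 0 < (2 * Real.pi)⁻¹ := by positivity
  nlinarith [mul_pos this h1]

theorem circleCont_cavg {F : ℂ → ℂ → ℂ}
    (hF : ContinuousOn (Function.uncurry F) (Metric.sphere 0 1 ×ˢ Metric.sphere 0 1)) :
    CircleCont fun z => cavg (F z) := by
  rw [CircleCont, continuousOn_iff_continuous_domRestrict]
  have : Continuous (Function.uncurry fun (z : Metric.sphere (0 : ℂ) 1) (θ : ℝ) =>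
      F z (circleMap 0 1 θ)) := by
    refine hF.comp_continuous (f := fun x : Metric.sphere (0 : ℂ) 1 × ℝ =>
      ((x.1 : ℂ), circleMap 0 1 x.2)) ?_ ?_
    · exact (continuous_subtype_val.comp continuous_fst).prodMk
        ((continuous_circleMap 0 1).comp continuous_snd)
    · rintro ⟨z, θ⟩
      exact ⟨z.2, by simp⟩
  exact (intervalIntegral.continuous_parametric_intervalIntegral_of_continuous' this 0
    (2 * Real.pi)).const_smul _

section Matrix
variable {m : ℕ}

/-- Matrix form of x + 1/x ≥ 2, from M + M⁻¹ - 2 = (M - 1)ᴴ M⁻¹ (M - 1). A positive semidefinite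
matrix of trace zero is zero, whence (M - 1)² = 0. -/
theorem trace_add_inv {M : Matrix (Fin m) (Fin m) ℂ} (hM : M.PosDef) :
    0 ≤ (M + M⁻¹ - 2).trace ∧ ((M + M⁻¹ - 2).trace = 0 → M = 1) := by
  have hdet : IsUnit M.det := (Matrix.isUnit_iff_isUnit_det M).1 hM.isUnit
  have h1 : M * M⁻¹ = 1 := Matrix.mul_nonsing_inv _ hdet
  have h2 : M⁻¹ * M = 1 := Matrix.nonsing_inv_mul _ hdet
  have hher : (M - 1).conjTranspose = M - 1 := by
    rw [Matrix.conjTranspose_sub, hM.isHermitian.eq, Matrix.conjTranspose_one]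
  have h3 : (M - 1).conjTranspose * M⁻¹ * (M - 1) = M + M⁻¹ - 2 := by
    rw [hher, sub_mul, h1, one_mul, mul_sub, sub_mul, one_mul, h2, mul_one]
    rw [show (2 : Matrix (Fin m) (Fin m) ℂ) = 1 + 1 from one_add_one_eq_two.symm]
    abel
  have hpsd : (M + M⁻¹ - 2).PosSemidef := by
    rw [← h3]
    exact hM.inv.posSemidef.conjTranspose_mul_mul_same _
  refine ⟨hpsd.trace_nonneg, fun h => ?_⟩
  have h4 := hpsd.trace_eq_zero_iff.1 h
  have h5 : (M - 1).conjTranspose * (M - 1) = 0 := by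
    have : (M - 1) * (M - 1) = M * (M + M⁻¹ - 2) := by
      rw [mul_sub M, mul_add M, h1, mul_two]
      noncomm_ring
    rw [hher, this, h4, mul_zero]
  exact sub_eq_zero.1 (Matrix.conjTranspose_mul_self_eq_zero.1 h5)

end Matrix

/-- `p(z, w)` has no zeros on the closed bidisk. -/
def LStable (p : Laurent) : Prop := ∀ z w : ℂ, ‖z‖ ≤ 1 → ‖w‖ ≤ 1 → ev z w p ≠ 0

variable {L : Laurent →ₗ[ℂ] ℂ} {n m : ℕ} {p : Laurent}

theorem ev_eq_qpoly (hp : p ∈ polySpace n m) (z : ℂ) :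
    (fun w => ev z w p) = qpoly m (fun t => col t z p) := by
  ext w
  have hp' : p ∈ polySpace n (((m + 1 : ℕ) : ℤ) - 1) := by simpa using hp
  rw [ev_eq_sum hp', qpoly]

theorem continuous_ev (hp : p ∈ polySpace n m) :
    Continuous (Function.uncurry fun z w => ev z w p) := by
  have h : (Function.uncurry fun z w => ev z w p) = fun x : ℂ × ℂ =>
      ∑ t ∈ Finset.range (m + 1), col t x.1 p * x.2 ^ t := by
    ext x
    exact congrFun (ev_eq_qpoly hp x.1) x.2
  rw [h]
  refine continuous_finsetSum _ fun t _ => ?_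
  exact ((differentiable_col hp _).continuous.comp continuous_fst).mul (by fun_prop)

/-- The moments in `w` of `1 / |p(z, w)| ^ 2`. -/
def wz (p : Laurent) (z : ℂ) (k : ℤ) : ℂ := wm (fun w => ev z w p) k

theorem wz_eq (hp : p ∈ polySpace n m) (z : ℂ) (k : ℤ) :
    wz p z k = wm (qpoly m (fun t => col t z p)) k := by
  rw [wz, ev_eq_qpoly hp]

theorem LStable.qpoly_ne_zero (hs : LStable p) (hp : p ∈ polySpace n m) {z : ℂ} (hz : ‖z‖ ≤ 1)
    (w : ℂ) (hw : ‖w‖ ≤ 1) : qpoly m (fun t => col t z p) w ≠ 0 := by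
  rw [← ev_eq_qpoly hp]; exact hs z w hz hw

theorem circleCont_wz (hp : p ∈ polySpace n m) (hs : LStable p) (k : ℤ) :
    CircleCont fun z => wz p z k := by
  refine circleCont_cavg (F := fun z w => w ^ k / (‖ev z w p‖ : ℂ) ^ 2) ?_
  refine ContinuousOn.div ?_ ?_ ?_
  · exact (circleCont_zpow k).comp continuousOn_snd (fun x hx => hx.2)
  · exact ((Complex.continuous_ofReal.comp (continuous_norm.comp (continuous_ev hp))).pow
      2).continuousOn
  · rintro ⟨z, w⟩ ⟨hz, hw⟩
    simp only [mem_sphere_iff_norm, sub_zero] at hz hw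
    simpa using hs z w hz.le hw.le

/-- The Bernstein–Szegő moments. -/
def bsm (p : Laurent) (j k : ℤ) : ℂ := cavg fun z => z ^ j * wz p z k

/-- The Bernstein–Szegő functional. -/
def bsLin (p : Laurent) : Laurent →ₗ[ℂ] ℂ :=
  (Finsupp.linearCombination ℂ (fun x : ℤ × ℤ => bsm p x.1 x.2)) ∘ₗ
    (AddMonoidAlgebra.coeffLinearEquiv ℂ : Laurent ≃ₗ[ℂ] _).toLinearMap

theorem bsLin_mono (p : Laurent) (s t : ℤ) : bsLin p (mono s t) = bsm p s t := by
  simp [bsLin, mono]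

theorem bsm_neg (p : Laurent) (j k : ℤ) : bsm p (-j) (-k) = conj (bsm p j k) := by
  rw [bsm, bsm, ← cavg_conj]
  refine cavg_congr fun z hz => ?_
  rw [map_mul, map_zpow₀, conj_eq_inv hz, inv_zpow', wz, wm_neg, wz]

/-- The exponents of the monomial are arbitrary integers, because w⁻¹ and the corner z^n w^m lie
outside the space on which the matrix weight represents the form. -/
theorem sesq_bsLin_mono (hp : p ∈ polySpace n m) (hs : LStable p) (j k : ℤ) {n' : ℕ}
    {h : Laurent} (hh : h ∈ polySpace n' ((m : ℤ) - 1)) :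
    sesq (bsLin p) (mono j k) h =
      cavg fun z => z ^ j * ∑ l : Fin m, wz p z (k - (l : ℕ)) * conj (col (l : ℕ) z h) := by
  conv_lhs => rw [polySpace_expand hh]
  simp only [map_sum, map_smulₛₗ, sesq_mono, bsLin_mono, smul_eq_mul]
  have hc : ∀ (s : ℕ) (t : ℕ), CircleCont fun z => z ^ (j - (s : ℤ)) * wz p z (k - t) :=
    fun s t => (circleCont_zpow _).fun_mul (circleCont_wz hp hs _)
  simp only [bsm, ← cavg_mul_left]
  simp_rw [← cavg_sum _ fun t _ => (hc _ t).const_mul _]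
  rw [← cavg_sum _ fun s _ => CircleCont.fun_sum _ fun t => (hc s t).const_mul _]
  refine cavg_congr fun z hz => ?_
  have hz0 : z ≠ 0 := by rintro rfl; simp at hz
  rw [Finset.sum_comm, ← Fin.sum_univ_eq_sum_range (fun t => ∑ s ∈ Finset.range (n' + 1),
    conj (h.coeff (s, t)) * (z ^ (j - s) * wz p z (k - t))) m, Finset.mul_sum]
  refine Finset.sum_congr rfl fun l _ => ?_
  rw [col_eq_sum hh, map_sum, Finset.mul_sum, Finset.mul_sum]
  refine Finset.sum_congr rfl fun s _ => ?_
  rw [map_mul, map_pow, conj_eq_inv hz, zpow_sub₀ hz0, zpow_natCast, inv_pow]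
  ring

/-- The Toeplitz matrix of the moments in `w`. -/
def matW (m : ℕ) (p : Laurent) (z : ℂ) : Matrix (Fin m) (Fin m) ℂ :=
  Matrix.of fun k l => wz p z (((k : ℕ) : ℤ) - ((l : ℕ) : ℤ))

theorem matW_apply (p : Laurent) (z : ℂ) (k l : Fin m) :
    matW m p z k l = wz p z (((k : ℕ) : ℤ) - ((l : ℕ) : ℤ)) := rfl

theorem sesq_bsLin (hp : p ∈ polySpace n m) (hs : LStable p) {n' n'' : ℕ} {f h : Laurent}
    (hf : f ∈ polySpace n' ((m : ℤ) - 1)) (hh : h ∈ polySpace n'' ((m : ℤ) - 1)) :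
    sesq (bsLin p) f h = cavg fun z => ∑ k : Fin m, ∑ l : Fin m,
      col (k : ℕ) z f * matW m p z k l * conj (col (l : ℕ) z h) := by
  conv_lhs => rw [polySpace_expand hf]
  simp only [map_sum, map_smulₛₗ, LinearMap.sum_apply, LinearMap.smul_apply, smul_eq_mul,
    RingHom.id_apply, sesq_bsLin_mono hp hs _ _ hh]
  have hc : ∀ (s : ℕ) (t : ℕ), CircleCont fun z => z ^ (s : ℤ) *
      ∑ l : Fin m, wz p z ((t : ℤ) - (l : ℕ)) * conj (col (l : ℕ) z h) :=
    fun s t => (circleCont_zpow _).fun_mul (CircleCont.fun_sum _ fun l =>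
      (circleCont_wz hp hs _).fun_mul (circleCont_col _ h).conj)
  simp only [← cavg_mul_left]
  simp_rw [← cavg_sum _ fun t _ => (hc _ t).const_mul _]
  rw [← cavg_sum _ fun s _ => CircleCont.fun_sum _ fun t => (hc s t).const_mul _]
  refine cavg_congr fun z hz => ?_
  rw [Finset.sum_comm, ← Fin.sum_univ_eq_sum_range (fun t => ∑ s ∈ Finset.range (n' + 1),
    f.coeff (s, t) * (z ^ (s : ℤ) * ∑ l : Fin m, wz p z (t - (l : ℕ)) *
      conj (col (l : ℕ) z h))) m]
  refine Finset.sum_congr rfl fun k _ => ?_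
  rw [col_eq_sum hf]
  simp only [mul_assoc, ← Finset.mul_sum]
  rw [Finset.sum_mul]
  refine Finset.sum_congr rfl fun s _ => ?_
  rw [zpow_natCast, mul_assoc]
  rfl

/-- If the weight of `p` is the weight of `g`, then `𝓖` is orthogonal to `z ^ j * w ^ (-1)`. -/
theorem sesq_bsLin_neg_one (hL : PosOn L n ((m : ℤ) - 1)) {g : Fin m → Laurent}
    (hg : IsONB L (spaceG L n m) g) (hp : p ∈ polySpace n m) (hs : LStable p)
    (hW : ∀ z : ℂ, ‖z‖ = 1 → matW m p z = weightG g z) {j : ℕ} (hj : j ≠ 0) {h : Laurent}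
    (hh : h ∈ spaceG L n m) : sesq (bsLin p) (mono j (-1)) h = 0 := by
  suffices H : ∀ i, sesq (bsLin p) (mono j (-1)) (g i) = 0 by
    rw [hg.expand h hh]
    simp [H]
  intro i
  rw [sesq_bsLin_mono hp hs _ _ (hg.mem i).1]
  have h0 : ∀ z : ℂ, ‖z‖ ≤ 1 → col 0 z p ≠ 0 := by
    intro z hz
    have := hs.qpoly_ne_zero hp hz 0 (by simp)
    rwa [qpoly, Finset.sum_range_succ', Finset.sum_eq_zero (fun t _ => by simp), zero_add,
      pow_zero, mul_one] at this
  -- By `sum_coeff_wm`, p₀ times the moment row of index -1 is -Σ pₜ₊₁ times row t. Paired with gᵢ,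
  -- row t gives the entry (t, i) of WΓᴴ = Γ⁻¹. The result is analytic as p₀ has no zeros in the
  -- closed disk, and the factor z^j makes it vanish at 0.
  have key : (cavg fun z => z ^ (j : ℤ) *
      ∑ l : Fin m, wz p z (-1 - (l : ℕ)) * conj (col (l : ℕ) z (g i))) =
      cavg fun z => z ^ j * (-(∑ t : Fin m, col ((t : ℕ) + 1 : ℕ) z p * matB g z t i) /
        col 0 z p) := by
    refine cavg_congr fun z hz => ?_
    rw [zpow_natCast]
    congr 1
    rw [eq_div_iff (h0 z hz.le), eq_neg_iff_add_eq_zero, mul_comm]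
    have hB : ∀ t : Fin m, matB g z t i =
        ∑ l : Fin m, wz p z ((t : ℕ) - (l : ℕ)) * conj (col (l : ℕ) z (g i)) := by
      intro t
      rw [← weightG_mul_matG hL hg hz.le, ← hW z hz, Matrix.mul_apply]
      rfl
    simp only [hB, Finset.mul_sum]
    rw [Finset.sum_comm, ← Finset.sum_add_distrib]
    refine Finset.sum_eq_zero fun l _ => ?_
    have h1 := sum_coeff_wm (fun w hw => hs.qpoly_ne_zero hp hz.le w hw) ((l : ℕ) + 1)
    rw [zero_pow (by omega), zero_div, map_zero, Finset.sum_range_succ'] at h1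
    simp only [← wz_eq hp] at h1
    rw [← Fin.sum_univ_eq_sum_range (fun t => col ((t + 1 : ℕ) : ℤ) z p *
      wz p z (((t + 1 : ℕ) : ℤ) - ((((l : ℕ) + 1 : ℕ)) : ℤ))) m] at h1
    have h2 : ∀ t : ℕ, ((t + 1 : ℕ) : ℤ) - (((l : ℕ) + 1 : ℕ) : ℤ) = (t : ℤ) - (l : ℕ) :=
      fun t => by push_cast; ring
    have h3 : ((0 : ℕ) : ℤ) - (((l : ℕ) + 1 : ℕ) : ℤ) = -1 - (l : ℕ) := by push_cast; ring
    simp only [h2, h3] at h1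
    simp only [← mul_assoc, ← Finset.sum_mul]
    rw [← add_mul, add_comm]
    push_cast at h1 ⊢
    rw [h1, zero_mul]
  rw [key, cavg_eq_apply_zero]
  · simp [hj]
  · intro z hz
    refine (by fun_prop : DifferentiableAt ℂ (fun z : ℂ => z ^ j) z).mul
      (DifferentiableAt.div (DifferentiableAt.neg (DifferentiableAt.fun_sum fun t _ => ?_))
        (differentiable_col hp _ z) (h0 z hz))
    exact (differentiable_col hp _ z).mul (differentiableAt_matB hL hg hz _ _)

end

/-! ### The Gohberg–Semencul formula, and equality of weights from equality of moments -/

section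

theorem CircleCont.fun_add {f g : ℂ → ℂ} (hf : CircleCont f) (hg : CircleCont g) :
    CircleCont fun z => f z + g z := ContinuousOn.add hf hg

theorem CircleCont.fun_sub {f g : ℂ → ℂ} (hf : CircleCont f) (hg : CircleCont g) :
    CircleCont fun z => f z - g z := ContinuousOn.sub hf hg

theorem circleCont_const (a : ℂ) : CircleCont fun _ => a := continuousOn_const

/-- The coefficients of the quotient of `∑ a l l' * x ^ l * y ^ l'` by `1 - x * y`. -/
def gsX (a : ℕ → ℕ → ℂ) (l l' : ℕ) : ℂ := ∑ i ∈ Finset.range (min l l' + 1), a (l - i) (l' - i)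

theorem gsX_succ (a : ℕ → ℕ → ℂ) (l l' : ℕ) :
    gsX a (l + 1) (l' + 1) = gsX a l l' + a (l + 1) (l' + 1) := by
  rw [gsX, gsX, Nat.add_min_add_right, Finset.sum_range_succ']
  simp

/-- `gsX` sums along diagonals, so multiplying by 1 - xy telescopes by `gsX_succ`. The vanishing
border says that the quotient has degree below m in each variable. -/
theorem gsX_mul (a : ℕ → ℕ → ℂ) (m : ℕ) (h1 : ∀ l ≤ m, gsX a l m = 0)
    (h2 : ∀ l ≤ m, gsX a m l = 0) (x y : ℂ) :
    (1 - x * y) * ∑ l ∈ Finset.range m, ∑ l' ∈ Finset.range m, gsX a l l' * x ^ l * y ^ l' =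
      ∑ l ∈ Finset.range (m + 1), ∑ l' ∈ Finset.range (m + 1), a l l' * x ^ l * y ^ l' := by
  have hX : ∑ l ∈ Finset.range m, ∑ l' ∈ Finset.range m, gsX a l l' * x ^ l * y ^ l' =
      ∑ l ∈ Finset.range (m + 1), ∑ l' ∈ Finset.range (m + 1), gsX a l l' * x ^ l * y ^ l' := by
    rw [Finset.sum_range_succ, Finset.sum_eq_zero (s := Finset.range (m + 1)), add_zero]
    · refine Finset.sum_congr rfl fun l hl => ?_
      rw [Finset.sum_range_succ, h1 l (Finset.mem_range.1 hl).le]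
      ring
    · intro l hl
      rw [h2 l (Nat.lt_succ_iff.1 (Finset.mem_range.1 hl))]
      ring
  have split : ∀ b : ℕ → ℕ → ℂ,
      ∑ l ∈ Finset.range (m + 1), ∑ l' ∈ Finset.range (m + 1), b l l' * x ^ l * y ^ l' =
      ∑ l ∈ Finset.range m, ∑ l' ∈ Finset.range m, b (l + 1) (l' + 1) * x ^ (l + 1) * y ^ (l' + 1)
      + ∑ l ∈ Finset.range m, b (l + 1) 0 * x ^ (l + 1) +
      ∑ l' ∈ Finset.range (m + 1), b 0 l' * y ^ l' := by
    intro b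
    rw [Finset.sum_range_succ']
    simp_rw [Finset.sum_range_succ' _ m]
    rw [Finset.sum_add_distrib]
    simp
  have e1 : ∀ l, gsX a 0 l = a 0 l := fun l => by simp [gsX]
  have e2 : ∀ l, gsX a l 0 = a l 0 := fun l => by simp [gsX]
  rw [sub_mul, one_mul]
  conv_lhs => enter [1]; rw [hX, split]
  rw [split]
  simp only [e1, e2, gsX_succ, add_mul, Finset.sum_add_distrib]
  have : x * y * ∑ l ∈ Finset.range m, ∑ l' ∈ Finset.range m, gsX a l l' * x ^ l * y ^ l' =
      ∑ l ∈ Finset.range m, ∑ l' ∈ Finset.range m, gsX a l l' * x ^ (l + 1) * y ^ (l' + 1) := by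
    simp only [Finset.mul_sum]
    refine Finset.sum_congr rfl fun l _ => Finset.sum_congr rfl fun l' _ => ?_
    ring
  rw [this]
  ring

/-- The coefficients of `q q̄ - q̃ q̃̄`. -/
def gsA (m : ℕ) (c : ℕ → ℂ) (l l' : ℕ) : ℂ :=
  c l * conj (c l') - revc m c l * conj (revc m c l')

/-- Reversing the order of summation turns the q q̄ terms into the terms of the reversed polynomial.
-/
theorem gsX_gsA_right (m : ℕ) (c : ℕ → ℂ) {l : ℕ} (hl : l ≤ m) : gsX (gsA m c) m l = 0 := by
  rw [gsX, min_eq_right hl]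
  simp only [gsA, Finset.sum_sub_distrib]
  rw [sub_eq_zero, ← Finset.sum_range_reflect]
  refine Finset.sum_congr rfl fun i hi => ?_
  have hi' := Nat.lt_succ_iff.1 (Finset.mem_range.1 hi)
  have h1 : m - (l + 1 - 1 - i) = m - (l - i) := by omega
  have h2 : l - (l + 1 - 1 - i) = i := by omega
  have h3 : m - (m - i) = i := by omega
  rw [h1, h2, revc, revc, h3, Complex.conj_conj, mul_comm]

theorem gsX_gsA_left (m : ℕ) (c : ℕ → ℂ) {l : ℕ} (hl : l ≤ m) : gsX (gsA m c) l m = 0 := by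
  have h : gsX (gsA m c) l m = conj (gsX (gsA m c) m l) := by
    rw [gsX, gsX, map_sum, min_comm]
    refine Finset.sum_congr rfl fun i _ => ?_
    simp only [gsA, map_sub, map_mul, Complex.conj_conj]
    ring
  rw [h, gsX_gsA_right m c hl, map_zero]

/-- Provides the hypothesis `hX` of `toeplitz_inverse` for every q, with entries quadratic in the
coefficients of q and their conjugates. -/
theorem gsX_identity (m : ℕ) (c : ℕ → ℂ) (w η : ℂ) :
    (1 - w * conj η) * ∑ l : Fin m, ∑ l' : Fin m,
      gsX (gsA m c) l l' * w ^ (l : ℕ) * conj (η ^ (l' : ℕ)) =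
      qpoly m c w * conj (qpoly m c η) - qpoly m (revc m c) w * conj (qpoly m (revc m c) η) := by
  have h := gsX_mul (gsA m c) m (fun l hl => gsX_gsA_left m c hl)
    (fun l hl => gsX_gsA_right m c hl) w (conj η)
  rw [← Fin.sum_univ_eq_sum_range (fun l => ∑ l' ∈ Finset.range m,
    gsX (gsA m c) l l' * w ^ l * (conj η) ^ l') m] at h
  simp_rw [← fun l : ℕ => Fin.sum_univ_eq_sum_range (fun l' =>
    gsX (gsA m c) l l' * w ^ l * (conj η) ^ l') m, ← map_pow] at h
  rw [h]
  simp only [qpoly, map_sum, Finset.sum_mul_sum, gsA, sub_mul, Finset.sum_sub_distrib, map_mul,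
    map_pow]
  congr 1 <;>
  exact Finset.sum_congr rfl fun l _ => Finset.sum_congr rfl fun l' _ => by ring

variable {L : Laurent →ₗ[ℂ] ℂ} {n m : ℕ} {p : Laurent}

/-- Two functionals which agree on `𝓛_{n,m}` define the same form. -/
theorem sesq_congr {L' : Laurent →ₗ[ℂ] ℂ} {k l : ℤ} (h : ∀ f ∈ laurentSpace k l, L f = L' f)
    {f g : Laurent} (hf : f ∈ polySpace k l) (hg : g ∈ polySpace k l) :
    sesq L f g = sesq L' f g := h _ (mul_conjInv_mem hf hg)

/-- Two weights with the same moments have the same integrals against `φ ψ̄`. -/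
theorem cavg_weight_eq (hL : PosOn L n ((m : ℤ) - 1)) {g : Fin m → Laurent}
    (hg : IsONB L (spaceG L n m) g) (hp : p ∈ polySpace n m) (hs : LStable p)
    (hag : ∀ f ∈ laurentSpace n ((m : ℤ) - 1), L f = bsLin p f) {f h : Laurent} {l l' : ℤ}
    (hf : f ∈ polySpace n l) (hh : h ∈ polySpace n l') (a b : ℤ) (i j : Fin m) :
    (cavg fun z => col a z f * weightG g z i j * conj (col b z h)) =
      cavg fun z => col a z f * matW m p z i j * conj (col b z h) := by
  -- Moving a column of f to the power wⁱ isolates one entry of the weight. The source column may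
  -- have any index a, so column m of p is allowed.
  have exists_row : ∀ {f : Laurent} {l : ℤ}, f ∈ polySpace n l → ∀ (a : ℤ) (i : Fin m),
      ∃ F ∈ polySpace n ((m : ℤ) - 1), ∀ (k : Fin m) z,
        col (k : ℕ) z F = if k = i then col a z f else 0 := by
    intro f l hf a i
    refine ⟨∑ s ∈ Finset.range (n + 1), f.coeff (s, a) • mono s (i : ℕ),
      Submodule.sum_mem _ fun s hs => Submodule.smul_mem _ _ (mono_mem_polySpace (by omega)
        (by have := Finset.mem_range.1 hs; omega) (by omega) (by omega)), fun k z => ?_⟩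
    simp only [map_sum, map_smul, col_mono, col_eq_sum hf, smul_eq_mul, Nat.cast_inj,
      Fin.val_inj, eq_comm (a := i), zpow_natCast]
    split_ifs <;> simp
  obtain ⟨F, hF, hF'⟩ := exists_row hf a i
  obtain ⟨H, hH, hH'⟩ := exists_row hh b j
  have h1 := sesq_eq_gform hL hg hF hH
  rw [sesq_congr hag hF hH, sesq_bsLin hp hs hF hH, gform] at h1
  simpa [hF', hH', ite_mul, mul_ite, apply_ite] using h1.symm

theorem matW_isHermitian (p : Laurent) (z : ℂ) : (matW m p z).IsHermitian := by
  ext k l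
  rw [Matrix.conjTranspose_apply, matW_apply, matW_apply, wz, wz, ← neg_sub, wm_neg]
  simp

/-- The quadratic form at x is the average in w of |Σ xₗ w⁻ˡ|² / |p(z, w)|². -/
theorem matW_posSemidef (hp : p ∈ polySpace n m) (hs : LStable p) {z : ℂ} (hz : ‖z‖ = 1) :
    (matW m p z).PosSemidef := by
  refine Matrix.PosSemidef.of_dotProduct_mulVec_nonneg (matW_isHermitian p z) fun x => ?_
  have hq0 : ∀ w : ℂ, ‖w‖ ≤ 1 → qpoly m (fun t => col t z p) w ≠ 0 :=
    fun w hw => hs.qpoly_ne_zero hp hz.le w hw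
  have hc : ∀ k : ℤ, CircleCont fun w => w ^ k / (‖qpoly m (fun t => col t z p) w‖ : ℂ) ^ 2 :=
    circleCont_wm (differentiable_qpoly _ _) hq0
  have h1 : star x ⬝ᵥ (matW m p z).mulVec x = cavg fun w =>
      ∑ k : Fin m, ∑ l : Fin m, conj (x k) * x l * (w ^ (((k : ℕ) : ℤ) - ((l : ℕ) : ℤ)) /
        (‖qpoly m (fun t => col t z p) w‖ : ℂ) ^ 2) := by
    rw [cavg_sum _ fun k _ => CircleCont.fun_sum _ fun l => (hc _).const_mul _]
    simp only [dotProduct, Matrix.mulVec, Finset.mul_sum]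
    refine Finset.sum_congr rfl fun k _ => ?_
    rw [cavg_sum _ fun l _ => (hc _).const_mul _]
    refine Finset.sum_congr rfl fun l _ => ?_
    rw [cavg_mul_left, matW_apply, wz_eq hp, wm, Pi.star_apply]
    change conj (x k) * _ = _
    ring
  rw [h1]
  refine cavg_nonneg fun w hw => ?_
  have hw0 : w ≠ 0 := by rintro rfl; simp at hw
  have h2 : ∑ k : Fin m, ∑ l : Fin m, conj (x k) * x l * (w ^ (((k : ℕ) : ℤ) - ((l : ℕ) : ℤ)) /
        (‖qpoly m (fun t => col t z p) w‖ : ℂ) ^ 2) =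
      (((‖∑ l : Fin m, x l * (w ^ (l : ℕ))⁻¹‖ / ‖qpoly m (fun t => col t z p) w‖) ^ 2 : ℝ) : ℂ) := by
    push_cast
    rw [div_pow, ← Complex.conj_mul' (∑ l : Fin m, x l * (w ^ (l : ℕ))⁻¹), map_sum, Finset.sum_mul_sum, Finset.sum_div]
    refine Finset.sum_congr rfl fun k _ => ?_
    rw [Finset.sum_div]
    refine Finset.sum_congr rfl fun l _ => ?_
    rw [map_mul, map_inv₀, map_pow, conj_eq_inv hw, zpow_sub₀ hw0, zpow_natCast, zpow_natCast,
      inv_pow, inv_inv]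
    ring
  rw [h2, Complex.zero_le_real]
  positivity

/-- If `L` has the Bernstein–Szegő moments of `p` then the weight of `p` is the weight of an
orthonormal basis of `𝓖`. -/
theorem matW_eq_weightG (hL : PosOn L n ((m : ℤ) - 1)) {g : Fin m → Laurent}
    (hg : IsONB L (spaceG L n m) g) (hp : p ∈ polySpace n m) (hs : LStable p)
    (hag : ∀ f ∈ laurentSpace n ((m : ℤ) - 1), L f = bsLin p f) {z : ℂ} (hz : ‖z‖ = 1) :
    matW m p z = weightG g z := by
  let X : ℂ → Matrix (Fin m) (Fin m) ℂ := fun z =>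
    Matrix.of fun l l' => conj (gsX (gsA m fun t => col t z p) l l')
  have hWX : ∀ z : ℂ, ‖z‖ = 1 → matW m p z * X z = 1 := by
    intro z hz
    ext k l'
    rw [Matrix.mul_apply, Matrix.one_apply]
    simp only [matW_apply, wz_eq hp]
    exact toeplitz_inverse (fun w hw => hs.qpoly_ne_zero hp hz.le w hw)
      (gsX_identity m fun t => col t z p) k l'
  -- M = ΓWΓᴴ is the identity exactly when W = Γ⁻¹Γ⁻ᴴ; the aim is that tr(M + M⁻¹ - 2) has average
  -- zero.
  let M : ℂ → Matrix (Fin m) (Fin m) ℂ := fun z =>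
    matG g z * matW m p z * (matG g z).conjTranspose
  have hM : ∀ z : ℂ, ‖z‖ = 1 → (M z).PosDef := by
    intro z hz
    have h1 : (matW m p z).PosDef := by
      rw [(matW_posSemidef hp hs hz).posDef_iff_isUnit]
      exact IsUnit.of_mul_eq_one _ (hWX z hz)
    refine h1.mul_mul_conjTranspose_same ?_
    exact Matrix.vecMul_injective_of_isUnit ((Matrix.isUnit_iff_isUnit_det _).2
      (isUnit_iff_ne_zero.2 (det_matG_ne_zero hL hg hz.le)))
  have hMinv : ∀ z : ℂ, ‖z‖ = 1 →
      (M z)⁻¹ = (matB g z).conjTranspose * X z * matB g z := by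
    intro z hz
    apply Matrix.inv_eq_right_inv
    have h1 : (matG g z).conjTranspose * (matB g z).conjTranspose = 1 := by
      rw [← Matrix.conjTranspose_mul, matB_mul_matG hL hg hz.le, Matrix.conjTranspose_one]
    calc M z * ((matB g z).conjTranspose * X z * matB g z)
        = matG g z * (matW m p z * (((matG g z).conjTranspose * (matB g z).conjTranspose) * X z)) *
          matB g z := by simp only [M, mul_assoc]
      _ = 1 := by rw [h1, one_mul, hWX z hz, mul_one, matG_mul_matB hL hg hz.le]
  have htr : ∀ z : ℂ, ‖z‖ = 1 → (M z + (M z)⁻¹ - 2).trace =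
      ∑ i : Fin m, (∑ k : Fin m, ∑ l : Fin m,
        col (k : ℕ) z (g i) * matW m p z k l * conj (col (l : ℕ) z (g i))) +
      (∑ l : Fin m, ∑ l' : Fin m, X z l l' * weightG g z l' l) - 2 * m := by
    intro z hz
    have t1 : (M z).trace = ∑ i : Fin m, (∑ k : Fin m, ∑ l : Fin m,
        col (k : ℕ) z (g i) * matW m p z k l * conj (col (l : ℕ) z (g i))) := by
      refine Finset.sum_congr rfl fun i _ => ?_
      simp only [M, Matrix.diag_apply, Matrix.mul_apply, Finset.sum_mul]
      rw [Finset.sum_comm]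
      rfl
    have t2 : ((M z)⁻¹).trace = ∑ l : Fin m, ∑ l' : Fin m, X z l l' * weightG g z l' l := by
      rw [hMinv z hz, Matrix.trace_mul_comm, ← mul_assoc, Matrix.trace_mul_comm, ← weightG]
      simp only [Matrix.trace, Matrix.diag_apply, Matrix.mul_apply]
    rw [Matrix.trace_sub, Matrix.trace_add, t1, t2,
      show (2 : Matrix (Fin m) (Fin m) ℂ) = 1 + 1 from one_add_one_eq_two.symm,
      Matrix.trace_add, Matrix.trace_one, Fintype.card_fin]
    ring
  have hcW : ∀ k l : Fin m, CircleCont fun z => matW m p z k l :=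
    fun k l => circleCont_wz hp hs _
  have hcX : ∀ l l' : Fin m, CircleCont fun z => X z l l' := by
    intro l l'
    refine CircleCont.conj (f := fun z => gsX (gsA m fun t => col t z p) l l')
      (CircleCont.fun_sum _ fun i => ?_)
    exact ((circleCont_col _ p).fun_mul (circleCont_col _ p).conj).sub
      ((circleCont_col _ p).conj.fun_mul (circleCont_col _ p).conj.conj)
  have hcG : ∀ i, CircleCont fun z => ∑ k : Fin m, ∑ l : Fin m,
        col (k : ℕ) z (g i) * matW m p z k l * conj (col (l : ℕ) z (g i)) :=
    fun i => CircleCont.fun_sum _ fun k => CircleCont.fun_sum _ fun l =>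
      ((circleCont_col _ _).fun_mul (hcW k l)).fun_mul (circleCont_col _ _).conj
  have hcB : ∀ k l : Fin m, CircleCont fun z => weightG g z k l := circleCont_weightG hL hg
  have hcXB : CircleCont fun z => ∑ l : Fin m, ∑ l' : Fin m, X z l l' * weightG g z l' l :=
    CircleCont.fun_sum _ fun l => CircleCont.fun_sum _ fun l' => (hcX l l').fun_mul (hcB l' l)
  -- Average of tr M⁻¹. The entries of X = W⁻¹ are sums of products of a column of p with a
  -- conjugated one, so `cavg_weight_eq` replaces Γ⁻¹Γ⁻ᴴ by W, and tr(XW) = m pointwise.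
  have hXB : (cavg fun z => ∑ l : Fin m, ∑ l' : Fin m, X z l l' * weightG g z l' l) = m := by
    have h1 : (cavg fun z => ∑ l : Fin m, ∑ l' : Fin m, X z l l' * weightG g z l' l) =
        cavg fun z => ∑ l : Fin m, ∑ l' : Fin m, X z l l' * matW m p z l' l := by
      rw [cavg_sum _ fun l _ => CircleCont.fun_sum _ fun l' => (hcX l l').fun_mul (hcB l' l),
        cavg_sum _ fun l _ => CircleCont.fun_sum _ fun l' => (hcX l l').fun_mul (hcW l' l)]
      refine Finset.sum_congr rfl fun l _ => ?_
      rw [cavg_sum _ fun l' _ => (hcX l l').fun_mul (hcB l' l),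
        cavg_sum _ fun l' _ => (hcX l l').fun_mul (hcW l' l)]
      refine Finset.sum_congr rfl fun l' _ => ?_
      have hX : ∀ (A : ℂ → ℂ), CircleCont A → (cavg fun z => X z l l' * A z) =
          ∑ i ∈ Finset.range (min (l : ℕ) (l' : ℕ) + 1),
          ((cavg fun z => col ((l' - i : ℕ) : ℤ) z p * A z * conj (col ((l - i : ℕ) : ℤ) z p)) -
          cavg fun z => col ((m - (l - i) : ℕ) : ℤ) z p * A z *
            conj (col ((m - (l' - i) : ℕ) : ℤ) z p)) := by
        intro A hA
        have hc : ∀ a b : ℤ, CircleCont fun z => col a z p * A z * conj (col b z p) :=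
          fun a b => ((circleCont_col _ p).fun_mul hA).fun_mul (circleCont_col _ p).conj
        refine Eq.trans ?_ (Finset.sum_congr rfl fun i _ => cavg_sub (hc _ _) (hc _ _))
        rw [← cavg_sum _ fun i _ => (hc _ _).fun_sub (hc _ _)]
        refine cavg_congr fun z _ => ?_
        simp only [X, Matrix.of_apply, gsX, gsA, revc, map_sum, map_sub, map_mul,
          Complex.conj_conj, Finset.sum_mul]
        refine Finset.sum_congr rfl fun i _ => ?_
        ring
      rw [hX _ (hcB l' l), hX _ (hcW l' l)]
      refine Finset.sum_congr rfl fun i _ => ?_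
      rw [cavg_weight_eq hL hg hp hs hag hp hp, cavg_weight_eq hL hg hp hs hag hp hp]
    rw [h1, ← cavg_const (m : ℂ)]
    refine cavg_congr fun z hz => ?_
    have h2 : (X z * matW m p z).trace = m := by
      rw [mul_eq_one_comm.1 (hWX z hz), Matrix.trace_one, Fintype.card_fin]
    rw [← h2]
    simp only [Matrix.trace, Matrix.diag_apply, Matrix.mul_apply]
  -- Average of tr M: the i-th diagonal entry averages to ⟨gᵢ, gᵢ⟩ = 1.
  have hGG : (cavg fun z => ∑ i : Fin m, (∑ k : Fin m, ∑ l : Fin m,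
        col (k : ℕ) z (g i) * matW m p z k l * conj (col (l : ℕ) z (g i)))) = m := by
    rw [cavg_sum _ fun i _ => hcG i]
    simp_rw [← fun i => sesq_bsLin hp hs (hg.mem i).1 (hg.mem i).1,
      ← fun i => sesq_congr hag (hg.mem i).1 (hg.mem i).1, hg.inner]
    simp
  let F : ℂ → ℂ := fun z => ∑ i : Fin m, (∑ k : Fin m, ∑ l : Fin m,
        col (k : ℕ) z (g i) * matW m p z k l * conj (col (l : ℕ) z (g i))) +
      (∑ l : Fin m, ∑ l' : Fin m, X z l l' * weightG g z l' l) - 2 * m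
  have hcF1 : CircleCont fun z => ∑ i : Fin m, (∑ k : Fin m, ∑ l : Fin m,
        col (k : ℕ) z (g i) * matW m p z k l * conj (col (l : ℕ) z (g i))) :=
    CircleCont.fun_sum _ hcG
  have hcF : CircleCont F := (hcF1.fun_add hcXB).fun_sub (circleCont_const _)
  have hF0 : cavg F = 0 := by
    rw [cavg_sub (hcF1.fun_add hcXB) (circleCont_const _), cavg_add hcF1 hcXB, hGG, hXB, cavg_const]
    ring
  have hF1 : ∀ z : ℂ, ‖z‖ = 1 → 0 ≤ F z := fun z hz => by
    simp only [F]; rw [← htr z hz]; exact (trace_add_inv (hM z hz)).1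
  have hFz := re_eq_zero_of_cavg_eq_zero hcF (fun z hz => (Complex.le_def.1 (hF1 z hz)).1) hF0 hz
  have hM1 : M z = 1 := by
    refine (trace_add_inv (hM z hz)).2 ?_
    rw [htr z hz]
    exact Complex.ext hFz (Complex.le_def.1 (hF1 z hz)).2.symm
  calc matW m p z = (matB g z * matG g z) * matW m p z * (matB g z * matG g z).conjTranspose := by
        rw [matB_mul_matG hL hg hz.le, one_mul, Matrix.conjTranspose_one, mul_one]
    _ = matB g z * M z * (matB g z).conjTranspose := by
        rw [Matrix.conjTranspose_mul]; simp only [M, mul_assoc]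
    _ = weightG g z := by rw [hM1, mul_one, weightG]

end

/-! ### The extremal polynomial and the Christoffel–Darboux formula -/

section

/-- `𝓕¹_{n-1,m}` inside the Laurent polynomials. -/
def spaceF1 (L : Laurent →ₗ[ℂ] ℂ) (n m : ℕ) : Submodule ℂ Laurent :=
  perp L (polySpace ((n : ℤ) - 1) m) (polySpace ((n : ℤ) - 1) ((m : ℤ) - 1))

/-- `𝓕²_{n,m-1}` inside the Laurent polynomials. -/
def spaceF2 (L : Laurent →ₗ[ℂ] ℂ) (n m : ℕ) : Submodule ℂ Laurent :=
  perp L (polySpace n ((m : ℤ) - 1)) (polySpace ((n : ℤ) - 1) ((m : ℤ) - 1))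

/-- The orthonormalized constant polynomial, of exact position `(0, 0)`. -/
structure IsExtremal (L : Laurent →ₗ[ℂ] ℂ) (n m : ℕ) (p : Laurent) : Prop where
  mem : p ∈ polySpace n m
  orth : ∀ x ∈ polySpace n m, x.coeff (0, 0) = 0 → sesq L p x = 0
  norm : sesq L p p = 1

variable {L : Laurent →ₗ[ℂ] ℂ} {n m : ℕ} {p : Laurent}

/-- Take 1 minus its projection onto the elements without constant term. Its constant coefficient is
still 1, so it is nonzero and can be normalized. -/
theorem exists_isExtremal (hL : PosOn L n m) : ∃ p, IsExtremal L n m p := by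
  let N : Submodule ℂ Laurent := polySpace n m ⊓ LinearMap.ker (coeffLin 0 0)
  obtain ⟨b, hb⟩ := hL.exists_isONB (S := N) inf_le_left
  set y : Laurent := 1 - ∑ i, sesq L 1 (b i) • b i with hy
  have h1 : (1 : Laurent) ∈ polySpace n m :=
    mono_mem_polySpace le_rfl (by omega) le_rfl (by omega)
  have hyn : y ∈ polySpace n m := Submodule.sub_mem _ h1
    (Submodule.sum_mem _ fun i _ => Submodule.smul_mem _ _ (hb.mem i).1)
  have hy0 : y ≠ 0 := by
    intro h
    have h2 : coeffLin 0 0 y = 1 := by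
      have : ∀ i, coeffLin 0 0 (b i) = 0 := fun i => (hb.mem i).2
      rw [hy, map_sub, map_sum]
      simp only [map_smul, this, smul_zero, Finset.sum_const_zero, sub_zero]
      rw [← mono_zero, coeffLin_apply, coeff_mono]
      simp
    simp [h] at h2
  have hpos := hL.pos y hyn hy0
  refine ⟨((Real.sqrt (sesq L y y).re)⁻¹ : ℂ) • y, Submodule.smul_mem _ _ hyn, ?_, ?_⟩
  · intro x hx hx0
    rw [map_smul, LinearMap.smul_apply, hb.sub_perp 1 ⟨hx, hx0⟩, smul_zero]
  · simp only [map_smulₛₗ, LinearMap.smul_apply, smul_eq_mul, RingHom.id_apply, map_inv₀,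
      Complex.conj_ofReal]
    rw [hL.self_eq hyn]
    norm_cast
    have h3 := Real.mul_self_sqrt hpos.le
    have h4 : Real.sqrt (sesq L y y).re ≠ 0 := (Real.sqrt_pos.2 hpos).ne'
    generalize Real.sqrt (sesq L y y).re = r at h3 h4
    rw [← h3]
    field_simp

theorem IsExtremal.sesq_eq (hp : IsExtremal L n m p) {x : Laurent} (hx : x ∈ polySpace n m) :
    sesq L p x = conj (x.coeff (0, 0)) * sesq L p 1 := by
  have h1 : (1 : Laurent) ∈ polySpace n m :=
    mono_mem_polySpace le_rfl (by omega) le_rfl (by omega)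
  have := hp.orth (x - x.coeff (0, 0) • 1)
    (Submodule.sub_mem _ hx (Submodule.smul_mem _ _ h1)) (by
      rw [← coeffLin_apply, map_sub, map_smul, coeffLin_apply, ← mono_zero, coeffLin_apply,
        coeff_mono]
      simp)
  rw [map_sub, map_smulₛₗ, sub_eq_zero] at this
  exact this

theorem IsExtremal.coeff_ne_zero (hp : IsExtremal L n m p) : p.coeff (0, 0) ≠ 0 := by
  intro h
  have := hp.norm
  rw [hp.sesq_eq hp.mem, h] at this
  simp at this

/-- Reversal exchanges the coefficients at (0, 0) and (n, m). -/
theorem IsExtremal.rev_orth (hL : PosOn L n m) (hp : IsExtremal L n m p) {x : Laurent}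
    (hx : x ∈ polySpace n m) (hx0 : x.coeff (n, m) = 0) : sesq L (rev n m p) x = 0 := by
  rw [← rev_rev n m x, sesq_rev, hL.symm hp.mem (rev_mem hx), hp.orth _ (rev_mem hx), map_zero]
  rw [coeff_rev]
  simp [hx0]

theorem mem_sup_polySpace {x : Laurent} (hx : x ∈ polySpace n m) (hx0 : x.coeff (n, m) = 0) :
    x ∈ polySpace ((n : ℤ) - 1) m ⊔ polySpace n ((m : ℤ) - 1) := by
  have hx' : x ∈ polySpace n (((m + 1 : ℕ) : ℤ) - 1) := by simpa using hx
  rw [polySpace_expand hx']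
  refine Submodule.sum_mem _ fun s hs => Submodule.sum_mem _ fun t ht => ?_
  rw [Finset.mem_range] at hs ht
  by_cases h : s = n
  · by_cases h' : t = m
    · rw [h, h', hx0, zero_smul]; exact Submodule.zero_mem _
    · exact Submodule.mem_sup_right (Submodule.smul_mem _ _
        (mono_mem_polySpace (by omega) (by omega) (by omega) (by omega)))
  · exact Submodule.mem_sup_left (Submodule.smul_mem _ _
        (mono_mem_polySpace (by omega) (by omega) (by omega) (by omega)))

variable {ι κ μ : Type*} [Fintype ι] [Fintype κ] [Fintype μ]

section
variable [DecidableEq ι] [DecidableEq κ] [DecidableEq μ]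

theorem IsONB.sup {S₁ S₂ : Submodule ℂ Laurent} {e : ι → Laurent} {a : κ → Laurent}
    {f : μ → Laurent} (h₁ : IsONB L S₁ (Sum.elim e a)) (h₂ : IsONB L S₂ (Sum.elim e f))
    (haf : ∀ i j, sesq L (a i) (f j) = 0) (hfa : ∀ i j, sesq L (f i) (a j) = 0) :
    IsONB L (S₁ ⊔ S₂) (Sum.elim (Sum.elim e a) f) := by
  refine ⟨?_, ?_, ?_⟩
  · rintro (i | i)
    · exact Submodule.mem_sup_left (h₁.mem i)
    · exact Submodule.mem_sup_right (h₂.mem (Sum.inr i))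
  · rintro (i | i) (j | j)
    · simpa using h₁.inner i j
    · rcases i with i | i
      · simpa using h₂.inner (Sum.inl i) (Sum.inr j)
      · simpa using haf i j
    · rcases j with j | j
      · simpa using h₂.inner (Sum.inr i) (Sum.inl j)
      · simpa using hfa i j
    · simpa using h₂.inner (Sum.inr i) (Sum.inr j)
  · intro x hx
    obtain ⟨u, hu, v, hv, rfl⟩ := Submodule.mem_sup.1 hx
    have hef : ∀ i j, sesq L (e i) (f j) = 0 := fun i j => by
      simpa using h₂.inner (Sum.inl i) (Sum.inr j)
    have hea : ∀ i j, sesq L (e i) (a j) = 0 := fun i j => by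
      simpa using h₁.inner (Sum.inl i) (Sum.inr j)
    have hu' := h₁.expand u hu
    have hv' := h₂.expand v hv
    rw [Fintype.sum_sum_type] at hu' hv'
    simp only [Sum.elim_inl, Sum.elim_inr] at hu' hv'
    have huf : ∀ j, sesq L u (f j) = 0 := fun j => by
      rw [hu']; simp [hef, haf]
    have hva : ∀ j, sesq L v (a j) = 0 := fun j => by
      rw [hv']; simp [hea, hfa]
    rw [Fintype.sum_sum_type, Fintype.sum_sum_type]
    simp only [Sum.elim_inl, Sum.elim_inr, map_add, LinearMap.add_apply, huf, hva, add_zero,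
      zero_add, add_smul, Finset.sum_add_distrib]
    conv_lhs => rw [hu', hv']
    abel

/-- Here 𝓕¹ ⊥ 𝓕² enters: it makes e, a, f an orthonormal basis of `𝓟_{n-1,m} + 𝓟_{n,m-1}`. In
`𝓟_{n,m}` only the monomial z^n w^m is then missing, and the reversed p spans the orthogonal
complement. -/
theorem isONB_full (hL : PosOn L n m) (hp : IsExtremal L n m p) {e : ι → Laurent}
    {a : κ → Laurent} {f : μ → Laurent}
    (he : IsONB L (polySpace ((n : ℤ) - 1) ((m : ℤ) - 1)) e)
    (ha : IsONB L (spaceF1 L n m) a) (hf : IsONB L (spaceF2 L n m) f)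
    (hO : ∀ x ∈ spaceF1 L n m, ∀ y ∈ spaceF2 L n m, sesq L x y = 0) :
    IsONB L (polySpace n m)
      (Sum.elim (Sum.elim (Sum.elim e a) f) (fun _ : Unit => rev n m p)) := by
  have hS1 : polySpace ((n : ℤ) - 1) m ≤ polySpace n m := polySpace_mono (by omega) le_rfl
  have hS2 : polySpace n ((m : ℤ) - 1) ≤ polySpace n m := polySpace_mono le_rfl (by omega)
  have h1 := he.sum_elim hL hS1 (polySpace_mono le_rfl (by omega)) ha
  have h2 := he.sum_elim hL hS2 (polySpace_mono (by omega) le_rfl) hf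
  have haf : ∀ i j, sesq L (a i) (f j) = 0 := fun i j => hO _ (ha.mem i) _ (hf.mem j)
  have hfa : ∀ i j, sesq L (f i) (a j) = 0 := fun i j => by
    rw [hL.symm (hS1 (ha.mem j).1) (hS2 (hf.mem i).1), haf, map_zero]
  have h3 := IsONB.sup h1 h2 haf hfa
  have hsup : polySpace ((n : ℤ) - 1) m ⊔ polySpace n ((m : ℤ) - 1) ≤ polySpace n m :=
    sup_le hS1 hS2
  have hr := rev_mem hp.mem
  have hcoef : ∀ x ∈ polySpace ((n : ℤ) - 1) m ⊔ polySpace n ((m : ℤ) - 1),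
      x.coeff (n, m) = 0 := by
    intro x hx
    obtain ⟨u, hu, v, hv, rfl⟩ := Submodule.mem_sup.1 hx
    rw [← coeffLin_apply, map_add, coeffLin_apply, coeffLin_apply]
    have hu0 : u.coeff (n, m) = 0 := by
      by_contra hc; have := mem_polySpace.1 hu _ _ hc; omega
    have hv0 : v.coeff (n, m) = 0 := by
      by_contra hc; have := mem_polySpace.1 hv _ _ hc; omega
    rw [hu0, hv0, add_zero]
  refine h3.sum_elim hL le_rfl hsup ⟨fun _ => ⟨hr, fun y hy =>
    hp.rev_orth hL (hsup hy) (hcoef y hy)⟩, ?_, ?_⟩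
  · intro i j
    simp [sesq_rev, hp.norm]
  · intro x hx
    -- The reversed p has corner coefficient conj p(0,0), so this c removes z^n w^m from x. What
    -- remains is orthogonal to itself.
    set c : ℂ := x.coeff (n, m) / conj (p.coeff (0, 0)) with hc
    have hp0 : conj (p.coeff (0, 0)) ≠ 0 := by simpa using hp.coeff_ne_zero
    have hd : x - c • rev n m p ∈ polySpace n m :=
      Submodule.sub_mem _ hx.1 (Submodule.smul_mem _ _ hr)
    have hd0 : (x - c • rev n m p).coeff (n, m) = 0 := by
      rw [← coeffLin_apply, map_sub, map_smul, coeffLin_apply, coeffLin_apply, coeff_rev, sub_self,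
        sub_self, smul_eq_mul, hc, div_mul_cancel₀ _ hp0, sub_self]
    have hdd : sesq L (x - c • rev n m p) (x - c • rev n m p) = 0 := by
      conv_lhs => enter [1]; rw [map_sub, map_smul]
      rw [LinearMap.sub_apply, LinearMap.smul_apply, hp.rev_orth hL hd hd0,
        hx.2 _ (mem_sup_polySpace hd hd0), smul_zero, sub_zero]
    have hxc : x = c • rev n m p := sub_eq_zero.1 (hL.eq_zero hd hdd)
    have : sesq L x (rev n m p) = c := by
      rw [hxc, map_smul, LinearMap.smul_apply, sesq_rev, hp.norm, smul_eq_mul, mul_one]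
    rw [Fintype.sum_unique, this]
    exact hxc

end

/-- The kernel of an orthonormal family. -/
def ker (e : ι → Laurent) (z w ζ η : ℂ) : ℂ := ∑ i, ev z w (e i) * conj (ev ζ η (e i))

theorem IsONB.ker_rev [DecidableEq ι] {k l : ℤ} (hL : PosOn L k l) {e : ι → Laurent}
    (he : IsONB L (polySpace k l) e) (z w ζ η : ℂ) :
    ker e z w ζ η = ker (fun i => rev k l (e i)) z w ζ η :=
  he.kernel_eq hL le_rfl (he.map_rev hL le_rfl (fun _ hx => rev_mem hx) (fun _ hx => rev_mem hx))
    _ _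

/-- Reversing with respect to a larger bidegree only multiplies by a monomial. -/
theorem ker_rev_mul {k l : ℤ} {e : ι → Laurent} (he : ∀ i, e i ∈ polySpace k l) (a b : ℕ)
    (z w ζ η : ℂ) :
    ker (fun i => rev (k + a) (l + b) (e i)) z w ζ η =
      (z * conj ζ) ^ a * (w * conj η) ^ b * ker (fun i => rev k l (e i)) z w ζ η := by
  rw [ker, ker, Finset.mul_sum]
  refine Finset.sum_congr rfl fun i _ => ?_
  rw [add_comm k, add_comm l, ← mono_mul_rev, ev_mono_mul (rev_mem (he i)),
    ev_mono_mul (rev_mem (he i))]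
  simp only [map_mul, map_pow]
  ring

theorem ker_sum_elim (e : ι → Laurent) (a : κ → Laurent) (z w ζ η : ℂ) :
    ker (Sum.elim e a) z w ζ η = ker e z w ζ η + ker a z w ζ η := by
  simp [ker, Fintype.sum_sum_type]

theorem ker_rev_sum_elim (k l : ℤ) (e : ι → Laurent) (a : κ → Laurent) (z w ζ η : ℂ) :
    ker (fun i => rev k l (Sum.elim e a i)) z w ζ η =
      ker (fun i => rev k l (e i)) z w ζ η + ker (fun i => rev k l (a i)) z w ζ η := by
  simp [ker, Fintype.sum_sum_type]

/-- The kernel of `𝓟_{n,m-1}` in the basis e, f is invariant under reversal; reversed at z-degree n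
instead of n - 1, the e part picks up the factor z ζ̄. -/
theorem ker_F2 [DecidableEq ι] [DecidableEq μ] (hL : PosOn L n m) {e : ι → Laurent} {f : μ → Laurent}
    (he : IsONB L (polySpace ((n : ℤ) - 1) ((m : ℤ) - 1)) e)
    (hf : IsONB L (spaceF2 L n m) f) (z w ζ η : ℂ) :
    ker (fun i => rev n ((m : ℤ) - 1) (f i)) z w ζ η =
      ker f z w ζ η + (1 - z * conj ζ) * ker e z w ζ η := by
  have hL' : PosOn L n ((m : ℤ) - 1) := hL.mono le_rfl (by omega)
  have h1 := (he.sum_elim hL' le_rfl (polySpace_mono (by omega) le_rfl) hf).ker_rev hL' z w ζ η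
  have h2 := ker_rev_mul he.mem 1 0 z w ζ η
  rw [ker_rev_sum_elim, ker_sum_elim] at h1
  rw [← he.ker_rev (hL.mono (by omega) (by omega))] at h2
  simp only [Nat.cast_one, sub_add_cancel, Nat.cast_zero, add_zero, pow_one, pow_zero,
    mul_one] at h2
  rw [h2] at h1
  linear_combination -h1

theorem ker_F1 [DecidableEq ι] [DecidableEq κ] (hL : PosOn L n m) {e : ι → Laurent} {a : κ → Laurent}
    (he : IsONB L (polySpace ((n : ℤ) - 1) ((m : ℤ) - 1)) e)
    (ha : IsONB L (spaceF1 L n m) a) (z w ζ η : ℂ) :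
    ker (fun i => rev ((n : ℤ) - 1) m (a i)) z w ζ η =
      ker a z w ζ η + (1 - w * conj η) * ker e z w ζ η := by
  have hL' : PosOn L ((n : ℤ) - 1) m := hL.mono (by omega) le_rfl
  have h1 := (he.sum_elim hL' le_rfl (polySpace_mono le_rfl (by omega)) ha).ker_rev hL' z w ζ η
  have h2 := ker_rev_mul he.mem 0 1 z w ζ η
  rw [ker_rev_sum_elim, ker_sum_elim] at h1
  rw [← he.ker_rev (hL.mono (by omega) (by omega))] at h2
  simp only [Nat.cast_one, sub_add_cancel, Nat.cast_zero, add_zero, pow_one, pow_zero,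
    one_mul] at h2
  rw [h2] at h1
  linear_combination -h1

/-- The Christoffel–Darboux formula. -/
theorem christoffel_darboux [DecidableEq ι] [DecidableEq κ] [DecidableEq μ] (hL : PosOn L n m) (hp : IsExtremal L n m p) {e : ι → Laurent}
    {a : κ → Laurent} {f : μ → Laurent}
    (he : IsONB L (polySpace ((n : ℤ) - 1) ((m : ℤ) - 1)) e)
    (ha : IsONB L (spaceF1 L n m) a) (hf : IsONB L (spaceF2 L n m) f)
    (hO : ∀ x ∈ spaceF1 L n m, ∀ y ∈ spaceF2 L n m, sesq L x y = 0) (z w ζ η : ℂ) :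
    ev z w p * conj (ev ζ η p) - ev z w (rev n m p) * conj (ev ζ η (rev n m p)) =
      (1 - z * conj ζ) * ker a z w ζ η + (1 - w * conj η) * ker f z w ζ η +
      (1 - z * conj ζ) * (1 - w * conj η) * ker e z w ζ η := by
  -- Two expressions for the kernel of `𝓟_{n,m}`: in the basis and in its reversal. The reversed e,
  -- a, f are brought back by `ker_rev_mul`, `ker_F1`, `ker_F2`, and the reversed p by `rev_rev`.
  have h := (isONB_full hL hp he ha hf hO).ker_rev hL z w ζ η
  rw [ker_rev_sum_elim, ker_rev_sum_elim, ker_rev_sum_elim, ker_sum_elim, ker_sum_elim,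
    ker_sum_elim] at h
  have h1 := ker_rev_mul he.mem 1 1 z w ζ η
  rw [← he.ker_rev (hL.mono (by omega) (by omega))] at h1
  have h2 := ker_rev_mul (fun i => (ha.mem i).1) 1 0 z w ζ η
  rw [ker_F1 hL he ha] at h2
  have h3 := ker_rev_mul (fun i => (hf.mem i).1) 0 1 z w ζ η
  rw [ker_F2 hL he hf] at h3
  simp only [Nat.cast_one, sub_add_cancel, Nat.cast_zero, add_zero, pow_one, pow_zero,
    one_mul, mul_one] at h1 h2 h3
  rw [h1, h2, h3] at h
  simp only [ker, rev_rev, Fintype.sum_unique] at h ⊢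
  linear_combination -h

/-- Reversal at bidegree (n, m - 1) carries `𝓟_{n-1,m-1}` into `z 𝓟_{n-1,m-1}`, so it exchanges 𝓖
and 𝓕². -/
theorem rev_mem_spaceF2 (hL : PosOn L n m) {x : Laurent} (hx : x ∈ spaceG L n m) :
    rev n ((m : ℤ) - 1) x ∈ spaceF2 L n m := by
  refine ⟨rev_mem hx.1, fun y hy => ?_⟩
  have hy' : rev n ((m : ℤ) - 1) y = mono 1 0 * rev ((n : ℤ) - 1) ((m : ℤ) - 1) y := by
    rw [mono_mul_rev]; congr 1 <;> ring
  have hmem : rev n ((m : ℤ) - 1) y ∈ shiftSpace ((n : ℤ) - 1) ((m : ℤ) - 1) :=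
    mem_shiftSpace.2 ⟨_, rev_mem hy, hy'.symm⟩
  rw [← rev_rev n ((m : ℤ) - 1) y, sesq_rev,
    (hL.mono le_rfl (by omega)).symm hx.1 (shiftSpace_le hmem), hx.2 _ hmem, map_zero]

theorem rev_mem_spaceG (hL : PosOn L n m) {x : Laurent} (hx : x ∈ spaceF2 L n m) :
    rev n ((m : ℤ) - 1) x ∈ spaceG L n m := by
  refine ⟨rev_mem hx.1, fun y hy => ?_⟩
  obtain ⟨q, hq, rfl⟩ := mem_shiftSpace.1 hy
  have hq' : mono 1 0 * q = rev n ((m : ℤ) - 1) (rev ((n : ℤ) - 1) ((m : ℤ) - 1) q) := by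
    conv_lhs => rw [← rev_rev ((n : ℤ) - 1) ((m : ℤ) - 1) q, mono_mul_rev]
    congr 1 <;> ring
  rw [hq', sesq_rev, (hL.mono le_rfl (by omega)).symm hx.1
    (polySpace_mono (by omega) le_rfl (rev_mem hq)), hx.2 _ (rev_mem hq), map_zero]

theorem rev_isONB_F2 [DecidableEq ι] (hL : PosOn L n m) {g : ι → Laurent}
    (hg : IsONB L (spaceG L n m) g) :
    IsONB L (spaceF2 L n m) (fun i => rev n ((m : ℤ) - 1) (g i)) :=
  hg.map_rev (hL.mono (le_refl (n : ℤ)) (by omega : (m : ℤ) - 1 ≤ m)) (spaceG_le L n m)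
    (fun _ => rev_mem_spaceF2 hL) (fun _ => rev_mem_spaceG hL)

theorem ev_rev_eq (hp : p ∈ polySpace n m) {z : ℂ} (hz : ‖z‖ = 1) (w : ℂ) :
    ev z w (rev n m p) = z ^ n * qpoly m (revc m fun t => col t z p) w := by
  have h := congrFun (ev_eq_qpoly (rev_mem hp) z) w
  rw [h, qpoly, qpoly, Finset.mul_sum]
  refine Finset.sum_congr rfl fun t ht => ?_
  have ht' : t ≤ m := Nat.lt_succ_iff.1 (Finset.mem_range.1 ht)
  have hz0 : z ≠ 0 := by rintro rfl; simp at hz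
  rw [← mul_assoc]
  congr 1
  rw [revc, col_eq_sum (rev_mem hp), col_eq_sum hp, map_sum, Finset.mul_sum,
    ← Finset.sum_range_reflect]
  refine Finset.sum_congr rfl fun s hs => ?_
  have hs' : s ≤ n := Nat.lt_succ_iff.1 (Finset.mem_range.1 hs)
  have h1 : n + 1 - 1 - s = n - s := by omega
  have h2 : (n : ℤ) - ((n - s : ℕ) : ℤ) = s := by omega
  have h3 : (m : ℤ) - (t : ℤ) = ((m - t : ℕ) : ℤ) := by omega
  rw [h1, coeff_rev, h2, h3, map_mul, map_pow, conj_eq_inv hz, inv_pow]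
  have h4 : z ^ n = z ^ (n - s) * z ^ s := by rw [← pow_add]; congr 1; omega
  rw [h4]
  field_simp

/-- The Christoffel–Darboux formula for `|z| = 1`. -/
theorem christoffel_darboux_circle [DecidableEq ι] (hL : PosOn L n m) (hp : IsExtremal L n m p)
    {g : ι → Laurent} (hg : IsONB L (spaceG L n m) g)
    (hO : ∀ x ∈ spaceF1 L n m, ∀ y ∈ spaceF2 L n m, sesq L x y = 0) {z : ℂ} (hz : ‖z‖ = 1)
    (w η : ℂ) :
    ev z w p * conj (ev z η p) - ev z w (rev n m p) * conj (ev z η (rev n m p)) =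
      (1 - w * conj η) * ker g z w z η := by
  obtain ⟨e, he⟩ := hL.exists_isONB (S := polySpace ((n : ℤ) - 1) ((m : ℤ) - 1))
    (polySpace_mono (by omega) (by omega))
  obtain ⟨a, ha⟩ := hL.exists_isONB (S := spaceF1 L n m)
    (fun x hx => polySpace_mono (by omega) le_rfl hx.1)
  have hf := rev_isONB_F2 hL hg
  have h1 : 1 - z * conj z = 0 := by
    rw [Complex.mul_conj, Complex.normSq_eq_norm_sq, hz]; simp
  have h2 := ker_F2 hL he hf z w z η
  simp only [rev_rev] at h2
  rw [h1, zero_mul, add_zero] at h2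
  rw [christoffel_darboux hL hp he ha hf hO, h1, ← h2]
  simp

/-- For |z| = 1 the Christoffel–Darboux formula is the hypothesis of `toeplitz_inverse` with X read
off from ΓᴴΓ; hence W ΓᴴΓ = 1. -/
theorem matW_eq_weightG_of_orth (hL : PosOn L n m) (hp : IsExtremal L n m p)
    {g : Fin m → Laurent} (hg : IsONB L (spaceG L n m) g) (hs : LStable p)
    (hO : ∀ x ∈ spaceF1 L n m, ∀ y ∈ spaceF2 L n m, sesq L x y = 0) {z : ℂ} (hz : ‖z‖ = 1) :
    matW m p z = weightG g z := by
  have hL' : PosOn L n ((m : ℤ) - 1) := hL.mono le_rfl (by omega)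
  have hX := toeplitz_inverse (X := fun l l' => ∑ i, matG g z i l * conj (matG g z i l'))
    (fun w hw => hs.qpoly_ne_zero hp.mem hz.le w hw) (fun w η => by
      have h1 := christoffel_darboux_circle hL hp hg hO hz w η
      have hzn : z ^ n * conj (z ^ n) = 1 := by
        rw [Complex.mul_conj, Complex.normSq_eq_norm_sq, norm_pow, hz]; simp
      have h2 := fun w => congrFun (ev_eq_qpoly hp.mem z) w
      rw [ev_rev_eq hp.mem hz, ev_rev_eq hp.mem hz, h2, h2, map_mul] at h1
      have h3 : ker g z w z η = ∑ l : Fin m, ∑ l' : Fin m,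
          (∑ i, matG g z i l * conj (matG g z i l')) * w ^ (l : ℕ) * conj (η ^ (l' : ℕ)) := by
        have h4 : ∀ i w, ev z w (g i) = ∑ l : Fin m, matG g z i l * w ^ (l : ℕ) := fun i w => by
          rw [ev_eq_sum (hg.mem i).1, ← Fin.sum_univ_eq_sum_range
            (fun t => col t z (g i) * w ^ t) m]
          rfl
        simp only [ker, h4, map_sum, Finset.sum_mul_sum]
        simp only [Finset.sum_mul]
        rw [Finset.sum_comm]
        refine Finset.sum_congr rfl fun l _ => ?_
        rw [Finset.sum_comm]
        refine Finset.sum_congr rfl fun l' _ => Finset.sum_congr rfl fun i _ => ?_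
        rw [map_mul]
        ring
      rw [← h3, ← h1]
      linear_combination (-(qpoly m (revc m fun t => col t z p) w *
        conj (qpoly m (revc m fun t => col t z p) η))) * hzn)
  have hWQ : matW m p z * ((matG g z).conjTranspose * matG g z) = 1 := by
    ext k l'
    rw [Matrix.mul_apply, Matrix.one_apply, ← hX k l']
    refine Finset.sum_congr rfl fun l _ => ?_
    rw [matW_apply, wz_eq hp.mem, Matrix.mul_apply, map_sum]
    congr 1
    refine Finset.sum_congr rfl fun i _ => ?_
    rw [map_mul, Complex.conj_conj, Matrix.conjTranspose_apply]
    rfl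
  have h5 : (matG g z).conjTranspose * matG g z * weightG g z = 1 := by
    rw [weightG, mul_assoc, ← mul_assoc (matG g z), matG_mul_matB hL' hg hz.le, one_mul,
      ← Matrix.conjTranspose_mul, matB_mul_matG hL' hg hz.le, Matrix.conjTranspose_one]
  calc matW m p z = matW m p z * ((matG g z).conjTranspose * matG g z * weightG g z) := by
        rw [h5, mul_one]
    _ = weightG g z := by rw [← mul_assoc, hWQ, one_mul]

end

/-! ### Exchange of variables and stability of the extremal polynomial -/

section

/-- The exchange of the variables `z` and `w`. -/
def swap : Laurent →ₐ[ℂ] Laurent :=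
  AddMonoidAlgebra.mapDomainAlgHom ℂ ℂ (AddEquiv.prodComm : ℤ × ℤ ≃+ ℤ × ℤ).toAddMonoidHom

theorem swap_mono (s t : ℤ) : swap (mono s t) = mono t s := by
  simp [swap, mono]

theorem swap_swap (f : Laurent) : swap (swap f) = f := by
  induction f using AddMonoidAlgebra.induction_linear with
  | zero => simp
  | add x y hx hy => simp [hx, hy]
  | single x c => simp [swap]

theorem coeff_swap (f : Laurent) (s t : ℤ) : (swap f).coeff (s, t) = f.coeff (t, s) := by
  induction f using AddMonoidAlgebra.induction_linear with
  | zero => simp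
  | add x y hx hy => simp [hx, hy]
  | single x c =>
    obtain ⟨a, b⟩ := x
    simp [swap, Finsupp.single_apply, and_comm]

theorem conjInv_swap (f : Laurent) : conjInv (swap f) = swap (conjInv f) := by
  ext x
  obtain ⟨a, b⟩ := x
  rw [coeff_conjInv, coeff_swap, coeff_swap, coeff_conjInv]

theorem swap_mem {k l : ℤ} {f : Laurent} (hf : f ∈ polySpace k l) : swap f ∈ polySpace l k := by
  rw [mem_polySpace] at *
  intro s t h
  rw [coeff_swap] at h
  exact (hf t s h).symm

theorem swap_mem_laurentSpace {k l : ℤ} {f : Laurent} (hf : f ∈ laurentSpace k l) :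
    swap f ∈ laurentSpace l k := by
  have : laurentSpace k l ≤ (laurentSpace l k).comap swap.toLinearMap := by
    refine Submodule.span_le.2 ?_
    rintro _ ⟨s, t, hs, ht, rfl⟩
    simp only [Submodule.comap_coe, Set.mem_preimage, AlgHom.toLinearMap_apply, SetLike.mem_coe,
      swap_mono]
    exact mono_mem_laurentSpace ht hs
  exact this hf

theorem ev_swap (z w : ℂ) (f : Laurent) : ev z w (swap f) = ev w z f := by
  induction f using AddMonoidAlgebra.induction_linear with
  | zero => simp
  | add x y hx hy => simp [hx, hy]
  | single x c => simp [swap, ev, mul_comm]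

/-- The functional with exchanged variables. -/
def swapLin (L : Laurent →ₗ[ℂ] ℂ) : Laurent →ₗ[ℂ] ℂ := L ∘ₗ swap.toLinearMap

variable {L : Laurent →ₗ[ℂ] ℂ} {n m : ℕ} {p : Laurent}

theorem swapLin_apply (f : Laurent) : swapLin L f = L (swap f) := rfl

theorem sesq_swapLin (f g : Laurent) : sesq (swapLin L) f g = sesq L (swap f) (swap g) := by
  rw [sesq_apply, sesq_apply, swapLin_apply, map_mul, conjInv_swap]

theorem PosOn.swapLin {k l : ℤ} (hL : PosOn L k l) : PosOn (swapLin L) l k := by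
  refine ⟨fun f hf => ?_, fun f hf hf0 => ?_⟩
  · rw [swapLin_apply, swapLin_apply, ← conjInv_swap, hL.herm _ (swap_mem_laurentSpace hf)]
  · rw [sesq_swapLin]
    refine hL.pos _ (swap_mem hf) fun h => hf0 ?_
    rw [← swap_swap f, h, map_zero]

theorem swap_mem_spaceF1 {f : Laurent} (hf : f ∈ spaceF1 (swapLin L) m n) :
    swap f ∈ spaceF2 L n m :=
  ⟨swap_mem hf.1, fun y hy => by
    have := hf.2 _ (swap_mem hy)
    rwa [sesq_swapLin, swap_swap] at this⟩

theorem swap_mem_spaceF2 {f : Laurent} (hf : f ∈ spaceF2 (swapLin L) m n) :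
    swap f ∈ spaceF1 L n m :=
  ⟨swap_mem hf.1, fun y hy => by
    have := hf.2 _ (swap_mem hy)
    rwa [sesq_swapLin, swap_swap] at this⟩

theorem spaceF1_le (L : Laurent →ₗ[ℂ] ℂ) (n m : ℕ) : spaceF1 L n m ≤ polySpace n m :=
  fun _ h => polySpace_mono (by omega) le_rfl h.1

theorem spaceF2_le (L : Laurent →ₗ[ℂ] ℂ) (n m : ℕ) : spaceF2 L n m ≤ polySpace n m :=
  fun _ h => polySpace_mono le_rfl (by omega) h.1

theorem orth_swap (hL : PosOn L n m)
    (hO : ∀ x ∈ spaceF1 L n m, ∀ y ∈ spaceF2 L n m, sesq L x y = 0) :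
    ∀ x ∈ spaceF1 (swapLin L) m n, ∀ y ∈ spaceF2 (swapLin L) m n, sesq (swapLin L) x y = 0 := by
  intro x hx y hy
  have hx' := swap_mem_spaceF1 hx
  have hy' := swap_mem_spaceF2 hy
  rw [sesq_swapLin, hL.symm (spaceF1_le L n m hy') (spaceF2_le L n m hx'), hO _ hy' _ hx',
    map_zero]

theorem IsExtremal.swap (hp : IsExtremal L n m p) : IsExtremal (swapLin L) m n (swap p) := by
  refine ⟨swap_mem hp.mem, fun x hx hx0 => ?_, ?_⟩
  · rw [sesq_swapLin, swap_swap, hp.orth _ (swap_mem hx) (by rwa [coeff_swap])]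
  · rw [sesq_swapLin, swap_swap, hp.norm]

theorem LStable.swap (hs : LStable p) : LStable (swap p) := fun z w hz hw => by
  rw [ev_swap]; exact hs w z hw hz

theorem continuousOn_weight (hp : p ∈ polySpace n m) (hs : LStable p) (j k : ℤ) :
    ContinuousOn (Function.uncurry fun z w => z ^ j * (w ^ k / (‖ev z w p‖ : ℂ) ^ 2))
      (Metric.sphere 0 1 ×ˢ Metric.sphere 0 1) := by
  refine ContinuousOn.mul ?_ (ContinuousOn.div ?_ ?_ ?_)
  · exact (circleCont_zpow j).comp continuousOn_fst (fun x hx => hx.1)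
  · exact (circleCont_zpow k).comp continuousOn_snd (fun x hx => hx.2)
  · exact ((Complex.continuous_ofReal.comp (continuous_norm.comp (continuous_ev hp))).pow
      2).continuousOn
  · rintro ⟨z, w⟩ ⟨hz, hw⟩
    simp only [mem_sphere_iff_norm, sub_zero] at hz hw
    simpa using hs z w hz.le hw.le

theorem continuous_circle_weight (hp : p ∈ polySpace n m) (hs : LStable p) (j k : ℤ) :
    Continuous (Function.uncurry fun θ φ : ℝ => circleMap 0 1 θ ^ j *
      (circleMap 0 1 φ ^ k / (‖ev (circleMap 0 1 θ) (circleMap 0 1 φ) p‖ : ℂ) ^ 2)) := by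
  have h : ∀ θ : ℝ, circleMap 0 1 θ ∈ Metric.sphere (0 : ℂ) 1 := fun θ =>
    circleMap_mem_sphere 0 zero_le_one θ
  rw [← continuousOn_univ]
  refine (continuousOn_weight hp hs j k).comp (f := fun x : ℝ × ℝ =>
    (circleMap 0 1 x.1, circleMap 0 1 x.2)) ?_ fun x _ => ⟨h _, h _⟩
  fun_prop

theorem bsm_eq_integral (p : Laurent) (j k : ℤ) :
    bsm p j k = ((2 * Real.pi) ^ 2 : ℂ)⁻¹ * ∫ θ in (0 : ℝ)..(2 * Real.pi),
      ∫ φ in (0 : ℝ)..(2 * Real.pi), circleMap 0 1 θ ^ j *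
        (circleMap 0 1 φ ^ k / (‖ev (circleMap 0 1 θ) (circleMap 0 1 φ) p‖ : ℂ) ^ 2) := by
  simp only [bsm, wz, wm, cavg, Real.circleAverage_def, Complex.real_smul,
    intervalIntegral.integral_const_mul]
  rw [← intervalIntegral.integral_const_mul, ← intervalIntegral.integral_const_mul]
  congr 1
  ext θ
  push_cast
  ring

/-- Fubini on the torus; stability makes the integrand continuous there. -/
theorem bsm_swap (hp : p ∈ polySpace n m) (hs : LStable p) (j k : ℤ) :
    bsm (swap p) k j = bsm p j k := by
  rw [bsm_eq_integral, bsm_eq_integral]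
  congr 1
  simp only [intervalIntegral.integral_of_le Real.two_pi_pos.le]
  rw [MeasureTheory.integral_integral_swap]
  · refine MeasureTheory.integral_congr_ae (Filter.Eventually.of_forall fun θ =>
      MeasureTheory.integral_congr_ae (Filter.Eventually.of_forall fun φ => ?_))
    simp only [ev_swap]
    ring
  · rw [MeasureTheory.Measure.prod_restrict]
    exact ((continuous_circle_weight (swap_mem hp) hs.swap k j).continuousOn.integrableOn_compact
      (isCompact_Icc.prod isCompact_Icc)).mono_set
      (Set.prod_mono Set.Ioc_subset_Icc_self Set.Ioc_subset_Icc_self)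

theorem ker_self (e : Fin m → Laurent) (z w : ℂ) :
    ker e z w z w = ((∑ i, ‖ev z w (e i)‖ ^ 2 : ℝ) : ℂ) := by
  simp [ker, Complex.mul_conj, Complex.normSq_eq_norm_sq]

theorem ev_one (z w : ℂ) : ev z w 1 = 1 := by
  rw [← mono_zero, ev_mono]; simp

/-- At a zero inside the bidisk the diagonal Christoffel–Darboux formula equates -|p̃|² with a sum
of nonnegative terms, so every e and a vanishes there. They span `𝓟_{n-1,m}`, which contains 1 since
n ≥ 1. -/
theorem IsExtremal.ev_ne_zero_of_lt (hL : PosOn L n m) (hp : IsExtremal L n m p)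
    (hO : ∀ x ∈ spaceF1 L n m, ∀ y ∈ spaceF2 L n m, sesq L x y = 0) (hn : n ≠ 0) {z w : ℂ}
    (hz : ‖z‖ < 1) (hw : ‖w‖ < 1) : ev z w p ≠ 0 := by
  intro h0
  have hS : polySpace ((n : ℤ) - 1) m ≤ polySpace n m := polySpace_mono (by omega) le_rfl
  have hS' : polySpace ((n : ℤ) - 1) ((m : ℤ) - 1) ≤ polySpace ((n : ℤ) - 1) m :=
    polySpace_mono le_rfl (by omega)
  obtain ⟨e, he⟩ := hL.exists_isONB (hS'.trans hS)
  obtain ⟨a, ha⟩ := hL.exists_isONB (spaceF1_le L n m)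
  obtain ⟨f, hf⟩ := hL.exists_isONB (spaceF2_le L n m)
  have h := christoffel_darboux hL hp he ha hf hO z w z w
  rw [h0, zero_mul, ker_self, ker_self, ker_self, Complex.mul_conj, Complex.mul_conj,
    Complex.mul_conj, Complex.normSq_eq_norm_sq, Complex.normSq_eq_norm_sq,
    Complex.normSq_eq_norm_sq] at h
  norm_cast at h
  have hz' : 0 < 1 - ‖z‖ ^ 2 := by nlinarith [norm_nonneg z]
  have hw' : 0 < 1 - ‖w‖ ^ 2 := by nlinarith [norm_nonneg w]
  have hA : 0 ≤ ∑ i, ‖ev z w (a i)‖ ^ 2 := Finset.sum_nonneg fun i _ => sq_nonneg _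
  have hE : 0 ≤ ∑ i, ‖ev z w (e i)‖ ^ 2 := Finset.sum_nonneg fun i _ => sq_nonneg _
  have hF : 0 ≤ ∑ i, ‖ev z w (f i)‖ ^ 2 := Finset.sum_nonneg fun i _ => sq_nonneg _
  have hP := sq_nonneg ‖ev z w (rev n m p)‖
  have h1 := mul_nonneg hz'.le hA
  have h2 := mul_nonneg hw'.le hF
  have h3 := mul_nonneg (mul_pos hz' hw').le hE
  have hA0 : ∑ i, ‖ev z w (a i)‖ ^ 2 = 0 :=
    (mul_eq_zero.1 (by linarith : (1 - ‖z‖ ^ 2) * ∑ i, ‖ev z w (a i)‖ ^ 2 = 0)).resolve_left hz'.ne'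
  have hE0 : ∑ i, ‖ev z w (e i)‖ ^ 2 = 0 :=
    (mul_eq_zero.1 (by linarith : (1 - ‖z‖ ^ 2) * (1 - ‖w‖ ^ 2) *
      ∑ i, ‖ev z w (e i)‖ ^ 2 = 0)).resolve_left (mul_pos hz' hw').ne'
  have hA1 : ∀ i, ev z w (a i) = 0 := fun i => by
    simpa using (Finset.sum_eq_zero_iff_of_nonneg fun i _ => sq_nonneg _).1 hA0 i
      (Finset.mem_univ i)
  have hE1 : ∀ i, ev z w (e i) = 0 := fun i => by
    simpa using (Finset.sum_eq_zero_iff_of_nonneg fun i _ => sq_nonneg _).1 hE0 i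
      (Finset.mem_univ i)
  have hone := (he.sum_elim hL hS hS' ha).expand 1
    (mono_mem_polySpace le_rfl (by omega) le_rfl (by omega))
  have := congrArg (ev z w) hone
  rw [ev_one, map_sum, Fintype.sum_sum_type] at this
  simp [hA1, hE1] at this

theorem continuous_ker {k : ℕ} {e : Fin k → Laurent} (he : ∀ i, e i ∈ polySpace n m) (z w ζ : ℂ) :
    Continuous fun η => ker e z w ζ η := by
  unfold ker
  have h : ∀ i, Continuous fun η => ev ζ η (e i) := fun i =>
    (continuous_ev (he i)).comp (f := fun η : ℂ => (ζ, η)) (by fun_prop)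
  exact continuous_finsetSum _ fun i _ =>
    continuous_const.mul (Complex.continuous_conj.comp (h i))

/-- At a zero with |z| = 1 all the gᵢ vanish, so Γ(z) annihilates the vector (wᵏ), whose entry at k
= 0 is 1; this contradicts its invertibility. -/
theorem IsExtremal.ev_ne_zero_of_norm_eq_one (hL : PosOn L n m) (hp : IsExtremal L n m p)
    (hO : ∀ x ∈ spaceF1 L n m, ∀ y ∈ spaceF2 L n m, sesq L x y = 0) (hm : m ≠ 0) {z w : ℂ}
    (hz : ‖z‖ = 1) (hw : ‖w‖ ≤ 1) : ev z w p ≠ 0 := by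
  intro h0
  have hL' : PosOn L n ((m : ℤ) - 1) := hL.mono le_rfl (by omega)
  obtain ⟨g, hg⟩ := exists_isONB_spaceG hL'
  have hcd := christoffel_darboux_circle hL hp hg hO hz w
  have h := hcd w
  rw [h0, zero_mul, ker_self, Complex.mul_conj, Complex.mul_conj, Complex.normSq_eq_norm_sq,
    Complex.normSq_eq_norm_sq] at h
  norm_cast at h
  have hG : 0 ≤ ∑ i, ‖ev z w (g i)‖ ^ 2 := Finset.sum_nonneg fun i _ => sq_nonneg _
  have hP := sq_nonneg ‖ev z w (rev n m p)‖
  have hG0 : ∑ i, ‖ev z w (g i)‖ ^ 2 = 0 := by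
    rcases hw.lt_or_eq with hw | hw
    · have hw' : 0 < 1 - ‖w‖ ^ 2 := by nlinarith [norm_nonneg w]
      have h2 := mul_nonneg hw'.le hG
      exact (mul_eq_zero.1 (by linarith : (1 - ‖w‖ ^ 2) * ∑ i, ‖ev z w (g i)‖ ^ 2 = 0)).resolve_left
        hw'.ne'
    · have hr : ev z w (rev n m p) = 0 := by
        rw [hw] at h
        simpa using h
      -- For |w| = 1 the factor 1 - |w|² is zero and the diagonal says nothing about the gᵢ. Both p
      -- and its reversal vanish at (z, w), so the kernel vanishes for η ≠ w, and at η = w by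
      -- continuity.
      have hk : ∀ η ∈ ({w}ᶜ : Set ℂ), ker g z w z η = 0 := by
        intro η hη
        have h1 := hcd η
        rw [h0, hr, zero_mul, zero_mul, sub_zero] at h1
        refine (mul_eq_zero.1 h1.symm).resolve_left fun h2 => hη ?_
        have hw0 : w ≠ 0 := by rintro rfl; simp at hw
        have h3 : conj η = w⁻¹ := by
          rw [eq_comm, inv_eq_of_mul_eq_one_right (sub_eq_zero.1 h2).symm]
        rw [← conj_eq_inv hw] at h3
        exact (starRingEnd ℂ).injective h3
      have hker : (fun η => ker g z w z η) = fun _ => 0 :=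
        (continuous_ker (n := n) (m := m) (fun i => polySpace_mono le_rfl (by omega) (hg.mem i).1) z w z).ext_on
          (dense_compl_singleton w) continuous_const hk
      have := congrFun hker w
      rw [ker_self] at this
      exact_mod_cast this
  have hG1 : ∀ i, ev z w (g i) = 0 := fun i => by
    simpa using (Finset.sum_eq_zero_iff_of_nonneg fun i _ => sq_nonneg _).1 hG0 i
      (Finset.mem_univ i)
  refine det_matG_ne_zero hL' hg hz.le (Matrix.exists_mulVec_eq_zero_iff.1
    ⟨fun k => w ^ (k : ℕ), fun hv => ?_, ?_⟩)
  · simpa using congrFun hv ⟨0, Nat.pos_of_ne_zero hm⟩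
  · ext i
    have := hG1 i
    rw [ev_eq_sum (hg.mem i).1, ← Fin.sum_univ_eq_sum_range
      (fun t => col t z (g i) * w ^ t) m] at this
    exact this

theorem ev_eq_of_mem_zero {k : ℤ} (hp : p ∈ polySpace 0 k) (z z' w : ℂ) :
    ev z w p = ev z' w p :=
  polySpace_induction _ _ (fun s t hs _ => by
    have : s = 0 := by omega
    rw [ev_mono, ev_mono, this]; simp) hp

theorem IsExtremal.lStable (hL : PosOn L n m) (hp : IsExtremal L n m p)
    (hO : ∀ x ∈ spaceF1 L n m, ∀ y ∈ spaceF2 L n m, sesq L x y = 0) : LStable p := by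
  intro z w hz hw
  have h1 : ∀ {z w : ℂ}, n ≠ 0 → ‖z‖ ≤ 1 → ‖w‖ = 1 → ev z w p ≠ 0 := fun hn hz hw => by
    rw [← ev_swap]
    exact hp.swap.ev_ne_zero_of_norm_eq_one hL.swapLin (orth_swap hL hO) hn hw hz
  rcases Nat.eq_zero_or_pos n with rfl | hn
  -- For n = 0 the value does not depend on z, which may be moved to the circle; the case m = 0
  -- below is the mirror image.
  · rw [ev_eq_of_mem_zero hp.mem z 1 w]
    rcases Nat.eq_zero_or_pos m with rfl | hm
    · have : p = p.coeff (0, 0) • mono 0 0 := by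
        simpa using polySpace_expand (n := 0) (m := 1) (by simpa using hp.mem)
      rw [this, map_smul, ev_mono]
      simpa using hp.coeff_ne_zero
    · exact hp.ev_ne_zero_of_norm_eq_one hL hO hm.ne' (by simp) hw
  · rcases Nat.eq_zero_or_pos m with rfl | hm
    · rw [← ev_swap, ev_eq_of_mem_zero (swap_mem hp.mem) w 1 z, ev_swap]
      exact h1 hn.ne' hz (by simp)
    · rcases hz.lt_or_eq with hz' | hz'
      · rcases hw.lt_or_eq with hw' | hw'
        · exact hp.ev_ne_zero_of_lt hL hO hn.ne' hz' hw'
        · exact h1 hn.ne' hz hw'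
      · exact hp.ev_ne_zero_of_norm_eq_one hL hO hm.ne' hz' hw

end

/-! ### Moments versus orthogonality -/

section

variable {L L' : Laurent →ₗ[ℂ] ℂ} {n m : ℕ} {p : Laurent}

/-- Splitting exponents into positive and negative parts writes each monomial of `𝓛_{k,l}` as x ·
`conjInv` y with x, y in `𝓟_{k,l}`. -/
theorem eq_mono_of_sesq_eq {k l : ℤ}
    (h : ∀ f ∈ polySpace k l, ∀ g ∈ polySpace k l, sesq L f g = sesq L' f g) {s t : ℤ}
    (hs : |s| ≤ k) (ht : |t| ≤ l) : L (mono s t) = L' (mono s t) := by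
  rw [abs_le] at hs ht
  have := h (mono (max s 0) (max t 0))
    (mono_mem_polySpace (by omega) (by omega) (by omega) (by omega))
    (mono (max (-s) 0) (max (-t) 0))
    (mono_mem_polySpace (by omega) (by omega) (by omega) (by omega))
  have h1 : max s 0 - max (-s) 0 = s := by omega
  have h2 : max t 0 - max (-t) 0 = t := by omega
  rwa [sesq_mono, sesq_mono, h1, h2] at this

theorem IsExtremal.apply_mono_of_abs_lt (hL : PosOn L n m) (hp : IsExtremal L n m p)
    (hO : ∀ x ∈ spaceF1 L n m, ∀ y ∈ spaceF2 L n m, sesq L x y = 0) {s t : ℤ}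
    (hs : |s| ≤ n) (ht : |t| ≤ (m : ℤ) - 1) : L (mono s t) = bsm p s t := by
  have hL' : PosOn L n ((m : ℤ) - 1) := hL.mono le_rfl (by omega)
  have hst := hp.lStable hL hO
  obtain ⟨g, hg⟩ := exists_isONB_spaceG hL'
  rw [← bsLin_mono]
  refine eq_mono_of_sesq_eq (fun f hf h hh => ?_) hs ht
  rw [sesq_eq_gform hL' hg hf hh, sesq_bsLin hp.mem hst hf hh, gform]
  refine cavg_congr fun z hz => ?_
  rw [matW_eq_weightG_of_orth hL hp hg hst hO hz]

theorem IsExtremal.apply_mono_of_abs_lt' (hL : PosOn L n m) (hp : IsExtremal L n m p)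
    (hO : ∀ x ∈ spaceF1 L n m, ∀ y ∈ spaceF2 L n m, sesq L x y = 0) {s t : ℤ}
    (hs : |s| ≤ (n : ℤ) - 1) (ht : |t| ≤ m) : L (mono s t) = bsm p s t := by
  rw [← bsm_swap hp.mem (hp.lStable hL hO),
    ← hp.swap.apply_mono_of_abs_lt hL.swapLin (orth_swap hL hO) ht hs, swapLin_apply, swap_mono]

/-- `𝓟_{n-1,m}` is the sum of `𝓟_{n-1,m-1}`, orthogonal to 𝓕² by definition, and 𝓕¹. -/
theorem sesq_F2_eq_zero (hL : PosOn L n m)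
    (hO : ∀ x ∈ spaceF1 L n m, ∀ y ∈ spaceF2 L n m, sesq L x y = 0) {f u : Laurent}
    (hf : f ∈ spaceF2 L n m) (hu : u ∈ polySpace ((n : ℤ) - 1) m) : sesq L f u = 0 := by
  have hS : polySpace ((n : ℤ) - 1) m ≤ polySpace n m := polySpace_mono (by omega) le_rfl
  have hS' : polySpace ((n : ℤ) - 1) ((m : ℤ) - 1) ≤ polySpace ((n : ℤ) - 1) m :=
    polySpace_mono le_rfl (by omega)
  obtain ⟨e, he⟩ := hL.exists_isONB (hS'.trans hS)
  obtain ⟨a, ha⟩ := hL.exists_isONB (spaceF1_le L n m)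
  have h1 : ∀ i, sesq L f (e i) = 0 := fun i => hf.2 _ (he.mem i)
  have h2 : ∀ i, sesq L f (a i) = 0 := fun i => by
    rw [hL.symm (spaceF1_le L n m (ha.mem i)) (spaceF2_le L n m hf), hO _ (ha.mem i) _ hf,
      map_zero]
  rw [(he.sum_elim hL hS hS' ha).expand u hu, map_sum, Fintype.sum_sum_type]
  simp [h1, h2]

theorem rev_mono (a b s t : ℤ) : rev a b (mono s t) = mono (a - s) (b - t) := by
  rw [rev, conjInv_mono, mono_mul_mono]; rfl

theorem sesq_neg_one_of_orth (hL : PosOn L n m)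
    (hO : ∀ x ∈ spaceF1 L n m, ∀ y ∈ spaceF2 L n m, sesq L x y = 0) {g : Laurent}
    (hg : g ∈ spaceG L n m) {j : ℕ} (hj : j ≠ 0) (hjn : j ≤ n) :
    sesq L (mono j (-1)) g = 0 := by
  have h1 : mono j (-1) = rev n ((m : ℤ) - 1) (mono ((n : ℤ) - j) m) := by
    rw [rev_mono]; congr 1 <;> ring
  rw [h1, ← rev_rev n ((m : ℤ) - 1) g, sesq_rev]
  exact sesq_F2_eq_zero hL hO (rev_mem_spaceF2 hL hg)
    (mono_mem_polySpace (by omega) (by omega) (by omega) (by omega))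

/-- Reversal at bidegree (n, m - 1) turns z^s w^t with s < n into z^(n-s) w^(m-1-t). For t < m this
lies in `z 𝓟_{n-1,m-1}`, to which 𝓖 is orthogonal anyway; for t = m it is z^(n-s) w⁻¹. -/
theorem orth_of_sesq_neg_one (hL : PosOn L n m)
    (hC : ∀ g ∈ spaceG L n m, ∀ j : ℕ, j ≠ 0 → j ≤ n → sesq L (mono j (-1)) g = 0) :
    ∀ x ∈ spaceF1 L n m, ∀ y ∈ spaceF2 L n m, sesq L x y = 0 := by
  intro x hx y hy
  have hg := rev_mem_spaceG hL hy
  rw [hL.symm (spaceF2_le L n m hy) (spaceF1_le L n m hx)]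
  suffices h : polySpace ((n : ℤ) - 1) m ≤ LinearMap.ker (sesq L y) by
    rw [LinearMap.mem_ker.1 (h hx.1), map_zero]
  refine Submodule.span_le.2 ?_
  rintro _ ⟨s, t, hs, ht, rfl⟩
  obtain ⟨j, hj⟩ : ∃ j : ℕ, (j : ℤ) = n - s := ⟨(n - s).toNat, by omega⟩
  rw [SetLike.mem_coe, LinearMap.mem_ker, ← sesq_rev L n ((m : ℤ) - 1), rev_mono, ← hj]
  rcases ht.2.lt_or_eq with ht' | ht'
  · have h1 : mono j ((m : ℤ) - 1 - t) ∈ shiftSpace ((n : ℤ) - 1) ((m : ℤ) - 1) :=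
      mem_shiftSpace.2 ⟨mono ((j : ℤ) - 1) ((m : ℤ) - 1 - t),
        mono_mem_polySpace (by omega) (by omega) (by omega) (by omega), by
          rw [mono_mul_mono]; congr 1 <;> ring⟩
    rw [(hL.mono le_rfl (by omega)).symm hg.1 (shiftSpace_le h1), hg.2 _ h1, map_zero]
  · have h2 : (m : ℤ) - 1 - t = -1 := by omega
    rw [h2]
    exact hC _ hg j (by omega) (by omega)

/-- Isolates one unknown moment: applied to the difference of two functionals, it leaves only the
corner moment. -/
theorem sesq_mono_eq_single {g : Laurent} (hg : g ∈ polySpace n ((m : ℤ) - 1)) {a b : ℤ} {k : ℕ}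
    (hk : k < m) (h : ∀ s t : ℕ, s ≤ n → t < m → (s ≠ 0 ∨ t ≠ k) →
      conj (g.coeff (s, t)) * L (mono (a - s) (b - t)) = 0) :
    sesq L (mono a b) g = conj (g.coeff (0, (k : ℤ))) * L (mono a (b - k)) := by
  conv_lhs => rw [polySpace_expand hg]
  simp only [map_sum, map_smulₛₗ, sesq_mono, smul_eq_mul]
  rw [Finset.sum_eq_single 0, Finset.sum_eq_single k]
  · simp
  · intro t ht htk
    exact h 0 t (by omega) (Finset.mem_range.1 ht) (Or.inr htk)
  · intro h; exact absurd (Finset.mem_range.2 hk) h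
  · intro s hs hs0
    exact Finset.sum_eq_zero fun t ht =>
      h s t (Nat.lt_succ_iff.1 (Finset.mem_range.1 hs)) (Finset.mem_range.1 ht) (Or.inl hs0)
  · simp

/-- By `sum_coeff_wm` the average in w is 0^m / p(z, 0), analytic in z, and the average in z is its
product with z^n at 0. The convention 0⁰ = 1 covers vanishing n or m. -/
theorem sesq_bsLin_corner (hp : p ∈ polySpace n m) (hs : LStable p) :
    sesq (bsLin p) (mono n m) p = 0 ^ n * (0 ^ m / p.coeff (0, 0)) := by
  have hp' : p ∈ polySpace n (((m + 1 : ℕ) : ℤ) - 1) := by simpa using hp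
  have h0 : ∀ z : ℂ, ‖z‖ ≤ 1 → col 0 z p ≠ 0 := by
    intro z hz
    have := hs.qpoly_ne_zero hp hz 0 (by simp)
    rwa [qpoly, Finset.sum_range_succ', Finset.sum_eq_zero (fun t _ => by simp), zero_add,
      pow_zero, mul_one] at this
  rw [sesq_bsLin_mono (polySpace_mono le_rfl (by omega) hp) hs _ _ hp']
  have key : (cavg fun z => z ^ (n : ℤ) *
      ∑ l : Fin (m + 1), wz p z ((m : ℤ) - (l : ℕ)) * conj (col (l : ℕ) z p)) =
      cavg fun z => z ^ n * (0 ^ m / col 0 z p) := by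
    refine cavg_congr fun z hz => ?_
    rw [zpow_natCast]
    congr 1
    have h1 := congrArg conj
      (sum_coeff_wm (fun w hw => hs.qpoly_ne_zero hp hz.le w hw) m)
    rw [Complex.conj_conj, map_sum, ← Fin.sum_univ_eq_sum_range
      (fun t => conj (col t z p * wm (qpoly m fun t => col t z p) ((t : ℤ) - m))) (m + 1)] at h1
    have h2 : qpoly m (fun t => col t z p) 0 = col 0 z p := by
      rw [qpoly, Finset.sum_range_succ', Finset.sum_eq_zero (fun t _ => by simp), zero_add,
        pow_zero, mul_one]
      rfl
    rw [← h2, ← h1]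
    refine Finset.sum_congr rfl fun l _ => ?_
    rw [map_mul, ← wz_eq hp, wz, wz, ← wm_neg, neg_sub, mul_comm]
  rw [key, cavg_eq_apply_zero]
  · rw [col_eq_sum hp, Finset.sum_range_succ', Finset.sum_eq_zero (fun t _ => by simp)]
    simp
  · intro z hz
    exact (by fun_prop : DifferentiableAt ℂ (fun z : ℂ => z ^ n) z).mul
      ((differentiableAt_const _).div (differentiable_col hp _ z) (h0 z hz))

/-- Pairing with p only sees the constant coefficient, and ⟨p, p⟩ = 1 gives ⟨1, p⟩ = 1/p(0,0). The
form of the result matches `sesq_bsLin_corner`. -/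
theorem IsExtremal.sesq_corner (hL : PosOn L n m) (hp : IsExtremal L n m p) :
    sesq L (mono n m) p = 0 ^ n * (0 ^ m / p.coeff (0, 0)) := by
  have h1 : mono n m ∈ polySpace n m :=
    mono_mem_polySpace (by omega) le_rfl (by omega) le_rfl
  have h2 := hp.norm
  rw [hp.sesq_eq hp.mem] at h2
  have h3 : p.coeff (0, 0) * conj (sesq L p 1) = 1 := by
    simpa only [RingHom.map_mul, Complex.conj_conj, RingHom.map_one] using congrArg conj h2
  have h4 := eq_inv_of_mul_eq_one_right h3
  rw [hL.symm hp.mem h1, hp.sesq_eq h1, map_mul, Complex.conj_conj, h4, coeff_mono, zero_pow_eq,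
    zero_pow_eq]
  by_cases hn : n = 0 <;> by_cases hm : m = 0 <;> simp [hn, hm]

/-- The moments of a functional with orthogonal `𝓕¹` and `𝓕²` are Bernstein–Szegő moments. -/
theorem IsExtremal.apply_mono (hL : PosOn L n m) (hp : IsExtremal L n m p)
    (hO : ∀ x ∈ spaceF1 L n m, ∀ y ∈ spaceF2 L n m, sesq L x y = 0) {s t : ℤ}
    (hs : |s| ≤ n) (ht : |t| ≤ m) : L (mono s t) = bsm p s t := by
  have hst := hp.lStable hL hO
  have hlt : ∀ s t : ℤ, |s| ≤ n → |t| ≤ m → (|s| < n ∨ |t| < m) →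
      (L - bsLin p) (mono s t) = 0 := by
    intro s t hs ht h
    rw [LinearMap.sub_apply, bsLin_mono, sub_eq_zero]
    rcases h with h | h
    · exact hp.apply_mono_of_abs_lt' hL hO (by omega) ht
    · exact hp.apply_mono_of_abs_lt hL hO hs (by omega)
  have hsub : ∀ f g, sesq (L - bsLin p) f g = sesq L f g - sesq (bsLin p) f g := fun f g => rfl
  -- In ⟨z^n w^m, p⟩ the corner moment has the nonzero coefficient conj p(0,0); all other moments
  -- are already known to agree.
  have hnm : L (mono n m) = bsm p n m := by
    have h1 : sesq (L - bsLin p) (mono n m) p = 0 := by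
      rw [hsub, hp.sesq_corner hL, sesq_bsLin_corner hp.mem hst, sub_self]
    have hp' : p ∈ polySpace n (((m + 1 : ℕ) : ℤ) - 1) := by simpa using hp.mem
    rw [sesq_mono_eq_single hp' (Nat.succ_pos m)] at h1
    · have := (mul_eq_zero.1 h1).resolve_left (by simpa using hp.coeff_ne_zero)
      rw [LinearMap.sub_apply, bsLin_mono, sub_eq_zero] at this
      simpa using this
    · intro s t hs ht hst
      rw [hlt _ _ (abs_le.2 (by omega)) (abs_le.2 (by omega)), mul_zero]
      rcases hst with h | h
      · exact Or.inl (abs_lt.2 (by omega))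
      · exact Or.inr (abs_lt.2 (by omega))
  have hnm' : n ≠ 0 → m ≠ 0 → L (mono n (-m)) = bsm p n (-m) := by
    intro hn hm
    have hL' : PosOn L n ((m : ℤ) - 1) := hL.mono le_rfl (by omega)
    obtain ⟨b, hb⟩ := exists_isONB_spaceG hL'
    -- An element of 𝓖 whose z⁰ part is w^(m-1): in ⟨z^n w⁻¹, g⟩ the moments with first index n then
    -- reduce to (n, -m).
    obtain ⟨g, hg, hgc⟩ := exists_mem_spaceG_coeff hL' (y := mono 0 ((m : ℤ) - 1))
      (mono_mem_polySpace le_rfl (by omega) (by omega) le_rfl)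
    have h1 : sesq (L - bsLin p) (mono n (-1)) g = 0 := by
      rw [hsub, sesq_neg_one_of_orth hL hO hg hn le_rfl, sesq_bsLin_neg_one hL' hb hp.mem hst
        (fun z hz => matW_eq_weightG_of_orth hL hp hb hst hO hz) hn hg, sub_self]
    rw [sesq_mono_eq_single hg.1 (Nat.sub_lt (Nat.pos_of_ne_zero hm) one_pos)] at h1
    · have h2 : (-1 : ℤ) - ((m - 1 : ℕ) : ℤ) = -m := by omega
      have h3 : (((m - 1 : ℕ) : ℤ)) = (m : ℤ) - 1 := by omega
      rw [h2, h3] at h1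
      have h4 : g.coeff (0, (m : ℤ) - 1) = 1 := by rw [hgc, coeff_mono]; simp
      rw [h4, map_one, one_mul] at h1
      rwa [LinearMap.sub_apply, bsLin_mono, sub_eq_zero] at h1
    · intro s t hs ht hst
      by_cases h : s = 0
      · rw [h, Nat.cast_zero, hgc, coeff_mono, if_neg (by omega), map_zero, zero_mul]
      · rw [hlt _ _ (abs_le.2 (by omega)) (abs_le.2 (by omega)) (Or.inl (abs_lt.2 (by omega))),
          mul_zero]
  have hneg : ∀ s t : ℤ, |s| ≤ n → |t| ≤ m → L (mono s t) = bsm p s t →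
      L (mono (-s) (-t)) = bsm p (-s) (-t) := by
    intro s t hs ht h
    rw [bsm_neg, ← h, ← hL.herm _ (mono_mem_laurentSpace hs ht), conjInv_mono]
  by_cases h : |s| < n ∨ |t| < m
  · have := hlt s t hs ht h
    rwa [LinearMap.sub_apply, bsLin_mono, sub_eq_zero] at this
  · have hs' : s = n ∨ s = -n := by rcases abs_cases s with h' | h' <;> omega
    have ht' : t = m ∨ t = -m := by rcases abs_cases t with h' | h' <;> omega
    have key : L (mono n (-m)) = bsm p n (-m) := by
      by_cases hn : n = 0
      · subst hn
        have := hneg _ _ (by simp) (by simp) hnm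
        simpa using this
      · by_cases hm : m = 0
        · subst hm; simpa using hnm
        · exact hnm' hn hm
    rcases hs' with rfl | rfl <;> rcases ht' with rfl | rfl
    · exact hnm
    · exact key
    · have := hneg _ _ (by simp) (by simp) key
      rwa [neg_neg] at this
    · exact hneg _ _ (by simp) (by simp) hnm

/-- If the moments are Bernstein–Szegő moments, then `𝓕¹` and `𝓕²` are orthogonal. -/
theorem orth_of_apply_mono (hL : PosOn L n m) (hp : p ∈ polySpace n m) (hs : LStable p)
    (h : ∀ f ∈ laurentSpace n m, L f = bsLin p f) :
    ∀ x ∈ spaceF1 L n m, ∀ y ∈ spaceF2 L n m, sesq L x y = 0 := by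
  have hL' : PosOn L n ((m : ℤ) - 1) := hL.mono le_rfl (by omega)
  obtain ⟨b, hb⟩ := exists_isONB_spaceG hL'
  refine orth_of_sesq_neg_one hL fun g hg j hj hjn => ?_
  -- Since z^j w⁻¹ is outside `𝓟_{n,m}`, both arguments are multiplied by w before the two
  -- functionals are compared.
  rw [← sesq_bsLin_neg_one hL' hb hp hs (fun z hz => matW_eq_weightG hL' hb hp hs
    (fun f hf => h f (laurentSpace_mono le_rfl (by omega) hf)) hz) hj hg,
    ← sesq_mono_mul L 0 1, ← sesq_mono_mul (bsLin p) 0 1, mono_mul_mono]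
  exact sesq_congr h (mono_mem_polySpace (by omega) (by omega) (by omega) (by omega))
    (mono_mul_mem hg.1 le_rfl (by omega) (by omega) (by omega))

end

/-! ### Transfer to the given linear form and to `MvPolynomial` -/

section

variable {L : Laurent →ₗ[ℂ] ℂ} {n m : ℕ}

/-- Positivity of the quadratic form implies hermitian symmetry. -/
theorem posOn_of_pos (h : ∀ f ∈ polySpace n m, f ≠ 0 → 0 < sesq L f f) : PosOn L n m := by
  have him : ∀ f ∈ polySpace n m, (sesq L f f).im = 0 := fun f hf => by
    by_cases h0 : f = 0
    · simp [h0]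
    · exact (Complex.pos_iff.1 (h f hf h0)).2.symm
  have hsymm : ∀ f ∈ polySpace n m, ∀ g ∈ polySpace n m, sesq L g f = conj (sesq L f g) := by
    intro f hf g hg
    have h1 := him _ (Submodule.add_mem _ hf hg)
    have h2 := him _ (Submodule.add_mem _ hf (Submodule.smul_mem _ Complex.I hg))
    simp only [map_add, map_smulₛₗ, LinearMap.add_apply, LinearMap.smul_apply, smul_eq_mul,
      RingHom.id_apply, Complex.conj_I, Complex.add_im, Complex.add_re, Complex.mul_im, Complex.mul_re,
      Complex.I_re, Complex.I_im, Complex.neg_re, Complex.neg_im, him f hf, him g hg] at h1 h2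
    apply Complex.ext
    · simp only [Complex.conj_re]; linarith
    · simp only [Complex.conj_im]; linarith
  refine ⟨fun f hf => ?_, fun f hf h0 => (Complex.pos_iff.1 (h f hf h0)).1⟩
  induction hf using Submodule.span_induction with
  | zero => simp
  | add x y _ _ hx hy => simp [hx, hy]
  | smul a x _ hx => simp [conjInv_smul, hx]
  | mem x hx =>
    obtain ⟨s, t, hs, ht, rfl⟩ := hx
    rw [abs_le] at hs ht
    have := hsymm (mono (max s 0) (max t 0))
      (mono_mem_polySpace (by omega) (by omega) (by omega) (by omega))
      (mono (max (-s) 0) (max (-t) 0))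
      (mono_mem_polySpace (by omega) (by omega) (by omega) (by omega))
    have h1 : max s 0 - max (-s) 0 = s := by omega
    have h2 : max t 0 - max (-t) 0 = t := by omega
    have h3 : max (-s) 0 - max s 0 = -s := by omega
    have h4 : max (-t) 0 - max t 0 = -t := by omega
    rwa [sesq_mono, sesq_mono, h1, h2, h3, h4, ← conjInv_mono] at this

section restrict

variable {T : laurentSpace n m →ₗ[ℂ] ℂ} (hLT : ∀ f : laurentSpace n m, L f = T f)
include hLT

theorem form_eq_sesq (f g : polySpace n m) : form T f g = sesq L f g :=
  (hLT ⟨(f : Laurent) * conjInv (g : Laurent), mul_conjInv_mem f.2 g.2⟩).symm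

theorem IsPositive.posOn (hT : IsPositive T) : PosOn L n m :=
  posOn_of_pos fun f hf h0 => by
    have := hT ⟨f, hf⟩ (fun h => h0 (congrArg Subtype.val h))
    rwa [form_eq_sesq hLT] at this

theorem mem_ominus_iff {S R : Submodule ℂ Laurent} (hR : R ≤ polySpace n m) (x : polySpace n m) :
    x ∈ ominus T (S.comap (polySpace n m).subtype) (R.comap (polySpace n m).subtype) ↔
      (x : Laurent) ∈ perp L S R := by
  rw [ominus, Submodule.mem_inf, Submodule.mem_orthogonalBilin_iff, mem_perp]
  refine and_congr Iff.rfl ⟨fun h y hy => ?_, fun h y hy => ?_⟩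
  · rw [← form_eq_sesq hLT x ⟨y, hR hy⟩]
    exact h ⟨y, hR hy⟩ hy
  · exact (form_eq_sesq hLT x y).trans (h y hy)

theorem orthogonal_iff : Orthogonal T (F1 T ((n : ℤ) - 1) m) (F2 T n ((m : ℤ) - 1)) ↔
    ∀ x ∈ spaceF1 L n m, ∀ y ∈ spaceF2 L n m, sesq L x y = 0 := by
  have hR : polySpace ((n : ℤ) - 1) ((m : ℤ) - 1) ≤ polySpace n m :=
    polySpace_mono (by omega) (by omega)
  refine ⟨fun h x hx y hy => ?_, fun h x hx y hy => ?_⟩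
  · rw [← form_eq_sesq hLT ⟨x, spaceF1_le L n m hx⟩ ⟨y, spaceF2_le L n m hy⟩]
    exact h _ ((mem_ominus_iff hLT hR ⟨x, spaceF1_le L n m hx⟩).2 hx) _
      ((mem_ominus_iff hLT hR ⟨y, spaceF2_le L n m hy⟩).2 hy)
  · rw [form_eq_sesq hLT]
    exact h _ ((mem_ominus_iff hLT hR _).1 hx) _ ((mem_ominus_iff hLT hR _).1 hy)

end restrict

theorem bsMoment_eq_bsm {p : MvPolynomial (Fin 2) ℂ} {q : Laurent}
    (h : ∀ z w : ℂ, MvPolynomial.eval ![z, w] p = ev z w q) (j k : ℤ) :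
    bsMoment p j k = bsm q j k := by
  rw [bsMoment, bsm_eq_integral, ← intervalIntegral.integral_const_mul]
  congr 1
  ext θ
  rw [← intervalIntegral.integral_const_mul]
  congr 1
  ext φ
  simp only [h, circleMap, Complex.ofReal_one, one_mul, zero_add]
  rw [div_mul_eq_div_div, mul_div_assoc]
  simp only [div_eq_mul_inv]
  ring

theorem exists_laurent {p : MvPolynomial (Fin 2) ℂ} (hn : p.degreeOf 0 ≤ n)
    (hm : p.degreeOf 1 ≤ m) :
    ∃ q ∈ polySpace n m, ∀ z w : ℂ, MvPolynomial.eval ![z, w] p = ev z w q := by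
  refine ⟨∑ d ∈ p.support, p.coeff d • mono (d 0 : ℕ) (d 1 : ℕ),
    Submodule.sum_mem _ fun d hd => Submodule.smul_mem _ _ ?_, fun z w => ?_⟩
  · have h0 := (MvPolynomial.degreeOf_le_iff.1 hn) d hd
    have h1 := (MvPolynomial.degreeOf_le_iff.1 hm) d hd
    exact mono_mem_polySpace (by omega) (by omega) (by omega) (by omega)
  · rw [MvPolynomial.eval_eq', map_sum]
    refine Finset.sum_congr rfl fun d _ => ?_
    simp [ev_mono, Fin.prod_univ_two]

theorem exists_mvPolynomial {q : Laurent} (hq : q ∈ polySpace n m) :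
    ∃ p : MvPolynomial (Fin 2) ℂ, p.degreeOf 0 ≤ n ∧ p.degreeOf 1 ≤ m ∧
      ∀ z w : ℂ, MvPolynomial.eval ![z, w] p = ev z w q := by
  induction hq using Submodule.span_induction with
  | zero => exact ⟨0, by simp, by simp, by simp⟩
  | add x y _ _ hx hy =>
    obtain ⟨a, ha0, ha1, ha⟩ := hx
    obtain ⟨b, hb0, hb1, hb⟩ := hy
    exact ⟨a + b, (MvPolynomial.degreeOf_add_le _ _ _).trans (max_le ha0 hb0),
      (MvPolynomial.degreeOf_add_le _ _ _).trans (max_le ha1 hb1), fun z w => by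
        rw [map_add, map_add, ha, hb]⟩
  | smul c x _ hx =>
    obtain ⟨a, ha0, ha1, ha⟩ := hx
    exact ⟨MvPolynomial.C c * a, (MvPolynomial.degreeOf_C_mul_le _ _ _).trans ha0,
      (MvPolynomial.degreeOf_C_mul_le _ _ _).trans ha1, fun z w => by
        rw [map_mul, MvPolynomial.eval_C, map_smul, ha, smul_eq_mul]⟩
  | mem x hx =>
    obtain ⟨s, t, hs, ht, rfl⟩ := hx
    lift s to ℕ using hs.1
    lift t to ℕ using ht.1
    refine ⟨MvPolynomial.monomial (Finsupp.single 0 s + Finsupp.single 1 t) 1, ?_, ?_,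
      fun z w => ?_⟩
    · rw [MvPolynomial.degreeOf_monomial_eq _ _ one_ne_zero]
      simp
      omega
    · rw [MvPolynomial.degreeOf_monomial_eq _ _ one_ne_zero]
      simp
      omega
    · rw [MvPolynomial.eval_monomial, ev_mono,
        Finsupp.prod_fintype _ _ fun i => pow_zero _]
      simp

end

end BernsteinSzego

end

theorem mainTheorem7 (n m : ℕ) (T : BernsteinSzego.laurentSpace n m →ₗ[ℂ] ℂ)
    (hT : BernsteinSzego.IsPositive T) :
    (∃ p : MvPolynomial (Fin 2) ℂ,
        BernsteinSzego.IsStable p ∧ p.degreeOf 0 ≤ n ∧ p.degreeOf 1 ≤ m ∧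
        ∀ (j k : ℤ) (hj : |j| ≤ (n : ℤ)) (hk : |k| ≤ (m : ℤ)),
          T ⟨BernsteinSzego.mono j k, BernsteinSzego.mono_mem_laurentSpace hj hk⟩ =
            BernsteinSzego.bsMoment p j k) ↔
      BernsteinSzego.Orthogonal T (BernsteinSzego.F1 T ((n : ℤ) - 1) m)
        (BernsteinSzego.F2 T n ((m : ℤ) - 1)) := by
  open BernsteinSzego in
  -- An arbitrary extension to all Laurent polynomials suffices: the hypotheses and conclusions only
  -- involve its values on `𝓛_{n,m}`.
  obtain ⟨L, hL⟩ := LinearMap.exists_extend T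
  have hLT : ∀ f : laurentSpace n m, L f = T f := fun f => LinearMap.congr_fun hL f
  have hpos := hT.posOn hLT
  rw [orthogonal_iff hLT]
  constructor
  · rintro ⟨p, hp, hpn, hpm, h⟩
    obtain ⟨q, hq, hpq⟩ := exists_laurent hpn hpm
    refine orth_of_apply_mono hpos hq (fun z w hz hw => hpq z w ▸ hp z w hz hw) fun f hf => ?_
    induction hf using Submodule.span_induction with
    | zero => simp
    | add x y _ _ hx hy => rw [map_add, map_add, hx, hy]
    | smul a x _ hx => rw [map_smul, map_smul, hx]
    | mem x hx =>
      obtain ⟨s, t, hs, ht, rfl⟩ := hx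
      rw [bsLin_mono, ← bsMoment_eq_bsm hpq, ← h s t hs ht, ← hLT]
  · intro hO
    obtain ⟨q, hq⟩ := exists_isExtremal hpos
    obtain ⟨p, hpn, hpm, hpq⟩ := exists_mvPolynomial hq.mem
    refine ⟨p, fun z w hz hw => hpq z w ▸ hq.lStable hpos hO z w hz hw, hpn, hpm,
      fun j k hj hk => ?_⟩
    rw [bsMoment_eq_bsm hpq, ← hq.apply_mono hpos hO hj hk, ← hLT]
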